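/- **Conventions.** Logarithms are to base 2. All parameters are functions of a security parameter $\lambda\in\mathbb N$. A function $\mu$ is *negligible* if $p(\lambda)\mu(\lambda)\to0$ for every polynomial $p$, and *superpolynomial* if it is eventually at least $p(\lambda)$ for every polynomial $p$. For $x\in\mathbb Z_q$, $|x|$ is the absolute value of the representative of $x$ in $(-q/2,q/2]$. For $B>0$, $D_{\mathbb Z_q,B}$ is the probability density on $\mathbb Z_q$ that is supported on $\{|x|\le B\}$ and proportional there to $e^{-\pi|x|^2/B^2}$. An *efficient quantum procedure* is a family, indexed by $\lambda$, of quantum circuits (gates $H,T,\mathrm{NOT},\mathrm{CNOT}$ and Toffoli) acting on the binary encoding of the input, on an advice state and on ancillas $|0\rangle$, some qubits being measured at the end in the computational basis, such that the numbers of gates, ancillas and advice qubits are polynomially bounded in $\lambda$; the advice state is an arbitrary pure state depending on $\lambda$. (Uniformly generated polynomial-time families of circuits are a special case.) **LWE assumption.** $\mathrm{LWE}_{\ell,q,\chi}$ says that for every $m'$ that is at most a polynomial in $\ell\log q$ and every efficient quantum procedure with one output bit, the difference of its probabilities of outputting $1$ on $(\mathbf A,\mathbf A\mathbf s+\mathbf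 e)$ and on $(\mathbf A,\mathbf u)$ is negligible in absolute value, where $\mathbf A\in\mathbb Z_q^{m'\times\ell}$, $\mathbf s\in\mathbb Z_q^\ell$ and $\mathbf u\in\mathbb Z_q^{m'}$ are uniform and $\mathbf e\leftarrow\chi^{m'}$. **Parameters.** Let $C,C_T>0$ be constants. Let $q$ be prime, let $\ell,n,m\ge1$ and $w=n\lceil\log q\rceil$ be polynomially bounded, let $B_L,B_V$ be positive integers and $B_P=\frac{q}{2C_T\sqrt{mn\log q}}$, such that $n\ge C\,\ell\log q$ and $m\ge C\,n\log q$ for all large $\lambda$, $2\sqrt n\le B_L<B_V<B_P$ for all $\lambda$, and $B_P/B_V$ and $B_V/B_L$ are superpolynomial. **Key generation.** $\mathrm{GEN}$ samples independently a matrix $\mathbf A\in\mathbb Z_q^{m\times n}$ by $\mathrm{GenTrap}$, a uniform $s\in\{0,1\}^n$ (written $\mathbf s$ as an element of $\mathbb Z_q^n$), and $\mathbf e\in\mathbb Z_q^m$ with independent coordinates of density $D_{\mathbb Z_q,B_V}$; the key is $(\mathbf A,\mathbf A\mathbf s+\mathbf e)$. Here $\mathrm{GenTrap}$ returns the matrix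 whose first $\bar m=m-w$ rows form a uniform matrix $\bar{\mathbf A}\in\mathbb Z_q^{\bar m\times n}$ and whose last $w$ rows form $\mathbf G-\mathbf R^T\bar{\mathbf A}$, where $\mathbf R\in\{-1,0,1\}^{\bar m\times w}$ has independent entries equal to $0$ with probability $\frac12$ and to $\pm1$ with probability $\frac14$ each, and $\mathbf G=\mathbf I_n\otimes(1,2,\dots,2^{\lceil\log q\rceil-1})^T$. **Hardcore sets.** Let $J:\mathbb Z_q^n\to\{0,1\}^w$ be the coordinatewise binary representation (representatives in $\{0,\dots,q-1\}$, $\lceil\log q\rceil$ bits each). For $b\in\{0,1\}$, $x\in\mathbb Z_q^n$, $d\in\{0,1\}^w$ let $I_{b,x}(d)\in\{0,1\}^n$ have as $i$-th coordinate the inner product mod 2 of the $i$-th blocks of $\lceil\log q\rceil$ bits of $d$ and of $J(x)\oplus J(x-(-1)^b\mathbf 1)$, where $\mathbf 1=(1,\dots,1)$. Let $G_{b,x}$ be the set of all $d$ for which the first $\lfloor n/2\rfloor$ coordinates (if $b=0$), respectively the last $n-\lfloor n/2\rfloor$ coordinates (if $b=1$), of $I_{b,x}(d)$ are not all $0$.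 For $s\in\{0,1\}^n$ let $\hat G_{s,b,x}=G_{0,x_0}\cap G_{1,x_1}$, where $x_b=x$ and $x_1=x_0-\mathbf s$. Put $$H_s=\big\{\big(b,x,d,\;d\cdot(J(x)\oplus J(x-(-1)^b\mathbf s))\big)\;\big|\;b\in\{0,1\},\ x\in\mathbb Z_q^n,\ d\in\hat G_{s,b,x}\big\},$$ $$\overline H_s=\{(b,x,d,c)\mid(b,x,d,c\oplus1)\in H_s\}.$$ **Lemma (adaptive hardcore bit).** There is a universal constant $C>0$ such that for every $C_T>0$ and all parameters as above the following holds. Assume $\mathrm{LWE}_{\ell,q,D_{\mathbb Z_q,B_L}}$. Then for every efficient quantum procedure $\mathcal A$ that takes a pair in $\mathbb Z_q^{m\times n}\times\mathbb Z_q^m$ and outputs (the binary encoding of) a tuple $(b,x,d,c)\in\{0,1\}\times\mathbb Z_q^n\times\{0,1\}^w\times\{0,1\}$ there is a negligible $\mu$ such that for all $\lambda$ $$\Big|\Pr\big[\mathcal A(\mathbf A,\mathbf A\mathbf s+\mathbf e)\in H_s\big]-\Pr\big[\mathcal A(\mathbf A,\mathbf A\mathbf s+\mathbf e)\in\overline H_s\big]\Big|\le\mu(\lambda),$$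 the probabilities being over $\mathrm{GEN}$ (including $s$) and the measurement of $\mathcal A$. The same holds, with $\mu$ depending also on the distribution, if in $\mathrm{GEN}$ the matrix $\mathbf A$ is drawn from any other distribution on $\mathbb Z_q^{m\times n}$ whose total variation distance from uniform is negligible in $\lambda$. -/

import Mathlib

open scoped BigOperators
open Filter

namespace LWE

/-! ### Asymptotics in the security parameter -/

/-- Negligible functions: `p(t) * f t → 0` for every polynomial `p`. -/
def Negligible (f : ℕ → ℝ) : Prop :=
  ∀ p : Polynomial ℝ, Tendsto (fun t : ℕ => p.eval (t : ℝ) * f t) atTop (nhds 0)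

/-- Polynomially bounded functions. -/
def PolyBounded (f : ℕ → ℕ) : Prop :=
  ∃ p : Polynomial ℝ, ∀ t : ℕ, (f t : ℝ) ≤ p.eval (t : ℝ)

/-- Superpolynomial functions: eventually above every polynomial. -/
def SuperPoly (f : ℕ → ℝ) : Prop :=
  ∀ p : Polynomial ℝ, ∀ᶠ t : ℕ in atTop, p.eval (t : ℝ) ≤ f t

/-! ### Densities on finite sets -/

section Densities

variable {α : Type}

/-- Probability densities on a finite set. -/
def IsDensity [Fintype α] (f : α → ℝ) : Prop :=
  (∀ a, 0 ≤ f a) ∧ ∑ a, f a = 1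

/-- The uniform density. -/
noncomputable def unif (α : Type) [Fintype α] : α → ℝ := fun _ => (Fintype.card α : ℝ)⁻¹

/-- Total variation distance. -/
noncomputable def tvDist [Fintype α] (f g : α → ℝ) : ℝ := (1 / 2) * ∑ a, |f a - g a|

end Densities

open Classical in
/-- The truncated discrete Gaussian density on `ℤ_q` with parameter `B`; the absolute value of a
residue is that of its representative in `(-q/2, q/2]`. -/
noncomputable def truncGaussian (q : ℕ) [NeZero q] (B : ℝ) (x : ZMod q) : ℝ :=
  if |(x.valMinAbs : ℝ)| ≤ B then
    Real.exp (-Real.pi * (x.valMinAbs : ℝ) ^ 2 / B ^ 2) /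
      ∑ y : ZMod q with |(y.valMinAbs : ℝ)| ≤ B,
        Real.exp (-Real.pi * (y.valMinAbs : ℝ) ^ 2 / B ^ 2)
  else 0

/-! ### Quantum circuits -/

/-- Elementary gates on a set `Q` of qubits: Hadamard, `T = diag(1, e^{iπ/4})`, NOT, CNOT and
Toffoli, the last listed qubit being the target. -/
inductive Gate (Q : Type) : Type
  | had (i : Q) : Gate Q
  | tgate (i : Q) : Gate Q
  | not (i : Q) : Gate Q
  | cnot (i j : Q) (hij : i ≠ j) : Gate Q
  | toffoli (i j k : Q) (hij : i ≠ j) (hik : i ≠ k) (hjk : j ≠ k) : Gate Q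

/-- The action of a gate on (the amplitudes in the computational basis of) a state vector. -/
noncomputable def Gate.apply {Q : Type} [DecidableEq Q] (g : Gate Q)
    (ψ : (Q → Bool) → ℂ) : (Q → Bool) → ℂ :=
  match g with
  | .had i => fun x =>
      ((Real.sqrt 2 : ℝ) : ℂ)⁻¹ * (ψ (Function.update x i false) +
        (if x i then -1 else 1) * ψ (Function.update x i true))
  | .tgate i => fun x => (if x i then Complex.exp (Complex.I * Real.pi / 4) else 1) * ψ x
  | .not i => fun x => ψ (Function.update x i (!(x i)))
  | .cnot i j _ => fun x => ψ (Function.update x j (xor (x j) (x i)))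
  | .toffoli i j k _ _ _ => fun x => ψ (Function.update x k (xor (x k) (x i && x j)))

/-- A quantum circuit with quantum advice, with input bits indexed by `ι` and output bits indexed
by `o`. It acts on the input register, an advice register and a register of ancillas that are
initialised to `0`; at the end the qubits `output` are measured in the computational basis. -/
structure QCircuit (ι o : Type) where
  adviceQubits : ℕ
  ancillas : ℕ
  advice : (Fin adviceQubits → Bool) → ℂ
  advice_norm : ∑ z, ‖advice z‖ ^ 2 = 1
  gates : List (Gate (ι ⊕ Fin adviceQubits ⊕ Fin ancillas))
  output : o ↪ (ι ⊕ Fin adviceQubits ⊕ Fin ancillas)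

namespace QCircuit

variable {ι o : Type}

/-- The qubits of a circuit. -/
abbrev Qubit (C : QCircuit ι o) : Type := ι ⊕ Fin C.adviceQubits ⊕ Fin C.ancillas

/-- The size of a circuit: number of advice qubits, of ancillas and of gates. -/
def size (C : QCircuit ι o) : ℕ := C.adviceQubits + C.ancillas + C.gates.length

open Classical in
/-- The state `|z⟩ ⊗ |advice⟩ ⊗ |0…0⟩`. -/
noncomputable def initial (C : QCircuit ι o) (z : ι → Bool) : (C.Qubit → Bool) → ℂ :=
  fun x =>
    if (∀ i, x (Sum.inl i) = z i) ∧ (∀ j, x (Sum.inr (Sum.inr j)) = false) then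
      C.advice (fun j => x (Sum.inr (Sum.inl j)))
    else 0

/-- The state after all gates, applied in the order of the list. -/
noncomputable def final [DecidableEq ι] (C : QCircuit ι o) (z : ι → Bool) :
    (C.Qubit → Bool) → ℂ :=
  C.gates.foldl (fun ψ g => g.apply ψ) (C.initial z)

open Classical in
/-- The probability that the circuit, on input `z`, outputs `y`. -/
noncomputable def prob [Fintype ι] [DecidableEq ι] (C : QCircuit ι o)
    (z : ι → Bool) (y : o → Bool) : ℝ :=
  ∑ x : C.Qubit → Bool with ∀ i, x (C.output i) = y i, ‖C.final z x‖ ^ 2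

end QCircuit

/-- Efficient quantum procedures: families of circuits of polynomial size, with polynomial-size
quantum advice. Every polynomial-time generated family of circuits is one of them. -/
def PolySize {ι o : ℕ → Type} (C : ∀ t, QCircuit (ι t) (o t)) : Prop :=
  PolyBounded fun t => (C t).size

/-! ### Binary encodings -/

/-- `⌈log₂ q⌉`, the number of bits of an element of `ℤ_q`. -/
abbrev bitLen (q : ℕ) : ℕ := Nat.clog 2 q

/-- The binary representation of `a ∈ {0, …, q-1}`, least significant bit first. -/
def bits {q : ℕ} (a : ZMod q) (j : Fin (bitLen q)) : Bool := a.val.testBit j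

/-- Bit strings of length `n ⌈log₂ q⌉`, in `n` blocks of length `⌈log₂ q⌉`. -/
abbrev Str (n q : ℕ) : Type := Fin n × Fin (bitLen q) → Bool

/-- The map `J` taking `x ∈ ℤ_q^n` to its binary representation. -/
def J {n q : ℕ} (x : Fin n → ZMod q) : Str n q := fun p => bits (x p.1) p.2

/-- Positions of the bits that represent a pair in `ℤ_q^{m×n} × ℤ_q^m`. -/
abbrev SampleBit (m n q : ℕ) : Type := ((Fin m × Fin n) ⊕ Fin m) × Fin (bitLen q)

/-- The binary representation of a pair in `ℤ_q^{m×n} × ℤ_q^m`. -/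
def encodeSample {m n q : ℕ} (A : Matrix (Fin m) (Fin n) (ZMod q)) (u : Fin m → ZMod q) :
    SampleBit m n q → Bool :=
  fun p => bits (Sum.elim (fun ij => A ij.1 ij.2) u p.1) p.2

/-- The tuples `(b, x, d, c)` in `{0,1} × ℤ_q^n × {0,1}^w × {0,1}`, where `w = n ⌈log₂ q⌉`. -/
abbrev Tuple (n q : ℕ) : Type := Bool × (Fin n → ZMod q) × Str n q × Bool

/-- Positions of the bits that represent a tuple `(b, x, d, c)`. -/
abbrev TupleBit (n q : ℕ) : Type :=
  Unit ⊕ (Fin n × Fin (bitLen q)) ⊕ (Fin n × Fin (bitLen q)) ⊕ Unit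

/-- The binary representation of a tuple `(b, x, d, c)`. -/
def encodeTuple {n q : ℕ} (t : Tuple n q) : TupleBit n q → Bool :=
  Sum.elim (fun _ => t.1) (Sum.elim (J t.2.1) (Sum.elim t.2.2.1 (fun _ => t.2.2.2)))

/-! ### The LWE assumption -/

/-- The advantage of a circuit in distinguishing `(A, A s + e)` from `(A, u)`. -/
noncomputable def lweAdvantage (n m q : ℕ) [NeZero q] (χ : ZMod q → ℝ)
    (D : QCircuit (SampleBit m n q) Unit) : ℝ :=
  |(∑ A : Matrix (Fin m) (Fin n) (ZMod q), ∑ s : Fin n → ZMod q, ∑ e : Fin m → ZMod q,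
      unif (Matrix (Fin m) (Fin n) (ZMod q)) A * unif (Fin n → ZMod q) s * (∏ i, χ (e i)) *
        D.prob (encodeSample A (A.mulVec s + e)) (fun _ => true)) -
    ∑ A : Matrix (Fin m) (Fin n) (ZMod q), ∑ u : Fin m → ZMod q,
      unif (Matrix (Fin m) (Fin n) (ZMod q)) A * unif (Fin m → ZMod q) u *
        D.prob (encodeSample A u) (fun _ => true)|

/-- The assumption `LWE_{n,q,χ}`: for every number `m` of samples that is at most a polynomial in
`n log q`, no efficient quantum procedure with quantum advice has non-negligible advantage. -/
def LWEAssumption (n q : ℕ → ℕ) [∀ t, NeZero (q t)] (χ : ∀ t, ZMod (q t) → ℝ) : Prop :=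
  ∀ m : ℕ → ℕ,
    (∃ p : Polynomial ℝ, ∀ t, (m t : ℝ) ≤ p.eval ((n t : ℝ) * Real.logb 2 (q t))) →
    ∀ D : ∀ t, QCircuit (SampleBit (m t) (n t) (q t)) Unit, PolySize D →
      Negligible fun t => lweAdvantage (n t) (m t) (q t) (χ t) (D t)

/-! ### Parameters -/

/-- The conditions on the parameters, as functions of the security parameter. `C` is the constant
in both `Ω(·)`; `C_T` is the constant in the definition of `B_P`. -/
structure Conditions (C C_T : ℝ) (ℓ n m q B_L B_V : ℕ → ℕ) (B_P : ℕ → ℝ) : Prop where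
  ell_pos : ∀ t, 1 ≤ ℓ t
  n_pos : ∀ t, 1 ≤ n t
  m_pos : ∀ t, 1 ≤ m t
  ell_poly : PolyBounded ℓ
  n_poly : PolyBounded n
  m_poly : PolyBounded m
  w_poly : PolyBounded fun t => n t * bitLen (q t)
  n_large : ∀ᶠ t in atTop, C * ((ℓ t : ℝ) * Real.logb 2 (q t)) ≤ n t
  m_large : ∀ᶠ t in atTop, C * ((n t : ℝ) * Real.logb 2 (q t)) ≤ m t
  B_P_eq : ∀ t, B_P t =
    (q t : ℝ) / (2 * C_T * Real.sqrt ((m t : ℝ) * (n t : ℝ) * Real.logb 2 (q t)))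
  le_B_L : ∀ t, 2 * Real.sqrt (n t) ≤ B_L t
  B_L_lt : ∀ t, B_L t < B_V t
  B_V_lt : ∀ t, (B_V t : ℝ) < B_P t
  ratio_PV : SuperPoly fun t => B_P t / B_V t
  ratio_VL : SuperPoly fun t => (B_V t : ℝ) / B_L t

/-! ### Key generation -/

/-- The matrix with a trapdoor built from `Abar` and a matrix `R` with entries in `{-1, 0, 1}`:
its first `m - n ⌈log₂ q⌉` rows are those of `Abar`, and its last `n ⌈log₂ q⌉` rows are those of
`G - Rᵀ Abar`, where row `i ⌈log₂ q⌉ + j` of the gadget matrix `G` is `2^j` times the `i`-th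
unit vector. An entry of `R` is the difference of a pair of bits. -/
def trapMatrix {m n q : ℕ}
    (Abar : Matrix (Fin (m - n * bitLen q)) (Fin n) (ZMod q))
    (R : Fin (m - n * bitLen q) → Fin (n * bitLen q) → Bool × Bool) :
    Matrix (Fin m) (Fin n) (ZMod q) :=
  Matrix.of fun i j =>
    if h : i.val < m - n * bitLen q then Abar ⟨i.val, h⟩ j
    else
      (if (i.val - (m - n * bitLen q)) / bitLen q = j.val then
          (2 : ZMod q) ^ ((i.val - (m - n * bitLen q)) % bitLen q) else 0) -
        ∑ a : Fin (m - n * bitLen q),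
          (((R a ⟨i.val - (m - n * bitLen q), by have := i.isLt; omega⟩).1.toNat : ZMod q) -
            ((R a ⟨i.val - (m - n * bitLen q), by have := i.isLt; omega⟩).2.toNat : ZMod q)) *
              Abar a j

open Classical in
/-- The density of the matrix returned by `GenTrap(1^n, 1^m, q)`: `Abar` is uniform and the entries
of the trapdoor `R` are independent, equal to `0` with probability `1/2` and to `1` and `-1` with
probability `1/4` each. -/
noncomputable def genTrap (m n q : ℕ) [NeZero q] (A : Matrix (Fin m) (Fin n) (ZMod q)) : ℝ :=
  ∑ Abar : Matrix (Fin (m - n * bitLen q)) (Fin n) (ZMod q),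
    ∑ R : Fin (m - n * bitLen q) → Fin (n * bitLen q) → Bool × Bool,
      if trapMatrix Abar R = A then
        unif (Matrix (Fin (m - n * bitLen q)) (Fin n) (ZMod q)) Abar *
          unif (Fin (m - n * bitLen q) → Fin (n * bitLen q) → Bool × Bool) R
      else 0

/-! ### The hardcore sets -/

section Hardcore

variable {n q : ℕ}

/-- A binary vector as an element of `ℤ_q^n`. -/
def vec (q : ℕ) (s : Fin n → Bool) : Fin n → ZMod q := fun i => if s i then 1 else 0

/-- The vector `x - (-1)^b v`. -/
def move (b : Bool) (x v : Fin n → ZMod q) : Fin n → ZMod q := if b then x + v else x - v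

/-- The inner product mod 2 of two bit strings. -/
def dot {κ : Type} [Fintype κ] (d z : κ → Bool) : Bool :=
  decide (Odd (Finset.univ.filter fun i => (d i && z i) = true).card)

/-- `I_{b,x}(d) ∈ {0,1}^n`: coordinate `i` is the inner product mod 2 of the `i`-th blocks of `d`
and of `J(x) ⊕ J(x - (-1)^b 1)`. -/
def I (b : Bool) (x : Fin n → ZMod q) (d : Str n q) (i : Fin n) : Bool :=
  dot (fun j => d (i, j)) (fun j => xor (J x (i, j)) (J (move b x 1) (i, j)))

/-- The set `G_{k,b,x}`: the first half (if `b = 0`) or the last half (if `b = 1`) of the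
coordinates of `I_{b,x}(d)` is not all zero. -/
def G (b : Bool) (x : Fin n → ZMod q) : Set (Str n q) :=
  {d | ∃ i : Fin n, (if b then n / 2 ≤ i.val else i.val < n / 2) ∧ I b x d i = true}

/-- The good set `G_{k,0,x_0} ∩ G_{k,1,x_1}`, where `x_b = x` and `x_1 = x_0 - s`. -/
def goodSet (s : Fin n → Bool) (b : Bool) (x : Fin n → ZMod q) : Set (Str n q) :=
  if b then G false (move true x (vec q s)) ∩ G true x
  else G false x ∩ G true (move false x (vec q s))

/-- The set `H_s`. -/
def H (q : ℕ) (s : Fin n → Bool) : Set (Tuple n q) :=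
  {t | ∃ (b : Bool) (x : Fin n → ZMod q) (d : Str n q), d ∈ goodSet s b x ∧
    t = (b, x, d, dot d (fun p => xor (J x p) (J (move b x (vec q s)) p)))}

/-- The complementary set: `(b, x, d, c)` with `(b, x, d, c ⊕ 1) ∈ H_s`. -/
def Hbar (q : ℕ) (s : Fin n → Bool) : Set (Tuple n q) :=
  {t | (t.1, t.2.1, t.2.2.1, !t.2.2.2) ∈ H q s}

end Hardcore

open Classical in
/-- The probability that `𝒜(A, A s + e) ∈ S s`, where `A` has density `gen`, `s` is uniform in
`{0,1}^n` and the entries of `e` are independent with density `χ`. -/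
noncomputable def keyProb {m n q : ℕ} [NeZero q]
    (gen : Matrix (Fin m) (Fin n) (ZMod q) → ℝ) (χ : ZMod q → ℝ)
    (𝒜 : QCircuit (SampleBit m n q) (TupleBit n q)) (S : (Fin n → Bool) → Set (Tuple n q)) : ℝ :=
  ∑ A : Matrix (Fin m) (Fin n) (ZMod q), ∑ s : Fin n → Bool, ∑ e : Fin m → ZMod q,
    gen A * unif (Fin n → Bool) s * (∏ i, χ (e i)) *
      ∑ t : Tuple n q with t ∈ S s,
        𝒜.prob (encodeSample A (A.mulVec (vec q s) + e)) (encodeTuple t)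

end LWE

/-! By the leftover hash lemma the trapdoor matrix is statistically close to uniform
(`tvDist_genTrap_le`), so it suffices to treat uniform `A`; any other almost uniform law is handled
in the same way.

A uniform `A` is then replaced by a lossy one, `A = B C + E`, with `B` and the `ℓ × n` matrix `C`
uniform and `E` Gaussian of an intermediate width `B_M`, the geometric mean of `B_L` and `B_V`. The
exchange is a hybrid argument over columns (`abs_ex_sub_hybEx_le`). The reduction chooses `s` and
`e` itself, so it can form `A s + e` and decide whether the answer lies in `H_s`. The LWE assumption
only grants polynomially many samples in `ℓ log q`, whereas `m` is polynomial in `λ`; `amplify`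
therefore makes `m` samples out of `4 (ℓ + 1) ⌈log q⌉` by taking random combinations with
coefficients in `{-1, 0, 1}` (uniform by leftover hashing) and hiding the combined noise under fresh
noise of width `B_M`.

In the lossy mode `A s + e = B (C s) + (E s + e)`, and `E s` is swallowed by `e` because `B_V / B_M`
is superpolynomial (`abs_ex_acc_lossy_le`). What the adversary sees depends on `s` only through `C
s`, which takes at most `q ^ ℓ` values.

The remaining statement is information-theoretic. For a fixed answer `(b, x, d, c)`, the difference
of the indicators of `H_s` and its complement is, up to the factor saying that `d` is good, the sign
`(-1) ^ (c + D · s)` with `D = I_{b,x}(d)` (`indicator_H_sub`). Goodness depends on `s` only through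
one half of its coordinates, while it forces `D` to be nonzero on the other half. Freezing the first
half leaves a signed count of subset sums of columns of `C`. In its Fourier expansion over `ℤ_q ^ ℓ`
the zero frequency cancels, since `D` does not vanish, and every other frequency has, averaged over
`C`, size at most `(2 cos (π / 8))` to the number of free coordinates (`abs_sum_subset_le`,
`ex_leak_le`). After normalisation the advantage is at most `q ^ ℓ * 2 * 0.924 ^ (n / 2)`, which is
at most `2 / q` once `n ≥ 50 ℓ ⌈log q⌉`, and `1 / q` is negligible.

That the reduction is a circuit of polynomial size is proved through straight-line programs: their
cost is counted by `Gen`, they become reversible circuits in `Chain.exists_circuit`, and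
`exists_wrapped_circuit` places them around the adversary. -/

namespace LWE

/-! ### Expectations with respect to densities on finite sets -/

section Expectation

variable {α β : Type} [Fintype α] [Fintype β]

/-- The expectation of `f` under `p`. -/
def ex (p : α → ℝ) (f : α → ℝ) : ℝ := ∑ a, p a * f a

/-- The `ℓ¹` distance of two functions. -/
def l1 (p r : α → ℝ) : ℝ := ∑ a, |p a - r a|

lemma isDensity_unif [Nonempty α] : IsDensity (unif α) := by
  refine ⟨fun _ => by unfold unif; positivity, ?_⟩
  have : (Fintype.card α : ℝ) ≠ 0 := by exact_mod_cast Fintype.card_ne_zero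
  simp [unif, this]

lemma ex_comm (p : α → ℝ) (r : β → ℝ) (f : α → β → ℝ) :
    ex p (fun a => ex r (f a)) = ex r (fun b => ex p fun a => f a b) := by
  simp only [ex, Finset.mul_sum]
  rw [Finset.sum_comm]
  exact Finset.sum_congr rfl fun _ _ => Finset.sum_congr rfl fun _ _ => by ring

lemma ex_sub (p f g : α → ℝ) : ex p (fun a => f a - g a) = ex p f - ex p g := by
  simp [ex, mul_sub]

lemma ex_add (p f g : α → ℝ) : ex p (fun a => f a + g a) = ex p f + ex p g := by
  simp [ex, mul_add, Finset.sum_add_distrib]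

lemma ex_const_mul (p : α → ℝ) (c : ℝ) (f : α → ℝ) : ex p (fun a => c * f a) = c * ex p f := by
  simp only [ex, Finset.mul_sum]
  exact Finset.sum_congr rfl fun _ _ => by ring

lemma ex_const {p : α → ℝ} (hp : IsDensity p) (c : ℝ) : ex p (fun _ => c) = c := by
  simp [ex, ← Finset.sum_mul, hp.2]

lemma ex_mono {p : α → ℝ} (hp : IsDensity p) {f g : α → ℝ} (h : ∀ a, f a ≤ g a) :
    ex p f ≤ ex p g :=
  Finset.sum_le_sum fun a _ => mul_le_mul_of_nonneg_left (h a) (hp.1 a)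

lemma abs_ex_le_ex_abs {p : α → ℝ} (hp : IsDensity p) (f : α → ℝ) :
    |ex p f| ≤ ex p fun a => |f a| := by
  refine (Finset.abs_sum_le_sum_abs _ _).trans (Finset.sum_le_sum fun a _ => ?_)
  rw [abs_mul, abs_of_nonneg (hp.1 a)]

lemma abs_ex_le {p : α → ℝ} (hp : IsDensity p) {f : α → ℝ} {c : ℝ} (h : ∀ a, |f a| ≤ c) :
    |ex p f| ≤ c :=
  (abs_ex_le_ex_abs hp f).trans ((ex_mono hp h).trans_eq (ex_const hp c))

lemma abs_ex_sub_ex_le {p : α → ℝ} (hp : IsDensity p) {f g : α → ℝ} {c : ℝ}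
    (h : ∀ a, |f a - g a| ≤ c) : |ex p f - ex p g| ≤ c := by
  rw [← ex_sub]; exact abs_ex_le hp h

lemma ex_le {p : α → ℝ} (hp : IsDensity p) {f : α → ℝ} {c : ℝ} (h : ∀ a, f a ≤ c) :
    ex p f ≤ c :=
  (ex_mono hp h).trans_eq (ex_const hp c)

lemma ex_nonneg {p : α → ℝ} (hp : IsDensity p) {f : α → ℝ} (h : ∀ a, 0 ≤ f a) : 0 ≤ ex p f :=
  Finset.sum_nonneg fun a _ => mul_nonneg (hp.1 a) (h a)

lemma abs_ex_sub_ex_le_l1 (p r : α → ℝ) {f : α → ℝ} (h : ∀ a, |f a| ≤ 1) :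
    |ex p f - ex r f| ≤ l1 p r := by
  unfold ex l1
  rw [← Finset.sum_sub_distrib]
  refine (Finset.abs_sum_le_sum_abs _ _).trans (Finset.sum_le_sum fun a _ => ?_)
  rw [← sub_mul, abs_mul]
  exact mul_le_of_le_one_right (abs_nonneg _) (h a)

/-- The sign of `p - r` is the extremal test function. Through this duality a distance between
densities can be bounded by computing expectations only. -/
lemma l1_le_of_forall_ex {p r : α → ℝ} {c : ℝ}
    (h : ∀ f : α → ℝ, (∀ a, |f a| ≤ 1) → |ex p f - ex r f| ≤ c) : l1 p r ≤ c := by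
  have := h (fun a => SignType.sign (p a - r a)) (fun a => by
    rcases lt_trichotomy (p a - r a) 0 with h | h | h <;> simp [h])
  refine le_trans (le_of_eq ?_) ((le_abs_self _).trans this)
  unfold ex l1
  rw [← Finset.sum_sub_distrib]
  refine Finset.sum_congr rfl fun a _ => ?_
  rw [← sub_mul, mul_comm, sign_mul_self]

lemma l1_triangle (p r s : α → ℝ) : l1 p s ≤ l1 p r + l1 r s := by
  unfold l1
  rw [← Finset.sum_add_distrib]
  exact Finset.sum_le_sum fun a _ => abs_sub_le _ _ _

lemma ex_unif_equiv (e : α ≃ β) (f : β → ℝ) : ex (unif α) (fun a => f (e a)) = ex (unif β) f := by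
  simp only [ex, unif, Fintype.card_congr e]
  exact e.sum_comp fun b => (Fintype.card β : ℝ)⁻¹ * f b

lemma ex_unif_prod (f : α × β → ℝ) :
    ex (unif (α × β)) f = ex (unif α) fun a => ex (unif β) fun b => f (a, b) := by
  simp only [ex, unif, Fintype.card_prod, Fintype.sum_prod_type, Finset.mul_sum]
  refine Finset.sum_congr rfl fun _ _ => Finset.sum_congr rfl fun _ _ => ?_
  push_cast; rw [mul_inv]; ring

/-- A surjective homomorphism of finite groups maps the uniform density to the uniform density. -/
lemma ex_unif_hom [AddCommGroup α] [AddCommGroup β] (φ : α →+ β) (hφ : Function.Surjective φ)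
    (f : β → ℝ) : ex (unif α) (fun a => f (φ a)) = ex (unif β) f := by
  -- By surjectivity `b` is some `φ a`, and translation by `a` preserves the uniform density.
  -- Averaging over `b` and exchanging the expectations then replaces `φ a + b` by a uniform
  -- element.
  have h1 : ∀ b, ex (unif α) (fun a => f (φ a)) = ex (unif α) (fun a => f (φ a + b)) := by
    intro b
    obtain ⟨a, rfl⟩ := hφ b
    rw [← ex_unif_equiv (Equiv.addRight a) (fun x => f (φ x))]
    simp
  have h2 : ∀ a, ex (unif β) (fun b => f (φ a + b)) = ex (unif β) f := fun a =>
    ex_unif_equiv (Equiv.addLeft (φ a)) f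
  rw [← ex_const (isDensity_unif (α := β)) (ex (unif α) fun a => f (φ a))]
  conv_lhs => arg 2; ext b; rw [h1 b]
  rw [ex_comm]
  simp only [h2, ex_const (isDensity_unif (α := α))]

/-! ### Images and products of densities -/

open Classical in
/-- The image of a density. -/
noncomputable def push (p : α → ℝ) (h : α → β) (b : β) : ℝ := ∑ a, if h a = b then p a else 0

lemma ex_push (p : α → ℝ) (h : α → β) (f : β → ℝ) : ex (push p h) f = ex p fun a => f (h a) := by
  classical
  simp only [ex, push, Finset.sum_mul]
  rw [Finset.sum_comm]
  refine Finset.sum_congr rfl fun a _ => ?_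
  simp

lemma isDensity_push {p : α → ℝ} (hp : IsDensity p) (h : α → β) : IsDensity (push p h) := by
  classical
  refine ⟨fun b => Finset.sum_nonneg fun a _ => ?_, ?_⟩
  · split_ifs
    exacts [hp.1 a, le_rfl]
  · have := ex_push p h fun _ => 1
    simpa [ex, hp.2] using this

end Expectation

section Product

variable {ι : Type} [Fintype ι] [DecidableEq ι] {α β : Type} [Fintype α] [Fintype β]

/-- The product of a family of densities. -/
def piD (p : ι → α → ℝ) (x : ι → α) : ℝ := ∏ i, p i (x i)

lemma sum_piD (p : ι → α → ℝ) : ∑ x, piD p x = ∏ i, ∑ a, p i a := (Fintype.prod_sum p).symm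

lemma isDensity_piD {p : ι → α → ℝ} (hp : ∀ i, IsDensity (p i)) : IsDensity (piD p) :=
  ⟨fun x => Finset.prod_nonneg fun i _ => (hp i).1 _, by rw [sum_piD]; simp [(hp _).2]⟩

lemma piD_unif : piD (fun _ : ι => unif α) = unif (ι → α) := by
  ext x
  simp [piD, unif]

lemma ex_piD_prod (p : ι → α → ℝ) (f : ι → α → ℝ) :
    ex (piD p) (fun x => ∏ i, f i (x i)) = ∏ i, ex (p i) (f i) := by
  simp only [ex, piD, ← Finset.prod_mul_distrib]
  exact (Fintype.prod_sum fun i a => p i a * f i a).symm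

omit [Fintype β] in
lemma push_piD (p : ι → α → ℝ) (h : ι → α → β) :
    push (piD p) (fun x i => h i (x i)) = piD fun i => push (p i) (h i) := by
  classical
  ext y
  simp only [push, piD]
  rw [Fintype.prod_sum]
  refine Finset.sum_congr rfl fun x _ => ?_
  rw [Finset.prod_ite_zero]
  simp [funext_iff]

lemma l1_piD_le {p r : ι → α → ℝ} (hp : ∀ i, IsDensity (p i)) (hr : ∀ i, IsDensity (r i)) :
    l1 (piD p) (piD r) ≤ ∑ i, l1 (p i) (r i) := by
  -- Hybrids: coordinates in `S` follow `p` and the others `r`; each enlargement of `S` changes one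
  -- factor.
  suffices h : ∀ S : Finset ι, l1 (piD fun i => if i ∈ S then p i else r i) (piD r) ≤
      ∑ i ∈ S, l1 (p i) (r i) by simpa using h Finset.univ
  intro S
  induction S using Finset.induction_on with
  | empty => simp [l1]
  | insert j S hj ih =>
    rw [Finset.sum_insert hj]
    refine (l1_triangle _ (piD fun i => if i ∈ S then p i else r i) _).trans (add_le_add ?_ ih)
    -- The absolute difference of neighbouring hybrids is itself a product, with factor `|p j - r
    -- j|` at `j` and densities elsewhere, so its sum is the distance at `j` alone.
    have key : ∀ x : ι → α, |piD (fun i => if i ∈ insert j S then p i else r i) x -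
        piD (fun i => if i ∈ S then p i else r i) x| =
        piD (fun i a => if i = j then |p i a - r i a| else if i ∈ S then p i a else r i a) x := by
      intro x
      unfold piD
      rw [← Finset.mul_prod_erase _ _ (Finset.mem_univ j),
        ← Finset.mul_prod_erase _ _ (Finset.mem_univ j),
        ← Finset.mul_prod_erase _ (fun i => if i = j then _ else _) (Finset.mem_univ j)]
      have e1 : ∀ i ∈ Finset.univ.erase j, (if i ∈ insert j S then p i else r i) (x i) =
          if i ∈ S then p i (x i) else r i (x i) := by
        intro i hi
        have : i ≠ j := Finset.ne_of_mem_erase hi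
        by_cases h : i ∈ S <;> simp [this, h]
      have e2 : ∀ i ∈ Finset.univ.erase j, (if i ∈ S then p i else r i) (x i) =
          if i ∈ S then p i (x i) else r i (x i) := by
        intro i hi
        by_cases h : i ∈ S <;> simp [h]
      have e3 : ∀ i ∈ Finset.univ.erase j, (if i = j then |p i (x i) - r i (x i)| else
          if i ∈ S then p i (x i) else r i (x i)) = if i ∈ S then p i (x i) else r i (x i) := by
        intro i hi
        simp [Finset.ne_of_mem_erase hi]
      rw [Finset.prod_congr rfl e1, Finset.prod_congr rfl e2, Finset.prod_congr rfl e3, ← sub_mul,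
        abs_mul]
      simp only [Finset.mem_insert, true_or, if_true, hj, if_false]
      congr 1
      refine abs_of_nonneg (Finset.prod_nonneg fun i _ => ?_)
      split_ifs
      exacts [(hp i).1 _, (hr i).1 _]
    unfold l1
    rw [Finset.sum_congr rfl fun x _ => key x, sum_piD, Finset.prod_eq_single j]
    · simp
    · intro i _ hi
      by_cases h : i ∈ S <;> simp [hi, h, (hp i).2, (hr i).2]
    · simp

end Product

/-! ### A leftover hash lemma -/

section LeftoverHash

variable {q : ℕ} [Fact q.Prime] {ρ κ ω : Type} [Fintype ρ] [Fintype κ] [Fintype ω]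
  [DecidableEq ρ] [DecidableEq κ] [DecidableEq ω]

/-- The difference of two bits in `ℤ_q`. -/
def sgn (q : ℕ) (p : Bool × Bool) : ZMod q := (p.1.toNat : ZMod q) - (p.2.toNat : ZMod q)

/-- The combination of the rows of `A` with coefficients in `{-1, 0, 1}` given by `r`. -/
def hash (A : ρ → κ → ZMod q) (r : ρ → Bool × Bool) (j : κ) : ZMod q := ∑ a, sgn q (r a) * A a j

lemma ex_sq_le {α : Type} [Fintype α] {p : α → ℝ} (hp : IsDensity p) (f : α → ℝ) :
    ex p f ^ 2 ≤ ex p fun a => f a ^ 2 := by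
  have h := ex_nonneg hp (f := fun a => (f a - ex p f) ^ 2) fun a => sq_nonneg _
  have h2 : ∀ c, ex p (fun a => (f a - c) ^ 2) =
      ex p (fun a => f a ^ 2) - 2 * c * ex p f + c ^ 2 * ∑ a, p a := by
    intro c
    unfold ex
    rw [Finset.mul_sum, Finset.mul_sum, ← Finset.sum_sub_distrib, ← Finset.sum_add_distrib]
    exact Finset.sum_congr rfl fun a _ => by ring
  rw [h2, hp.2] at h
  linarith

/-- Cauchy–Schwarz: the `ℓ¹` distance to uniform is controlled by the collision probability `ex p
p`. -/
lemma l1_unif_sq_le {α : Type} [Fintype α] [Nonempty α] {p : α → ℝ} (hp : IsDensity p) :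
    l1 p (unif α) ^ 2 ≤ Fintype.card α * ex p p - 1 := by
  have h : (∑ a, |p a - unif α a|) ^ 2 ≤ Fintype.card α * ∑ a, |p a - unif α a| ^ 2 := by
    simpa using sq_sum_le_card_mul_sum_sq (s := Finset.univ) (f := fun a => |p a - unif α a|)
  refine h.trans (le_of_eq ?_)
  have hc : (Fintype.card α : ℝ) ≠ 0 := by exact_mod_cast Fintype.card_ne_zero
  have h2 : ∑ a, |p a - unif α a| ^ 2 = ex p p - 2 * (Fintype.card α : ℝ)⁻¹ * ∑ a, p a +
      (Fintype.card α : ℝ)⁻¹ * ∑ a, unif α a := by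
    unfold ex
    rw [Finset.mul_sum, Finset.mul_sum, ← Finset.sum_sub_distrib, ← Finset.sum_add_distrib]
    exact Finset.sum_congr rfl fun a _ => by rw [sq_abs]; simp only [unif]; ring
  rw [h2, hp.2, isDensity_unif.2]
  field_simp
  ring

lemma ex_push_self {α β : Type} [Fintype α] [Fintype β] [DecidableEq β] (p : α → ℝ) (h : α → β) :
    ex (push p h) (push p h) = ex p fun a => ex p fun a' => if h a' = h a then 1 else 0 := by
  rw [ex_push]
  simp only [push, ex, mul_ite, mul_one, mul_zero]
  refine Finset.sum_congr rfl fun a _ => ?_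
  congr 1
  exact Finset.sum_congr rfl fun a' _ => by congr

/-- The value is `1/4 + 1/16 + 1/16`; this needs `1 ≠ -1` in `ℤ_q`, hence `2 < q`. -/
lemma sgn_collision (hq : 2 < q) :
    ex (unif (Bool × Bool)) (fun b => ex (unif (Bool × Bool)) fun b' =>
      if sgn q b' = sgn q b then (1 : ℝ) else 0) = 3 / 8 := by
  have h1 : (1 : ZMod q) ≠ 0 := one_ne_zero
  have : Fact (2 < q) := ⟨hq⟩
  have h2 : (1 : ZMod q) ≠ -1 := (ZMod.neg_one_ne_one).symm
  simp only [ex, unif, Fintype.sum_prod_type, Fintype.sum_bool, sgn]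
  simp [h1, h2, h2.symm]
  norm_num

lemma sgn_collision_pi (hq : 2 < q) :
    ex (unif (ρ → Bool × Bool)) (fun r => ex (unif (ρ → Bool × Bool)) fun r' =>
      if (fun a => sgn q (r' a)) = (fun a => sgn q (r a)) then (1 : ℝ) else 0) =
      (3 / 8) ^ Fintype.card ρ := by
  have e : ∀ r r' : ρ → Bool × Bool,
      (if (fun a => sgn q (r' a)) = (fun a => sgn q (r a)) then (1 : ℝ) else 0) =
        ∏ a, if sgn q (r' a) = sgn q (r a) then (1 : ℝ) else 0 := by
    intro r r'
    rw [Finset.prod_ite_zero]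
    simp [funext_iff]
  simp only [e]
  rw [← piD_unif]
  simp only [fun r : ρ → Bool × Bool => ex_piD_prod (fun _ : ρ => unif (Bool × Bool))
    (fun a b' => if sgn q b' = sgn q (r a) then (1 : ℝ) else 0)]
  rw [ex_piD_prod (fun _ : ρ => unif (Bool × Bool)) (fun _ b => ex (unif (Bool × Bool)) fun b' =>
      if sgn q b' = sgn q b then (1 : ℝ) else 0)]
  simp only [sgn_collision hq, Finset.prod_const, Finset.card_univ]

/-- If the coefficient vectors differ at `a`, their difference there is a unit of the field `ℤ_q`,
so row `a` alone makes the difference of the two hashes uniform and it vanishes with probability `q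
^ (-|κ|)`. -/
lemma ex_hash_collision (r r' : ρ → Bool × Bool) :
    ex (unif (ρ → κ → ZMod q)) (fun A => if hash A r' = hash A r then (1 : ℝ) else 0) ≤
      (if (fun a => sgn q (r' a)) = (fun a => sgn q (r a)) then (1 : ℝ) else 0) +
        ((q : ℝ) ^ Fintype.card κ)⁻¹ := by
  split_ifs with h
  · refine (ex_le isDensity_unif (c := 1) fun A => ?_).trans (by simp)
    split_ifs <;> norm_num
  · obtain ⟨a, ha⟩ := Function.ne_iff.1 h
    let φ : (ρ → κ → ZMod q) →+ (κ → ZMod q) :=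
      { toFun := fun A j => ∑ a, (sgn q (r' a) - sgn q (r a)) * A a j
        map_zero' := by ext; simp
        map_add' := fun A B => by ext; simp [mul_add, Finset.sum_add_distrib] }
    have hφ : Function.Surjective φ := by
      intro v
      refine ⟨fun a' j => if a' = a then (sgn q (r' a) - sgn q (r a))⁻¹ * v j else 0, ?_⟩
      ext j
      have : sgn q (r' a) - sgn q (r a) ≠ 0 := sub_ne_zero.2 ha
      simp [φ, this]
    have e : ∀ A, (if hash A r' = hash A r then (1 : ℝ) else 0) = if φ A = 0 then 1 else 0 := by
      intro A
      congr 1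
      simp [φ, hash, funext_iff, sub_mul, sub_eq_zero]
    simp only [e, zero_add]
    rw [ex_unif_hom φ hφ (fun v => if v = 0 then (1 : ℝ) else 0)]
    simp [ex, unif]

/-- Averaged over `A`, the collision probability is at most `(3/8) ^ |ρ| + q ^ (-|κ|)`. Multiplied
by the number of values, the second term cancels the `-1` of `l1_unif_sq_le`. -/
lemma leftover_hash_row (hq : 2 < q) :
    ex (unif (ρ → κ → ZMod q)) (fun A => l1 (push (unif (ρ → Bool × Bool)) (hash A)) (unif _)) ≤
      Real.sqrt ((q : ℝ) ^ Fintype.card κ * (3 / 8) ^ Fintype.card ρ) := by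
  refine Real.le_sqrt_of_sq_le ((ex_sq_le isDensity_unif _).trans ?_)
  refine (ex_mono isDensity_unif fun A => l1_unif_sq_le (isDensity_push isDensity_unif _)).trans ?_
  simp only [ex_push_self]
  rw [ex_sub, ex_const isDensity_unif]
  have hq0 : (q : ℝ) ^ Fintype.card κ ≠ 0 := by
    have := (Fact.out : q.Prime).pos
    positivity
  rw [ex_const_mul, ex_comm]
  simp only [ex_comm (unif (ρ → κ → ZMod q))]
  have h := ex_mono (isDensity_unif (α := ρ → Bool × Bool)) fun r =>
    ex_mono (isDensity_unif (α := ρ → Bool × Bool)) fun r' =>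
      ex_hash_collision (q := q) (κ := κ) r r'
  have h2 : ex (unif (ρ → Bool × Bool)) (fun r => ex (unif (ρ → Bool × Bool)) fun r' =>
      (if (fun a => sgn q (r' a)) = (fun a => sgn q (r a)) then (1 : ℝ) else 0) +
        ((q : ℝ) ^ Fintype.card κ)⁻¹) =
      (3 / 8) ^ Fintype.card ρ + ((q : ℝ) ^ Fintype.card κ)⁻¹ := by
    rw [← sgn_collision_pi (ρ := ρ) hq]
    simp only [ex_add, ex_const isDensity_unif]
  rw [h2] at h
  have hcard : (Fintype.card (κ → ZMod q) : ℝ) = (q : ℝ) ^ Fintype.card κ := by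
    simp [ZMod.card]
  rw [hcard]
  have h4 := mul_le_mul_of_nonneg_left h (by positivity : 0 ≤ (q : ℝ) ^ Fintype.card κ)
  rw [mul_add, mul_inv_cancel₀ hq0] at h4
  linarith

/-- Leftover hash lemma: several combinations of the rows of a uniform matrix, with coefficients
in `{-1, 0, 1}`, are jointly close to uniform given the matrix. -/
lemma leftover_hash (hq : 2 < q) (g : (ρ → κ → ZMod q) → (ω → κ → ZMod q) → ℝ)
    (hg : ∀ A U, |g A U| ≤ 1) :
    |ex (unif (ρ → κ → ZMod q)) (fun A => ex (unif (ω → ρ → Bool × Bool)) fun R =>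
        g A fun i => hash A (R i)) -
      ex (unif (ρ → κ → ZMod q)) (fun A => ex (unif (ω → κ → ZMod q)) (g A))| ≤
      Fintype.card ω * Real.sqrt ((q : ℝ) ^ Fintype.card κ * (3 / 8) ^ Fintype.card ρ) := by
  rw [← ex_sub]
  refine (abs_ex_le_ex_abs isDensity_unif _).trans ?_
  have h : ∀ A : ρ → κ → ZMod q, |ex (unif (ω → ρ → Bool × Bool)) (fun R =>
        g A fun i => hash A (R i)) - ex (unif (ω → κ → ZMod q)) (g A)| ≤
        Fintype.card ω * l1 (push (unif (ρ → Bool × Bool)) (hash A)) (unif _) := by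
    intro A
    -- For fixed `A` the hashes indexed by `ω` are independent, so their distances to uniform add
    -- up.
    rw [← ex_push (unif (ω → ρ → Bool × Bool)) (fun R i => hash A (R i)) (g A), ← piD_unif,
      push_piD (fun _ : ω => unif (ρ → Bool × Bool)) (fun _ => hash A)]
    refine (abs_ex_sub_ex_le_l1 _ _ (hg A)).trans ?_
    rw [← piD_unif (ι := ω) (α := κ → ZMod q)]
    refine (l1_piD_le (fun _ => isDensity_push isDensity_unif _) fun _ => isDensity_unif).trans ?_
    simp
  refine (ex_mono isDensity_unif h).trans ?_
  rw [ex_const_mul]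
  exact mul_le_mul_of_nonneg_left (leftover_hash_row hq) (by positivity)

end LeftoverHash

/-! ### The matrices returned by `GenTrap` -/

section GenTrap

variable {m n q : ℕ} [Fact q.Prime]

/-- The matrix with first rows `Abar` and last rows `G - U`. -/
def stackGadget (p : (Fin (m - n * bitLen q) → Fin n → ZMod q) × (Fin (n * bitLen q) → Fin n → ZMod q)) :
    Matrix (Fin m) (Fin n) (ZMod q) :=
  Matrix.of fun i j =>
    if h : i.val < m - n * bitLen q then p.1 ⟨i.val, h⟩ j
    else
      (if (i.val - (m - n * bitLen q)) / bitLen q = j.val then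
          (2 : ZMod q) ^ ((i.val - (m - n * bitLen q)) % bitLen q) else 0) -
        p.2 ⟨i.val - (m - n * bitLen q), by have := i.isLt; omega⟩ j

/-- Subtraction from the fixed gadget matrix is invertible, hence exact uniformity of both blocks
gives exact uniformity of the stacked matrix, provided that the `n ⌈log q⌉` last rows fit. -/
lemma stackGadget_bijective (h : n * bitLen q ≤ m) :
    Function.Bijective (stackGadget (m := m) (n := n) (q := q)) := by
  rw [Fintype.bijective_iff_injective_and_card]
  constructor
  · intro p p' hp
    have e := fun i j => congrFun (congrFun hp i) j
    refine Prod.ext (funext fun i => funext fun j => ?_) (funext fun i => funext fun j => ?_)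
    · have := e ⟨i.val, by omega⟩ j
      simpa [stackGadget] using this
    · have := e ⟨m - n * bitLen q + i.val, by omega⟩ j
      simpa [stackGadget] using this
  · have e : Fintype.card (Matrix (Fin m) (Fin n) (ZMod q)) =
        Fintype.card (Fin m → Fin n → ZMod q) := Fintype.card_congr Matrix.of.symm
    rw [e]
    simp only [Fintype.card_prod, Fintype.card_fun, Fintype.card_fin, ZMod.card]
    rw [← pow_add, Nat.sub_add_cancel h]

lemma ex_genTrap (f : Matrix (Fin m) (Fin n) (ZMod q) → ℝ) :
    ex (genTrap m n q) f = ex (unif (Matrix (Fin (m - n * bitLen q)) (Fin n) (ZMod q))) fun Abar =>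
      ex (unif (Fin (m - n * bitLen q) → Fin (n * bitLen q) → Bool × Bool)) fun R =>
        f (trapMatrix Abar R) := by
  classical
  simp only [ex, genTrap, Finset.sum_mul, Finset.mul_sum]
  rw [Finset.sum_comm]
  refine Finset.sum_congr rfl fun Abar _ => ?_
  rw [Finset.sum_comm]
  refine Finset.sum_congr rfl fun R _ => ?_
  simp only [ite_mul, zero_mul]
  rw [Finset.sum_ite_eq]
  simp [mul_assoc]

lemma tvDist_genTrap_le (hq : 2 < q) (h : n * bitLen q ≤ m) :
    tvDist (genTrap m n q) (unif _) ≤ (n * bitLen q : ℕ) *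
      Real.sqrt ((q : ℝ) ^ n * (3 / 8) ^ (m - n * bitLen q)) := by
  suffices h' : l1 (genTrap m n q) (unif _) ≤ (n * bitLen q : ℕ) *
      Real.sqrt ((q : ℝ) ^ n * (3 / 8) ^ (m - n * bitLen q)) by
    have h0 : 0 ≤ l1 (genTrap m n q) (unif _) := Finset.sum_nonneg fun _ _ => abs_nonneg _
    unfold tvDist
    unfold l1 at h' h0
    linarith
  refine l1_le_of_forall_ex fun f hf => ?_
  have h1 := leftover_hash (ρ := Fin (m - n * bitLen q)) (κ := Fin n) (ω := Fin (n * bitLen q)) hq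
    (fun A U => f (stackGadget (A, U))) (fun _ _ => hf _)
  simp only [Fintype.card_fin] at h1
  convert h1 using 3
  · rw [ex_genTrap]
    congr 1
    funext Abar
    -- `genTrap` indexes the trapdoor by rows of `Abar` first, `leftover_hash` by outputs first.
    rw [← ex_unif_equiv (Equiv.piComm fun _ _ => Bool × Bool)]
    rfl
  · rw [← ex_unif_equiv (Equiv.ofBijective _ (stackGadget_bijective h)) f, ex_unif_prod]
    rfl

end GenTrap

/-! ### Shifts of the truncated Gaussian -/

section Gaussian

/-- The effect of a shift by one on the expectation of a unimodal density on an interval. -/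
lemma abs_sum_shift_le {P f : ℕ → ℝ} {B : ℕ} (hf : ∀ i, |f i| ≤ 1) (h0 : ∀ i, 0 ≤ P i)
    (hup : ∀ i < B, P i ≤ P (i + 1)) (hdown : ∀ i, B ≤ i → P (i + 1) ≤ P i) :
    |∑ i ∈ Finset.range (2 * B + 1), P i * (f (i + 1) - f i)| ≤ 2 * P B := by
  -- Summation by parts moves the difference from `f` to `P`. The increments of `P` have constant
  -- sign on either side of the peak `B`, so their absolute values telescope; together with the two
  -- boundary terms they give `2 * P B`.
  have abel : ∀ N : ℕ, ∑ i ∈ Finset.range (N + 1), P i * (f (i + 1) - f i) =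
      P N * f (N + 1) - P 0 * f 0 + ∑ i ∈ Finset.range N, (P i - P (i + 1)) * f (i + 1) := by
    intro N
    induction N with
    | zero => simp; ring
    | succ N ih => rw [Finset.sum_range_succ, ih, Finset.sum_range_succ]; ring
  have bound : ∀ N : ℕ, |∑ i ∈ Finset.range (B + N), (P i - P (i + 1)) * f (i + 1)| ≤
      (P B - P 0) + (P B - P (B + N)) := by
    have h1 : ∀ K : ℕ, K ≤ B → |∑ i ∈ Finset.range K, (P i - P (i + 1)) * f (i + 1)| ≤ P K - P 0 := by
      intro K
      induction K with
      | zero => simp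
      | succ K ih =>
        intro hK
        rw [Finset.sum_range_succ]
        refine (abs_add_le _ _).trans ?_
        have := ih (by omega)
        have h2 : |(P K - P (K + 1)) * f (K + 1)| ≤ P (K + 1) - P K := by
          rw [abs_mul, abs_of_nonpos (by linarith [hup K (by omega)])]
          have := hup K (by omega)
          nlinarith [hf (K + 1)]
        linarith
    intro N
    induction N with
    | zero => simpa using h1 B le_rfl
    | succ N ih =>
      rw [← add_assoc, Finset.sum_range_succ]
      refine (abs_add_le _ _).trans ?_
      have h2 : |(P (B + N) - P (B + N + 1)) * f (B + N + 1)| ≤ P (B + N) - P (B + N + 1) := by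
        have := hdown (B + N) (by omega)
        rw [abs_mul, abs_of_nonneg (by linarith)]
        nlinarith [hf (B + N + 1)]
      linarith
  rw [abel, two_mul B]
  have h1 := bound B
  have h2 : |P (B + B) * f (B + B + 1)| ≤ P (B + B) := by
    rw [abs_mul, abs_of_nonneg (h0 _)]; nlinarith [hf (B + B + 1), h0 (B + B)]
  have h3 : |P 0 * f 0| ≤ P 0 := by
    rw [abs_mul, abs_of_nonneg (h0 _)]; nlinarith [hf 0, h0 0]
  have h4 := abs_add_le (P (B + B) * f (B + B + 1) - P 0 * f 0)
    (∑ i ∈ Finset.range (B + B), (P i - P (i + 1)) * f (i + 1))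
  have h5 := abs_sub (P (B + B) * f (B + B + 1)) (P 0 * f 0)
  linarith

variable {q : ℕ} [Fact q.Prime] {B : ℕ}

lemma valMinAbs_shift (hB : 2 * B < q) {i : ℕ} (hi : i < 2 * B + 1) :
    (((i : ℤ) - B : ℤ) : ZMod q).valMinAbs = (i : ℤ) - B := by
  rw [ZMod.valMinAbs_spec]
  refine ⟨rfl, ?_, ?_⟩ <;> omega

/-- Sums over the residues of absolute value at most `B`. -/
lemma sum_abs_le (hB : 2 * B < q) (F : ZMod q → ℝ) :
    ∑ y : ZMod q with |(y.valMinAbs : ℝ)| ≤ (B : ℝ), F y =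
      ∑ i ∈ Finset.range (2 * B + 1), F (((i : ℤ) - B : ℤ) : ZMod q) := by
  symm
  refine Finset.sum_bij (fun i _ => (((i : ℤ) - B : ℤ) : ZMod q)) ?_ ?_ ?_ fun _ _ => rfl
  · intro i hi
    rw [Finset.mem_range] at hi
    rw [Finset.mem_filter, valMinAbs_shift hB hi]
    refine ⟨Finset.mem_univ _, ?_⟩
    rw [abs_le]
    push_cast
    have : (i : ℝ) ≤ 2 * B := by exact_mod_cast Nat.lt_succ_iff.1 hi
    constructor <;> linarith [(Nat.cast_nonneg i : (0 : ℝ) ≤ i)]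
  · intro i hi j hj h
    rw [Finset.mem_range] at hi hj
    have := congrArg ZMod.valMinAbs h
    simp only [valMinAbs_shift hB hi, valMinAbs_shift hB hj] at this
    omega
  · intro y hy
    rw [Finset.mem_filter] at hy
    have hy2 : |y.valMinAbs| ≤ (B : ℤ) := by exact_mod_cast hy.2
    rw [abs_le] at hy2
    refine ⟨(y.valMinAbs + B).toNat, ?_, ?_⟩
    · rw [Finset.mem_range]; omega
    · have : (((y.valMinAbs + B).toNat : ℤ) - B : ℤ) = y.valMinAbs := by omega
      rw [this, ZMod.coe_valMinAbs]

/-- The normalising constant of the truncated Gaussian. -/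
noncomputable def gaussMass (B : ℕ) : ℝ :=
  ∑ i ∈ Finset.range (2 * B + 1), Real.exp (-Real.pi * ((i : ℝ) - B) ^ 2 / (B : ℝ) ^ 2)

/-- On the support the exponent is at least `-π`. Consequently the peak of the density is at most
`exp π / (2 B + 1)`, which is where `shiftErr` comes from. -/
lemma gaussMass_ge (hB : 0 < B) : (2 * B + 1) * Real.exp (-Real.pi) ≤ gaussMass B := by
  have : ∀ i ∈ Finset.range (2 * B + 1), Real.exp (-Real.pi) ≤
      Real.exp (-Real.pi * ((i : ℝ) - B) ^ 2 / (B : ℝ) ^ 2) := by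
    intro i hi
    rw [Finset.mem_range] at hi
    have hB' : (0 : ℝ) < B := by exact_mod_cast hB
    have hi' : (i : ℝ) ≤ 2 * B := by exact_mod_cast Nat.lt_succ_iff.1 hi
    rw [Real.exp_le_exp, le_div_iff₀ (by positivity)]
    have : ((i : ℝ) - B) ^ 2 ≤ (B : ℝ) ^ 2 := by nlinarith [(Nat.cast_nonneg i : (0 : ℝ) ≤ i)]
    nlinarith [Real.pi_pos]
  have h := Finset.card_nsmul_le_sum _ _ _ this
  simpa [gaussMass] using h

lemma gaussMass_pos (hB : 0 < B) : 0 < gaussMass B :=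
  lt_of_lt_of_le (by positivity) (gaussMass_ge hB)

lemma ex_truncGaussian (hB : 2 * B < q) (f : ZMod q → ℝ) :
    ex (truncGaussian q B) f = ∑ i ∈ Finset.range (2 * B + 1),
      Real.exp (-Real.pi * ((i : ℝ) - B) ^ 2 / (B : ℝ) ^ 2) / gaussMass B *
        f (((i : ℤ) - B : ℤ) : ZMod q) := by
  classical
  have hM : ∑ y : ZMod q with |(y.valMinAbs : ℝ)| ≤ (B : ℝ),
      Real.exp (-Real.pi * (y.valMinAbs : ℝ) ^ 2 / (B : ℝ) ^ 2) = gaussMass B := by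
    rw [sum_abs_le hB]
    refine Finset.sum_congr rfl fun i hi => ?_
    rw [valMinAbs_shift hB (Finset.mem_range.1 hi)]
    push_cast
    rfl
  have h1 : ex (truncGaussian q B) f = ∑ y : ZMod q with |(y.valMinAbs : ℝ)| ≤ (B : ℝ),
      Real.exp (-Real.pi * (y.valMinAbs : ℝ) ^ 2 / (B : ℝ) ^ 2) / gaussMass B * f y := by
    rw [Finset.sum_filter]
    refine Finset.sum_congr rfl fun y _ => ?_
    unfold truncGaussian
    rw [← hM]
    split_ifs
    · congr!
    · simp
  rw [h1, sum_abs_le hB]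
  refine Finset.sum_congr rfl fun i hi => ?_
  rw [valMinAbs_shift hB (Finset.mem_range.1 hi)]
  push_cast
  rfl

lemma isDensity_truncGaussian (hB0 : 0 < B) (hB : 2 * B < q) : IsDensity (truncGaussian q B) := by
  constructor
  · intro x
    unfold truncGaussian
    split_ifs
    · exact div_nonneg (Real.exp_nonneg _) (Finset.sum_nonneg fun _ _ => Real.exp_nonneg _)
    · exact le_rfl
  · have h := ex_truncGaussian hB fun _ => 1
    simp only [ex, mul_one] at h
    rw [h, ← Finset.sum_div]
    exact div_self (gaussMass_pos hB0).ne'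

/-- The bound on the effect of a shift by one on the truncated Gaussian. -/
noncomputable def shiftErr (B : ℕ) : ℝ := Real.exp Real.pi / B

lemma shiftErr_nonneg (B : ℕ) : 0 ≤ shiftErr B := by unfold shiftErr; positivity

lemma abs_ex_truncGaussian_shift_one_le (hB0 : 0 < B) (hB : 2 * B < q) {f : ZMod q → ℝ}
    (hf : ∀ x, |f x| ≤ 1) :
    |ex (truncGaussian q B) (fun x => f (x + 1)) - ex (truncGaussian q B) f| ≤ shiftErr B := by
  rw [← ex_sub, ex_truncGaussian hB]
  have hM := gaussMass_pos hB0
  have hB' : (0 : ℝ) < B := by exact_mod_cast hB0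
  -- The support is indexed by `i = x + B`, which puts the peak at `i = B`. The profile is not cut
  -- off after `2 B`; the jump at the edge of the support is accounted for by the boundary terms of
  -- the summation by parts.
  have h := abs_sum_shift_le (B := B)
    (P := fun i => Real.exp (-Real.pi * ((i : ℝ) - B) ^ 2 / (B : ℝ) ^ 2) / gaussMass B)
    (f := fun i => f (((i : ℤ) - B : ℤ) : ZMod q)) (fun i => hf _) (fun i => by positivity)
    (fun i hi => by
      have : (i : ℝ) + 1 ≤ B := by exact_mod_cast hi
      gcongr ?_ / _
      rw [Real.exp_le_exp]
      gcongr ?_ / _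
      push_cast
      nlinarith [Real.pi_pos])
    (fun i hi => by
      have : (B : ℝ) ≤ i := by exact_mod_cast hi
      gcongr ?_ / _
      rw [Real.exp_le_exp]
      gcongr ?_ / _
      push_cast
      nlinarith [Real.pi_pos])
  have e : ∀ i : ℕ, ((((i + 1 : ℕ) : ℤ) - B : ℤ) : ZMod q) = (((i : ℤ) - B : ℤ) : ZMod q) + 1 := by
    intro i; push_cast; ring
  simp only [e] at h
  refine h.trans ?_
  simp only [sub_self]
  have h2 := gaussMass_ge hB0
  unfold shiftErr
  rw [← mul_div_assoc, div_le_div_iff₀ hM hB']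
  have h3 : Real.exp Real.pi * ((2 * B + 1) * Real.exp (-Real.pi)) ≤
      Real.exp Real.pi * gaussMass B := by gcongr
  have h4 : Real.exp Real.pi * ((2 * B + 1) * Real.exp (-Real.pi)) = 2 * B + 1 := by
    rw [mul_left_comm, ← Real.exp_add]; simp
  rw [h4] at h3
  simp
  linarith

lemma abs_ex_truncGaussian_shift_le (hB0 : 0 < B) (hB : 2 * B < q) (a : ℤ) {f : ZMod q → ℝ}
    (hf : ∀ x, |f x| ≤ 1) :
    |ex (truncGaussian q B) (fun x => f (x + a)) - ex (truncGaussian q B) f| ≤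
      |(a : ℝ)| * shiftErr B := by
  have hnat : ∀ (k : ℕ) (g : ZMod q → ℝ), (∀ x, |g x| ≤ 1) →
      |ex (truncGaussian q B) (fun x => g (x + k)) - ex (truncGaussian q B) g| ≤
        k * shiftErr B := by
    intro k
    induction k with
    | zero => simp
    | succ k ih =>
      intro g hg
      have h1 := ih (fun x => g (x + 1)) fun x => hg _
      have h2 := abs_ex_truncGaussian_shift_one_le hB0 hB hg
      have e : (fun x : ZMod q => g (x + (k + 1 : ℕ))) = fun x => g (x + k + 1) := by
        funext x; push_cast; rw [add_assoc]
      rw [e]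
      refine (abs_sub_le _ (ex (truncGaussian q B) fun x => g (x + 1)) _).trans ?_
      push_cast
      linarith
  obtain ⟨k, rfl | rfl⟩ := a.eq_nat_or_neg
  · simpa using hnat k f hf
  · have h := hnat k (fun x => f (x - k)) fun x => hf _
    rw [abs_sub_comm]
    simpa [sub_eq_add_neg] using h

lemma l1_shift_truncGaussian_le (hB0 : 0 < B) (hB : 2 * B < q) (a : ℤ) :
    l1 (push (truncGaussian q B) fun x => x + a) (truncGaussian q B) ≤ |(a : ℝ)| * shiftErr B :=
  l1_le_of_forall_ex fun f hf => by
    rw [ex_push]; exact abs_ex_truncGaussian_shift_le hB0 hB a hf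

/-- Noise flooding: independent truncated Gaussians absorb a small shift. -/
lemma flooding {ι : Type} [Fintype ι] [DecidableEq ι] (hB0 : 0 < B) (hB : 2 * B < q) {K : ℝ}
    (a : ι → ℤ) (ha : ∀ i, |(a i : ℝ)| ≤ K) {f : (ι → ZMod q) → ℝ} (hf : ∀ x, |f x| ≤ 1) :
    |ex (piD fun _ => truncGaussian q B) (fun e => f fun i => e i + a i) -
      ex (piD fun _ => truncGaussian q B) f| ≤ Fintype.card ι * (K * shiftErr B) := by
  have hd := isDensity_truncGaussian hB0 hB
  rw [← ex_push (piD fun _ => truncGaussian q B) (fun e i => e i + a i) f,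
    push_piD _ (fun i x => x + (a i : ZMod q))]
  refine (abs_ex_sub_ex_le_l1 _ _ hf).trans
    ((l1_piD_le (fun i => isDensity_push hd _) fun _ => hd).trans ?_)
  refine (Finset.sum_le_sum fun i _ => (l1_shift_truncGaussian_le hB0 hB (a i)).trans
    (mul_le_mul_of_nonneg_right (ha i) (shiftErr_nonneg B))).trans (by simp)

end Gaussian

/-! ### The sign of a bit and the hardcore sets -/

section Sign

/-- The sign `(-1)^b`. -/
def sgB (b : Bool) : ℝ := if b then -1 else 1

lemma abs_sgB (b : Bool) : |sgB b| = 1 := by cases b <;> simp [sgB]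

lemma sgB_dot {κ : Type} [Fintype κ] (d z : κ → Bool) :
    sgB (dot d z) = ∏ i, sgB (d i && z i) := by
  unfold sgB dot
  rw [Finset.prod_ite, Finset.prod_const, Finset.prod_const_one, mul_one]
  simp only [decide_eq_true_eq]
  split_ifs with h
  · rw [h.neg_one_pow]
  · rw [(Nat.not_odd_iff_even.1 h).neg_one_pow]

variable {n q : ℕ}

/-- Blocks with `s i = 0` do not move and contribute nothing; blocks with `s i = 1` move exactly as
under the all-ones vector. So the bit in the definition of `H` is the inner product of `I b x d`
with `s`. -/
lemma sgB_dot_move (b : Bool) (x : Fin n → ZMod q) (d : Str n q) (s : Fin n → Bool) :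
    sgB (dot d fun p => xor (J x p) (J (move b x (vec q s)) p)) =
      ∏ i, sgB (I b x d i && s i) := by
  rw [sgB_dot, Fintype.prod_prod_type]
  refine Finset.prod_congr rfl fun i _ => ?_
  cases h : s i
  · have : move b x (vec q s) i = x i := by cases b <;> simp [move, vec, h]
    simp [J, this, sgB]
  · have : move b x (vec q s) i = move b x 1 i := by cases b <;> simp [move, vec, h]
    rw [Bool.and_true, I, sgB_dot]
    simp [J, this]

lemma I_congr {b : Bool} {x x' : Fin n → ZMod q} (d : Str n q) {i : Fin n} (h : x i = x' i) :
    I b x d i = I b x' d i := by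
  have : move b x 1 i = move b x' 1 i := by cases b <;> simp [move, h]
  simp [I, J, h, this]

/-- The half of the coordinates that is used in the definition of `G b x`. -/
def half (n : ℕ) (b : Bool) (i : Fin n) : Prop := if b then n / 2 ≤ i.val else i.val < n / 2

instance (n : ℕ) (b : Bool) : DecidablePred (half n b) := fun i => by
  unfold half; infer_instance

lemma half_not {b : Bool} {i : Fin n} : half n (!b) i ↔ ¬ half n b i := by
  cases b <;> simp [half]

lemma mem_goodSet {s : Fin n → Bool} {b : Bool} {x : Fin n → ZMod q} {d : Str n q} :
    d ∈ goodSet s b x ↔ d ∈ G b x ∧ d ∈ G (!b) (move b x (vec q s)) := by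
  cases b <;> simp [goodSet, and_comm]

/-- `G (!b)` inspects only the half complementary to `half n b`, and the point `x ∓ s` has
coordinates there that involve only that part of `s`. Thus goodness is constant while the other half
of `s` varies. -/
lemma mem_G_move_congr {b : Bool} {s s' : Fin n → Bool} (x : Fin n → ZMod q) (d : Str n q)
    (h : ∀ i, ¬ half n b i → s i = s' i) :
    d ∈ G (!b) (move b x (vec q s)) ↔ d ∈ G (!b) (move b x (vec q s')) := by
  refine exists_congr fun i => and_congr_right fun hi => ?_
  have hi' : ¬ half n b i := half_not.1 hi
  rw [I_congr]
  cases b <;> simp [move, vec, h i hi']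

lemma mem_H {s : Fin n → Bool} {b : Bool} {x : Fin n → ZMod q} {d : Str n q} {c : Bool} :
    (b, x, d, c) ∈ H q s ↔
      d ∈ goodSet s b x ∧ c = dot d (fun p => xor (J x p) (J (move b x (vec q s)) p)) := by
  constructor
  · rintro ⟨b', x', d', hd, h⟩
    simp only [Prod.mk.injEq] at h
    obtain ⟨rfl, rfl, rfl, rfl⟩ := h
    exact ⟨hd, rfl⟩
  · rintro ⟨hd, rfl⟩
    exact ⟨b, x, d, hd, rfl⟩

-- This turns the advantage into a correlation with a character of the cube, which is what Fourier
-- analysis can bound.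
open Classical in
lemma indicator_H_sub (s : Fin n → Bool) (b : Bool) (x : Fin n → ZMod q) (d : Str n q) (c : Bool) :
    (if (b, x, d, c) ∈ H q s then (1 : ℝ) else 0) - (if (b, x, d, c) ∈ Hbar q s then 1 else 0) =
      (if d ∈ goodSet s b x then sgB c else 0) * ∏ i, sgB (I b x d i && s i) := by
  have h : (b, x, d, c) ∈ Hbar q s ↔ (b, x, d, !c) ∈ H q s := Iff.rfl
  rw [h, ← sgB_dot_move, mem_H, mem_H]
  by_cases hd : d ∈ goodSet s b x
  · simp only [hd, true_and, if_true]
    generalize dot d _ = e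
    cases c <;> cases e <;> simp [sgB]
  · simp [hd]

end Sign

/-! ### Fourier analysis of the leakage -/

section Fourier

variable {q : ℕ} [Fact q.Prime]

/-- The largest absolute value of `1 ± ψ y`, where `ψ` is the standard character of `ℤ_q`. -/
noncomputable def kap (y : ZMod q) : ℝ := max ‖1 + ZMod.stdAddChar y‖ ‖1 - ZMod.stdAddChar y‖

lemma norm_stdAddChar (y : ZMod q) : ‖ZMod.stdAddChar y‖ = 1 :=
  AddChar.norm_apply _ _

lemma kap_nonneg (y : ZMod q) : 0 ≤ kap y := (norm_nonneg _).trans (le_max_left _ _)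

lemma normSq_char (y : ZMod q) :
    (ZMod.stdAddChar y).re ^ 2 + (ZMod.stdAddChar y).im ^ 2 = 1 := by
  have := norm_stdAddChar y
  rw [← Complex.sq_norm_sub_sq_re, this]
  ring

/-- For `|z| = 1` one has `|1 ± z|² = 2 ± 2 Re z`. -/
lemma kap_sq_le (y : ZMod q) : kap y ^ 2 ≤ 2 + 2 * |(ZMod.stdAddChar y).re| := by
  have h := normSq_char y
  have h1 : ‖1 + ZMod.stdAddChar y‖ ^ 2 ≤ 2 + 2 * |(ZMod.stdAddChar y).re| := by
    rw [Complex.sq_norm, Complex.normSq_apply]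
    simp only [Complex.add_re, Complex.one_re, Complex.add_im, Complex.one_im]
    nlinarith [le_abs_self (ZMod.stdAddChar y).re]
  have h2 : ‖1 - ZMod.stdAddChar y‖ ^ 2 ≤ 2 + 2 * |(ZMod.stdAddChar y).re| := by
    rw [Complex.sq_norm, Complex.normSq_apply]
    simp only [Complex.sub_re, Complex.one_re, Complex.sub_im, Complex.one_im]
    nlinarith [neg_abs_le (ZMod.stdAddChar y).re]
  unfold kap
  rcases max_choice ‖1 + ZMod.stdAddChar y‖ ‖1 - ZMod.stdAddChar y‖ with h | h <;> rw [h] <;>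
    assumption

lemma sum_char_mul (b : ZMod q) :
    ∑ a, ZMod.stdAddChar (a * b) = if b = 0 then (q : ℂ) else 0 := by
  rw [AddChar.sum_mulShift b (ZMod.isPrimitive_stdAddChar q), ZMod.card]
  split_ifs <;> simp

/-- The double-angle formula for `cos²`; the term `Re ψ (2 y)` averages to zero because `2 ≠ 0` in
`ℤ_q`. -/
lemma ex_re_sq (hq : 2 < q) :
    ex (unif (ZMod q)) (fun y => (ZMod.stdAddChar y).re ^ 2) = 1 / 2 := by
  have e : ∀ y : ZMod q, (ZMod.stdAddChar y).re ^ 2 =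
      (1 + (ZMod.stdAddChar (y * 2)).re) / 2 := by
    intro y
    rw [mul_two, AddChar.map_add_eq_mul, Complex.mul_re]
    linarith [normSq_char y]
  have h2 : (2 : ZMod q) ≠ 0 := by
    intro h
    have : ((2 : ℕ) : ZMod q) = 0 := by exact_mod_cast h
    rw [ZMod.natCast_eq_zero_iff] at this
    exact absurd (Nat.le_of_dvd (by norm_num) this) (by omega)
  have h3 := congrArg Complex.re (sum_char_mul (q := q) 2)
  simp only [h2, if_false, Complex.re_sum, Complex.zero_re] at h3
  have hq0 : (q : ℝ) ≠ 0 := by have := (Fact.out : q.Prime).ne_zero; exact_mod_cast this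
  simp only [ex, unif, ← Finset.mul_sum, e, ← Finset.sum_div, Finset.sum_add_distrib, h3]
  simp [ZMod.card]
  field_simp

/-- The bound `2 cos (π / 8)` on the mean of `kap`. -/
noncomputable def kapMean : ℝ := Real.sqrt (2 + 2 * Real.sqrt (1 / 2))

lemma ex_kap_le (hq : 2 < q) : ex (unif (ZMod q)) kap ≤ kapMean := by
  refine Real.le_sqrt_of_sq_le ((ex_sq_le isDensity_unif _).trans ?_)
  refine (ex_mono isDensity_unif kap_sq_le).trans ?_
  have h1 : ex (unif (ZMod q)) (fun y => |(ZMod.stdAddChar y).re|) ≤ Real.sqrt (1 / 2) := by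
    refine Real.le_sqrt_of_sq_le ((ex_sq_le isDensity_unif _).trans ?_)
    simp only [sq_abs, ex_re_sq hq, le_refl]
  have h2 : ex (unif (ZMod q)) (fun y => 2 + 2 * |(ZMod.stdAddChar y).re|) =
      2 + 2 * ex (unif (ZMod q)) (fun y => |(ZMod.stdAddChar y).re|) := by
    rw [ex_add, ex_const isDensity_unif, ex_const_mul]
  rw [h2]
  linarith

variable {τ : Type} [Fintype τ] [DecidableEq τ] {l : ℕ}

/-- The bound on the Fourier coefficients of the distribution of a subset sum of the columns
of `C`. -/
noncomputable def leak (C : Matrix (Fin l) τ (ZMod q)) : ℝ :=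
  ((q : ℝ) ^ l)⁻¹ * ∑ u ∈ Finset.univ.erase (0 : Fin l → ZMod q), ∏ i, kap (Matrix.vecMul u C i)

lemma addChar_sum {ι A R : Type} [Fintype ι] [AddCommMonoid A] [CommMonoid R] (ψ : AddChar A R)
    (f : ι → A) : ψ (∑ i, f i) = ∏ i, ψ (f i) := by
  classical
  suffices h : ∀ S : Finset ι, ψ (∑ i ∈ S, f i) = ∏ i ∈ S, ψ (f i) from h _
  intro S
  induction S using Finset.induction_on with
  | empty => simp
  | insert i S hi ih => rw [Finset.sum_insert hi, Finset.prod_insert hi, AddChar.map_add_eq_mul, ih]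

lemma sum_char_dot (y : Fin l → ZMod q) :
    ∑ u : Fin l → ZMod q, ZMod.stdAddChar (u ⬝ᵥ y) = if y = 0 then (q : ℂ) ^ l else 0 := by
  simp only [dotProduct, addChar_sum]
  rw [← Fintype.prod_sum fun k a => ZMod.stdAddChar (a * y k)]
  simp only [sum_char_mul]
  rw [Finset.prod_ite_zero]
  simp [funext_iff]

/-- The bits of a vector as elements of `ℤ_q`. -/
def vecOf (q : ℕ) (s : τ → Bool) : τ → ZMod q := fun i => if s i then 1 else 0

/-- Both the sign and the character are multiplicative in the coordinates of `s`, so the sum over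
the cube factors. -/
lemma sum_char_subset (u : Fin l → ZMod q) (C : Matrix (Fin l) τ (ZMod q)) (v : Fin l → ZMod q)
    (D : τ → Bool) :
    ∑ s : τ → Bool, ((∏ i, sgB (D i && s i) : ℝ) : ℂ) *
      ZMod.stdAddChar (u ⬝ᵥ (C.mulVec (vecOf q s) - v)) =
    ZMod.stdAddChar (-(u ⬝ᵥ v)) *
      ∏ i, (1 + (sgB (D i) : ℂ) * ZMod.stdAddChar (Matrix.vecMul u C i)) := by
  have h : ∀ s : τ → Bool, ((∏ i, sgB (D i && s i) : ℝ) : ℂ) *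
      ZMod.stdAddChar (u ⬝ᵥ (C.mulVec (vecOf q s) - v)) =
      ZMod.stdAddChar (-(u ⬝ᵥ v)) * ∏ i, ((sgB (D i && s i) : ℂ) *
        ZMod.stdAddChar (Matrix.vecMul u C i * if s i then 1 else 0)) := by
    intro s
    rw [Finset.prod_mul_distrib, ← addChar_sum]
    have : u ⬝ᵥ (C.mulVec (vecOf q s) - v) =
        -(u ⬝ᵥ v) + ∑ i, (Matrix.vecMul u C i * if s i then 1 else 0) := by
      rw [dotProduct_sub, Matrix.dotProduct_mulVec, sub_eq_neg_add]
      rfl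
    rw [this, AddChar.map_add_eq_mul]
    push_cast
    ring
  simp only [h]
  rw [← Finset.mul_sum, ← Fintype.prod_sum fun i (b : Bool) => ((sgB (D i && b) : ℂ) *
        ZMod.stdAddChar (Matrix.vecMul u C i * if b then 1 else 0))]
  congr 1
  refine Finset.prod_congr rfl fun i _ => ?_
  rw [Fintype.sum_bool]
  simp [sgB]
  ring

/-- The constraint is detected by averaging characters over all frequencies `u`. At `u = 0` a
coordinate with `D i = true` contributes the factor `1 - 1 = 0`; all other frequencies are bounded
by `leak C`, uniformly in `v` and `D`. -/
lemma abs_sum_subset_le (C : Matrix (Fin l) τ (ZMod q)) (v : Fin l → ZMod q)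
    {D : τ → Bool} (hD : ∃ i, D i = true) :
    |∑ s : τ → Bool, if C.mulVec (vecOf q s) = v then ∏ i, sgB (D i && s i) else 0| ≤ leak C := by
  have hq0 : (q : ℂ) ^ l ≠ 0 := by
    have := (Fact.out : q.Prime).ne_zero
    exact pow_ne_zero _ (by exact_mod_cast this)
  have e : ((∑ s : τ → Bool, if C.mulVec (vecOf q s) = v then ∏ i, sgB (D i && s i) else 0 : ℝ) : ℂ) =
      ((q : ℂ) ^ l)⁻¹ * ∑ u : Fin l → ZMod q, ZMod.stdAddChar (-(u ⬝ᵥ v)) *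
      ∏ i, (1 + (sgB (D i) : ℂ) * ZMod.stdAddChar (Matrix.vecMul u C i)) := by
    simp only [← sum_char_subset]
    rw [Finset.sum_comm]
    simp only [← Finset.mul_sum, sum_char_dot, sub_eq_zero]
    rw [Finset.mul_sum]
    push_cast
    refine Finset.sum_congr rfl fun s _ => ?_
    split_ifs
    · field_simp; push_cast; rfl
    · simp
  rw [← Real.norm_eq_abs, ← Complex.norm_real, e, norm_mul, norm_inv, norm_pow]
  unfold leak
  simp only [Complex.norm_natCast]
  refine mul_le_mul_of_nonneg_left ?_ (by positivity)
  obtain ⟨i0, hi0⟩ := hD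
  rw [← Finset.add_sum_erase _ _ (Finset.mem_univ 0)]
  have hz : ∏ i, (1 + (sgB (D i) : ℂ) *
      ZMod.stdAddChar (Matrix.vecMul (0 : Fin l → ZMod q) C i)) = 0 := by
    refine Finset.prod_eq_zero (Finset.mem_univ i0) ?_
    simp [hi0, sgB]
  rw [hz, mul_zero, zero_add]
  refine (norm_sum_le _ _).trans (Finset.sum_le_sum fun u _ => ?_)
  rw [norm_mul, norm_stdAddChar, one_mul, norm_prod]
  refine Finset.prod_le_prod (fun _ _ => norm_nonneg _) fun i _ => ?_
  unfold kap
  cases D i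
  · simp [sgB]
  · simp only [sgB, if_true]
    refine le_trans (le_of_eq ?_) (le_max_right _ _)
    congr 1
    push_cast
    ring

end Fourier

/-! ### What `C s` reveals about the hardcore bit. -/

section Leakage

variable {q : ℕ} [Fact q.Prime] {l n : ℕ}

/-- Once the coordinates of `s` outside `p` are frozen, `γ` and part of the sign are constants of
absolute value at most one, and a shifted subset-sum problem on `p` remains. The power of two counts
the frozen parts. -/
lemma abs_sum_mixed_le (p : Fin n → Prop) [DecidablePred p] (C : Matrix (Fin l) (Fin n) (ZMod q))
    (v : Fin l → ZMod q) {D : Fin n → Bool} (hD : ∃ i, p i ∧ D i = true)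
    {γ : (Fin n → Bool) → ℝ} (h1 : ∀ s, |γ s| ≤ 1)
    (hγ : ∀ s s', (∀ i, ¬ p i → s i = s' i) → γ s = γ s') :
    |∑ s, if C.mulVec (vec q s) = v then γ s * ∏ i, sgB (D i && s i) else 0| ≤
      2 ^ Fintype.card {i // ¬ p i} * leak (C.submatrix id (Subtype.val : {i // p i} → Fin n)) := by
  let e := Equiv.piEquivPiSubtypeProd p fun _ => Bool
  let C1 := C.submatrix id (Subtype.val : {i // p i} → Fin n)
  let C2 := C.submatrix id (Subtype.val : {i // ¬ p i} → Fin n)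
  have hmul : ∀ s1 s2, C.mulVec (vec q (e.symm (s1, s2))) =
      C1.mulVec (vecOf q s1) + C2.mulVec (vecOf q s2) := by
    intro s1 s2
    ext k
    simp only [Matrix.mulVec, dotProduct, Pi.add_apply]
    rw [← Fintype.sum_subtype_add_sum_subtype p]
    congr 1 <;> refine Finset.sum_congr rfl fun i _ => ?_ <;>
      simp [C1, C2, vec, vecOf, e, Equiv.piEquivPiSubtypeProd, i.2]
  have hprod : ∀ s1 s2, ∏ i, sgB (D i && e.symm (s1, s2) i) =
      (∏ i : {i // p i}, sgB (D i && s1 i)) * ∏ i : {i // ¬ p i}, sgB (D i && s2 i) := by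
    intro s1 s2
    rw [← Fintype.prod_subtype_mul_prod_subtype p]
    congr 1 <;> refine Finset.prod_congr rfl fun i _ => ?_ <;>
      simp [e, Equiv.piEquivPiSubtypeProd, i.2]
  rw [← e.symm.sum_comp, Fintype.sum_prod_type, Finset.sum_comm]
  refine (Finset.abs_sum_le_sum_abs _ _).trans ((Finset.sum_le_card_nsmul _ _
    (leak C1) fun s2 _ => ?_).trans (by simp [C1]))
  have e2 : ∀ s1, (if C.mulVec (vec q (e.symm (s1, s2))) = v then
        γ (e.symm (s1, s2)) * ∏ i, sgB (D i && e.symm (s1, s2) i) else 0) =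
      (γ (e.symm (fun _ => false, s2)) * ∏ i : {i // ¬ p i}, sgB (D i && s2 i)) *
        if C1.mulVec (vecOf q s1) = v - C2.mulVec (vecOf q s2) then
          ∏ i : {i // p i}, sgB (D i && s1 i) else 0 := by
    intro s1
    rw [hmul, hprod, hγ (e.symm (s1, s2)) (e.symm (fun _ => false, s2))]
    · simp only [← eq_sub_iff_add_eq]
      split_ifs <;> ring
    · intro i hi
      simp [e, Equiv.piEquivPiSubtypeProd, hi]
  simp only [e2]
  rw [← Finset.mul_sum, abs_mul, abs_mul, Finset.abs_prod]
  simp only [abs_sgB, Finset.prod_const_one, mul_one]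
  obtain ⟨i, hi, hi'⟩ := hD
  have h3 := abs_sum_subset_le C1 (v - C2.mulVec (vecOf q s2)) (D := fun i => D i) ⟨⟨i, hi⟩, hi'⟩
  refine (mul_le_of_le_one_left (abs_nonneg _) (h1 _)).trans h3

/-- For `u ≠ 0` the vector `u C` is uniform, so the factors `kap` become independent with mean at
most `kapMean`. There are fewer than `q ^ l` such `u`, which the normalisation of `leak` absorbs. -/
lemma ex_leak_le (hq : 2 < q) (p : Fin n → Prop) [DecidablePred p] :
    ex (unif (Matrix (Fin l) (Fin n) (ZMod q)))
      (fun C => leak (C.submatrix id (Subtype.val : {i // p i} → Fin n))) ≤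
      kapMean ^ Fintype.card {i // p i} := by
  unfold leak
  rw [ex_const_mul]
  have hq0 : (0 : ℝ) < q := by exact_mod_cast (Fact.out : q.Prime).pos
  have key : ∀ u ∈ Finset.univ.erase (0 : Fin l → ZMod q),
      ex (unif (Matrix (Fin l) (Fin n) (ZMod q))) (fun C => ∏ i : {i // p i},
        kap (Matrix.vecMul u (C.submatrix id (Subtype.val : {i // p i} → Fin n)) i)) ≤
      kapMean ^ Fintype.card {i // p i} := by
    intro u hu
    obtain ⟨k, hk⟩ := Function.ne_iff.1 (Finset.ne_of_mem_erase hu)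
    let φ : Matrix (Fin l) (Fin n) (ZMod q) →+ ({i // p i} → ZMod q) :=
      { toFun := fun C => Matrix.vecMul u (C.submatrix id (Subtype.val : {i // p i} → Fin n))
        map_zero' := by ext; simp
        map_add' := fun A B => by rw [← Matrix.vecMul_add]; rfl }
    have hφ : Function.Surjective φ := by
      intro v
      refine ⟨Matrix.of fun k' i => if k' = k then
        (if h : p i then (u k)⁻¹ * v ⟨i, h⟩ else 0) else 0, ?_⟩
      ext ⟨i, hi⟩
      have hk' : u k ≠ 0 := hk
      simp [φ, Matrix.vecMul, dotProduct, hi, hk']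
    have h2 := ex_unif_hom φ hφ fun y => ∏ i, kap (y i)
    refine (le_of_eq h2).trans ?_
    rw [← piD_unif, ex_piD_prod (fun _ => unif (ZMod q)) (fun _ => kap)]
    simp only [Finset.prod_const, Finset.card_univ]
    exact pow_le_pow_left₀ (ex_nonneg isDensity_unif kap_nonneg) (ex_kap_le hq) _
  have hsum : ex (unif (Matrix (Fin l) (Fin n) (ZMod q)))
      (fun C => ∑ u ∈ Finset.univ.erase (0 : Fin l → ZMod q), ∏ i : {i // p i},
        kap (Matrix.vecMul u (C.submatrix id (Subtype.val : {i // p i} → Fin n)) i)) =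
      ∑ u ∈ Finset.univ.erase (0 : Fin l → ZMod q),
        ex (unif (Matrix (Fin l) (Fin n) (ZMod q))) (fun C => ∏ i : {i // p i},
        kap (Matrix.vecMul u (C.submatrix id (Subtype.val : {i // p i} → Fin n)) i)) := by
    simp only [ex, Finset.mul_sum]
    rw [Finset.sum_comm]
  rw [hsum, inv_mul_le_iff₀ (by positivity)]
  have hk0 : 0 ≤ kapMean := Real.sqrt_nonneg _
  refine (Finset.sum_le_card_nsmul _ _ _ key).trans ?_
  rw [nsmul_eq_mul]
  refine mul_le_mul_of_nonneg_right ?_ (by positivity)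
  have : (Finset.univ.erase (0 : Fin l → ZMod q)).card ≤ q ^ l :=
    (Finset.card_le_card (Finset.erase_subset _ _)).trans (by simp [ZMod.card])
  exact_mod_cast this

/-- The difference of the indicators of `H_s` and of `Hbar_s`. -/
noncomputable def signedH (q : ℕ) (s : Fin n → Bool) (t : Tuple n q) : ℝ :=
  open Classical in (if t ∈ H q s then (1 : ℝ) else 0) - (if t ∈ Hbar q s then 1 else 0)

/-- The total leakage of `C s` about the hardcore bits. -/
noncomputable def totalLeak (C : Matrix (Fin l) (Fin n) (ZMod q)) : ℝ :=
  ∑ b : Bool, ((2 : ℝ) ^ Fintype.card {i // half n b i})⁻¹ *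
    leak (C.submatrix id (Subtype.val : {i // half n b i} → Fin n))

lemma leak_nonneg {τ : Type} [Fintype τ] [DecidableEq τ] (C : Matrix (Fin l) τ (ZMod q)) :
    0 ≤ leak C :=
  mul_nonneg (by positivity)
    (Finset.sum_nonneg fun _ _ => Finset.prod_nonneg fun _ _ => kap_nonneg _)

lemma totalLeak_nonneg (C : Matrix (Fin l) (Fin n) (ZMod q)) : 0 ≤ totalLeak C :=
  Finset.sum_nonneg fun _ _ => mul_nonneg (by positivity) (leak_nonneg _)

/-- If `d ∉ G b x`, the tuple is in neither set for any `s`. Otherwise `I b x d` is nonzero on `half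
n b`, and the goodness of `d` together with the sign of `c` plays the role of `γ` in
`abs_sum_mixed_le`. -/
lemma abs_ex_signedH_le (C : Matrix (Fin l) (Fin n) (ZMod q)) (v : Fin l → ZMod q)
    (t : Tuple n q) :
    |ex (unif (Fin n → Bool)) fun s => if C.mulVec (vec q s) = v then signedH q s t else 0| ≤
      totalLeak C := by
  classical
  obtain ⟨b, x, d, c⟩ := t
  have hb : ((2 : ℝ) ^ Fintype.card {i // half n b i})⁻¹ *
      leak (C.submatrix id (Subtype.val : {i // half n b i} → Fin n)) ≤ totalLeak C :=
    Finset.single_le_sum (f := fun b => ((2 : ℝ) ^ Fintype.card {i // half n b i})⁻¹ *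
      leak (C.submatrix id (Subtype.val : {i // half n b i} → Fin n)))
      (fun _ _ => mul_nonneg (by positivity) (leak_nonneg _)) (Finset.mem_univ b)
  by_cases hd : d ∈ G b x
  · refine le_trans ?_ hb
    have h := abs_sum_mixed_le (half n b) C v (D := I b x d) hd
      (γ := fun s => if d ∈ goodSet s b x then sgB c else 0)
      (fun s => by split_ifs <;> simp [abs_sgB])
      (fun s s' hs => by simp only [mem_goodSet, mem_G_move_congr x d hs])
    have e : (ex (unif (Fin n → Bool)) fun s =>
        if C.mulVec (vec q s) = v then signedH q s (b, x, d, c) else 0) = ((2 : ℝ) ^ n)⁻¹ *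
        ∑ s, if C.mulVec (vec q s) = v then
          (if d ∈ goodSet s b x then sgB c else 0) * ∏ i, sgB (I b x d i && s i) else 0 := by
      simp only [ex, unif, signedH, indicator_H_sub, ← Finset.mul_sum]
      simp
    rw [e, abs_mul, abs_of_pos (by positivity)]
    refine (mul_le_mul_of_nonneg_left h (by positivity)).trans (le_of_eq ?_)
    have hc := Fintype.card_subtype_compl (half n b)
    have hle := Fintype.card_subtype_le (half n b)
    rw [Fintype.card_fin] at hc hle
    have : (2 : ℝ) ^ n = 2 ^ Fintype.card {i // half n b i} *
        2 ^ Fintype.card {i // ¬ half n b i} := by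
      rw [← pow_add]; congr 1; omega
    rw [this]
    field_simp
  · refine le_trans (le_of_eq ?_) (totalLeak_nonneg C)
    have : ∀ s, signedH q s (b, x, d, c) = 0 := by
      intro s
      simp [signedH, indicator_H_sub, mem_goodSet, hd]
    simp [this, ex]

/-- An adversary that sees `s` only through `C s` has a small advantage. -/
lemma abs_ex_sum_signedH_le (C : Matrix (Fin l) (Fin n) (ZMod q))
    {P : (Fin l → ZMod q) → Tuple n q → ℝ} (hP : ∀ v t, 0 ≤ P v t) (hP1 : ∀ v, ∑ t, P v t ≤ 1) :
    |ex (unif (Fin n → Bool)) fun s => ∑ t, P (C.mulVec (vec q s)) t * signedH q s t| ≤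
      (q : ℝ) ^ l * totalLeak C := by
  -- Sorting by the value `v` of `C s` frees the output probabilities of `s`; the price is the
  -- number `q ^ l` of values.
  have e : (ex (unif (Fin n → Bool)) fun s => ∑ t, P (C.mulVec (vec q s)) t * signedH q s t) =
      ∑ v, ∑ t, P v t * ex (unif (Fin n → Bool)) fun s =>
        if C.mulVec (vec q s) = v then signedH q s t else 0 := by
    simp only [ex, Finset.mul_sum]
    refine Finset.sum_comm.trans (Eq.trans ?_ Finset.sum_comm)
    refine Finset.sum_congr rfl fun t _ => Eq.trans ?_ Finset.sum_comm
    refine Finset.sum_congr rfl fun s _ => ?_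
    simp only [mul_ite, mul_zero]
    rw [Finset.sum_ite_eq]
    simp
    ring
  rw [e]
  refine (Finset.abs_sum_le_sum_abs _ _).trans
    ((Finset.sum_le_card_nsmul _ _ (totalLeak C) fun v _ => ?_).trans (by simp [ZMod.card]))
  refine (Finset.abs_sum_le_sum_abs _ _).trans ?_
  have : ∀ t ∈ Finset.univ, |P v t * ex (unif (Fin n → Bool)) fun s =>
        if C.mulVec (vec q s) = v then signedH q s t else 0| ≤ P v t * totalLeak C := by
    intro t _
    rw [abs_mul, abs_of_nonneg (hP v t)]
    exact mul_le_mul_of_nonneg_left (abs_ex_signedH_le C v t) (hP v t)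
  refine (Finset.sum_le_sum this).trans ?_
  rw [← Finset.sum_mul]
  exact mul_le_of_le_one_left (totalLeak_nonneg C) (hP1 v)

/-- Half of this bound is the decay rate `0.924` below. -/
lemma kapMean_lt : kapMean < 1.848 := by
  unfold kapMean
  have h : Real.sqrt (1 / 2) < 0.7072 := by
    rw [Real.sqrt_lt' (by norm_num)]; norm_num
  rw [Real.sqrt_lt' (by norm_num)]
  linarith

lemma card_half_ge (b : Bool) : n / 2 ≤ Fintype.card {i // half n b i} := by
  have h1 : Fintype.card {i : Fin n // i.val < n / 2} = n / 2 := by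
    rw [Fintype.card_subtype]
    have : (Finset.univ.filter fun i : Fin n => i.val < n / 2).card =
        (Finset.range (n / 2)).card := by
      refine Finset.card_bij (fun i _ => i.val) (by simp) (fun i _ j _ h => Fin.ext h) ?_
      intro k hk
      rw [Finset.mem_range] at hk
      exact ⟨⟨k, by omega⟩, by simpa using hk, rfl⟩
    simpa using this
  cases b
  · simp only [half, Bool.false_eq_true, if_false]
    exact h1.ge
  · have h2 := Fintype.card_subtype_compl fun i : Fin n => i.val < n / 2
    simp only [half, if_true]
    simp only [not_lt] at h2
    rw [h2, h1, Fintype.card_fin]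
    omega

lemma ex_totalLeak_le (hq : 2 < q) :
    ex (unif (Matrix (Fin l) (Fin n) (ZMod q))) totalLeak ≤ 2 * (0.924 : ℝ) ^ (n / 2) := by
  have e : ex (unif (Matrix (Fin l) (Fin n) (ZMod q))) totalLeak =
      ∑ b : Bool, ((2 : ℝ) ^ Fintype.card {i // half n b i})⁻¹ *
      ex (unif (Matrix (Fin l) (Fin n) (ZMod q)))
        fun C => leak (C.submatrix id (Subtype.val : {i // half n b i} → Fin n)) := by
    simp only [← ex_const_mul]
    unfold totalLeak ex
    simp only [Finset.mul_sum]
    rw [Finset.sum_comm]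
  rw [e]
  have hk0 : 0 ≤ kapMean := Real.sqrt_nonneg _
  refine (Finset.sum_le_card_nsmul _ _ ((0.924 : ℝ) ^ (n / 2)) fun b _ => ?_).trans (by simp)
  calc _ ≤ ((2 : ℝ) ^ Fintype.card {i // half n b i})⁻¹ *
        1.848 ^ Fintype.card {i // half n b i} := by
        gcongr
        exact (ex_leak_le hq _).trans (pow_le_pow_left₀ hk0 kapMean_lt.le _)
    _ = (0.924 : ℝ) ^ Fintype.card {i // half n b i} := by
        rw [← inv_pow, ← mul_pow]; norm_num
    _ ≤ _ := pow_le_pow_of_le_one (by norm_num) (by norm_num) (card_half_ge b)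

end Leakage

/-! ### Straight-line programs -/

section Chain

variable {X κ : Type}

/-- The values computed by a straight-line program (the latest value first), as functions on a
set `X` of inputs, of which the program can read the bits `inp k`. -/
inductive Chain (inp : κ → X → Bool) : List (X → Bool) → Prop
  | nil : Chain inp []
  | true {L : List (X → Bool)} : Chain inp L → Chain inp ((fun _ => Bool.true) :: L)
  | inp {L : List (X → Bool)} (k : κ) : Chain inp L → Chain inp (inp k :: L)
  | nand {L : List (X → Bool)} {f g : X → Bool} : f ∈ L → g ∈ L → Chain inp L →
      Chain inp ((fun x => !(f x && g x)) :: L)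

/-- A straight-line program that computes all functions in `S` can be extended by `c` steps so as
to compute all functions in `T`. -/
def Gen (inp : κ → X → Bool) (S T : Set (X → Bool)) (c : ℕ) : Prop :=
  ∀ L, Chain inp L → (∀ f ∈ S, f ∈ L) →
    ∃ L', Chain inp L' ∧ L ⊆ L' ∧ (∀ f ∈ T, f ∈ L') ∧ L'.length ≤ L.length + c

variable {inp : κ → X → Bool} {S S' T T' U : Set (X → Bool)} {c c' d : ℕ}

namespace Gen

lemma mono (h : Gen inp S T c) (hS : S ⊆ S') (hT : T' ⊆ T) (hc : c ≤ c') : Gen inp S' T' c' := by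
  intro L hL hS'
  obtain ⟨L', h1, h2, h3, h4⟩ := h L hL fun f hf => hS' f (hS hf)
  exact ⟨L', h1, h2, fun f hf => h3 f (hT hf), by omega⟩

lemma of_subset (h : T ⊆ S) : Gen inp S T 0 := fun L hL hS =>
  ⟨L, hL, fun _ h => h, fun f hf => hS f (h hf), le_rfl⟩

lemma union (h : Gen inp S T c) (h' : Gen inp S U d) : Gen inp S (T ∪ U) (c + d) := by
  intro L hL hS
  obtain ⟨L', h1, h2, h3, h4⟩ := h L hL hS
  obtain ⟨L'', k1, k2, k3, k4⟩ := h' L' h1 fun f hf => h2 (hS f hf)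
  refine ⟨L'', k1, fun _ h => k2 (h2 h), ?_, by omega⟩
  rintro f (hf | hf)
  exacts [k2 (h3 f hf), k3 f hf]

lemma comp (h : Gen inp S T c) (h' : Gen inp T U d) : Gen inp S U (c + d) := by
  intro L hL hS
  obtain ⟨L', h1, h2, h3, h4⟩ := h L hL hS
  obtain ⟨L'', k1, k2, k3, k4⟩ := h' L' h1 h3
  exact ⟨L'', k1, fun _ h => k2 (h2 h), k3, by omega⟩

lemma comp_left (h : Gen inp S T c) (h' : Gen inp (S ∪ T) U d) : Gen inp S U (c + d) := by
  have h2 := ((of_subset (inp := inp) (le_refl S)).union h).comp h'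
  exact h2.mono le_rfl le_rfl (by omega)

lemma exists_chain (h : Gen inp ∅ T c) : ∃ L, Chain inp L ∧ (∀ f ∈ T, f ∈ L) ∧ L.length ≤ c := by
  obtain ⟨L, h1, -, h3, h4⟩ := h [] Chain.nil (by simp)
  exact ⟨L, h1, h3, by simpa using h4⟩

lemma biUnion {ι : Type} [DecidableEq ι] (s : Finset ι) {T : ι → Set (X → Bool)}
    (h : ∀ i ∈ s, Gen inp S (T i) c) : Gen inp S {f | ∃ i ∈ s, f ∈ T i} (s.card * c) := by
  induction s using Finset.induction_on with
  | empty => exact (of_subset (T := ∅) (by simp)).mono le_rfl (by intro f hf; simp at hf) (by simp)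
  | insert i s hi ih =>
    rw [Finset.card_insert_of_notMem hi]
    refine ((h i (Finset.mem_insert_self i s)).union
      (ih fun j hj => h j (Finset.mem_insert_of_mem hj))).mono le_rfl ?_ (by ring_nf; rfl)
    rintro f ⟨j, hj, hf⟩
    rcases Finset.mem_insert.1 hj with rfl | hj
    exacts [Or.inl hf, Or.inr ⟨j, hj, hf⟩]

lemma iUnion {ι : Type} [Fintype ι] {T : ι → Set (X → Bool)}
    (h : ∀ i, Gen inp S (T i) c) : Gen inp S (⋃ i, T i) (Fintype.card ι * c) := by
  classical
  refine (biUnion Finset.univ fun i _ => h i).mono le_rfl ?_ le_rfl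
  intro f hf
  simpa using hf

lemma range {ι : Type} [Fintype ι] {F : ι → X → Bool} (h : ∀ i, Gen inp S {F i} c) :
    Gen inp S (Set.range F) (Fintype.card ι * c) :=
  (iUnion h).mono le_rfl (by rintro _ ⟨i, rfl⟩; simp) le_rfl

lemma input (k : κ) : Gen inp S {inp k} 1 := fun L hL _ =>
  ⟨inp k :: L, hL.inp k, List.subset_cons_self _ _, by simp, by simp⟩

lemma inputs [Fintype κ] : Gen inp S (Set.range inp) (Fintype.card κ) :=
  (range fun k => input k).mono le_rfl le_rfl (by simp)

lemma nand {f g : X → Bool} (hf : f ∈ S) (hg : g ∈ S) : Gen inp S {fun x => !(f x && g x)} 1 :=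
  fun L hL hS => ⟨_ :: L, hL.nand (hS f hf) (hS g hg), List.subset_cons_self _ _, by simp, by simp⟩

lemma not {f : X → Bool} (hf : f ∈ S) : Gen inp S {fun x => !f x} 1 :=
  (nand hf hf).mono le_rfl (by simp) le_rfl

lemma const (b : Bool) : Gen inp S {fun _ => b} 2 := by
  have h : Gen inp S {fun _ => true} 1 := fun L hL _ =>
    ⟨_ :: L, hL.true, List.subset_cons_self _ _, by simp, by simp⟩
  cases b
  · exact (h.comp (not (Set.mem_singleton _))).mono le_rfl (by simp) le_rfl
  · exact h.mono le_rfl le_rfl (by norm_num)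

lemma nand' {f g : X → Bool} (hf : Gen inp S {f} c) (hg : Gen inp S {g} d) :
    Gen inp S {fun x => !(f x && g x)} (c + d + 1) :=
  (hf.union hg).comp (nand (by simp) (by simp))

lemma mux {e f g : X → Bool} (he : e ∈ S) (hf : Gen inp S {f} c) (hg : Gen inp S {g} d) :
    Gen inp S {fun x => if e x then f x else g x} (c + d + 4) := by
  have he' : Gen inp S {e} 0 := of_subset (by simpa using he)
  refine ((he'.nand' hf).nand' ((not he).nand' hg)).mono le_rfl ?_ (by omega)
  rw [Set.singleton_subset_iff, Set.mem_singleton_iff]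
  funext x
  cases e x <;> simp

lemma op1 {f : X → Bool} (op : Bool → Bool) (hf : f ∈ S) : Gen inp S {fun x => op (f x)} 2 := by
  cases h1 : op true <;> cases h0 : op false
  · refine (const false).mono le_rfl ?_ le_rfl
    rw [Set.singleton_subset_iff, Set.mem_singleton_iff]
    funext x
    cases h : f x <;> simp [h0, h1]
  · refine (not hf).mono le_rfl ?_ (by norm_num)
    rw [Set.singleton_subset_iff, Set.mem_singleton_iff]
    funext x
    cases h : f x <;> simp [h0, h1]
  · refine (of_subset (T := {f}) (by simpa using hf)).mono le_rfl ?_ (by norm_num)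
    rw [Set.singleton_subset_iff, Set.mem_singleton_iff]
    funext x
    cases h : f x <;> simp [h0, h1]
  · refine (const true).mono le_rfl ?_ le_rfl
    rw [Set.singleton_subset_iff, Set.mem_singleton_iff]
    funext x
    cases h : f x <;> simp [h0, h1]

lemma op2 {f g : X → Bool} (op : Bool → Bool → Bool) (hf : f ∈ S) (hg : g ∈ S) :
    Gen inp S {fun x => op (f x) (g x)} 8 := by
  refine (mux hf (op1 (op true) hg) (op1 (op false) hg)).mono le_rfl ?_ le_rfl
  rw [Set.singleton_subset_iff, Set.mem_singleton_iff]
  funext x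
  cases f x <;> simp

lemma op3 {f g h : X → Bool} (op : Bool → Bool → Bool → Bool) (hf : f ∈ S) (hg : g ∈ S)
    (hh : h ∈ S) : Gen inp S {fun x => op (f x) (g x) (h x)} 20 := by
  refine (mux hf (op2 (op true) hg hh) (op2 (op false) hg hh)).mono le_rfl ?_ le_rfl
  rw [Set.singleton_subset_iff, Set.mem_singleton_iff]
  funext x
  cases f x <;> simp

lemma op2' {f g : X → Bool} (op : Bool → Bool → Bool) (hf : Gen inp S {f} c)
    (hg : Gen inp S {g} d) : Gen inp S {fun x => op (f x) (g x)} (c + d + 8) :=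
  (hf.union hg).comp (op2 op (by simp) (by simp))

/-- Functions built up along a finite set by a binary operation in each step. -/
lemma fold {ι : Type} [DecidableEq ι] {F : ι → X → Bool} {P : Finset ι → X → Bool} (b : Bool)
    (h0 : ∀ x, P ∅ x = b) (op : Bool → Bool → Bool)
    (hs : ∀ i s, i ∉ s → ∀ x, P (insert i s) x = op (F i x) (P s x)) (s : Finset ι)
    (hF : ∀ i ∈ s, Gen inp S {F i} c) : Gen inp S {P s} (s.card * (c + 8) + 2) := by
  induction s using Finset.induction_on with
  | empty =>
    refine (const b).mono le_rfl ?_ (by omega)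
    rw [Set.singleton_subset_iff, Set.mem_singleton_iff]
    exact funext h0
  | insert i s hi ih =>
    rw [Finset.card_insert_of_notMem hi]
    refine (op2' op (hF i (Finset.mem_insert_self i s))
      (ih fun j hj => hF j (Finset.mem_insert_of_mem hj))).mono le_rfl ?_ (by ring_nf; rfl)
    rw [Set.singleton_subset_iff, Set.mem_singleton_iff]
    exact funext (hs i s hi)

lemma all {ι : Type} [Fintype ι] {F : ι → X → Bool} (hF : ∀ i, Gen inp S {F i} c) :
    Gen inp S {fun x => decide (∀ i, F i x = true)} (Fintype.card ι * (c + 8) + 2) := by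
  classical
  refine (fold (F := F) (P := fun s x => decide (∀ i ∈ s, F i x = true)) true (by simp)
    (fun a b => a && b) (fun i s _ x => by simp) Finset.univ fun i _ => hF i).mono le_rfl
      (by simp) le_rfl

lemma any {ι : Type} [Fintype ι] {F : ι → X → Bool} (hF : ∀ i, Gen inp S {F i} c) :
    Gen inp S {fun x => decide (∃ i, F i x = true)} (Fintype.card ι * (c + 8) + 2) := by
  classical
  refine (fold (F := F) (P := fun s x => decide (∃ i ∈ s, F i x = true)) false (by simp)
    (fun a b => a || b) (fun i s _ x => by simp) Finset.univ fun i _ => hF i).mono le_rfl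
      (by simp) le_rfl

lemma dot {ι : Type} [Fintype ι] {F F' : ι → X → Bool} (hF : ∀ i, Gen inp S {F i} c)
    (hF' : ∀ i, Gen inp S {F' i} d) :
    Gen inp S {fun x => dot (fun i => F i x) fun i => F' i x}
      (Fintype.card ι * (c + d + 16) + 2) := by
  classical
  refine (fold (F := fun i x => F i x && F' i x)
    (P := fun s x => decide (Odd (s.filter fun i => (F i x && F' i x) = true).card)) false
    (by simp) xor (fun i s hi x => ?_) Finset.univ
    fun i _ => op2' (fun a b => a && b) (hF i) (hF' i)).mono le_rfl ?_ le_rfl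
  · rw [Finset.filter_insert]
    split_ifs with h
    · rw [Finset.card_insert_of_notMem (by simp [hi]), h]
      simp [Nat.odd_add_one, -Nat.not_odd_iff_even]
    · rw [Bool.not_eq_true] at h
      rw [h]
      simp
  · simp only [LWE.dot]
    exact le_rfl

end Gen

/-! ### Arithmetic modulo `q` -/

/-- The lowest `k` bits of a natural number. -/
def natBits (k : ℕ) (V : X → ℕ) : Set (X → Bool) := {f | ∃ j < k, f = fun x => (V x).testBit j}

/-- The bits of a residue. -/
def zBits {q : ℕ} (u : X → ZMod q) : Set (X → Bool) :=
  Set.range fun (j : Fin (bitLen q)) x => bits (u x) j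

/-- A ripple-carry adder: each carry is the majority of two bits and the previous carry, each output
bit the parity of two bits and a carry, at 20 steps apiece. -/
lemma gen_nat_add (k : ℕ) (V W : X → ℕ) :
    Gen inp (natBits k V ∪ natBits k W) (natBits k fun x => V x + W x) (40 * k + 2) := by
  let car (j : ℕ) (x : X) : Bool :=
    BitVec.carry j (BitVec.ofNat k (V x)) (BitVec.ofNat k (W x)) false
  have hV : ∀ j < k, (fun x => (V x).testBit j) ∈ natBits k V ∪ natBits k W :=
    fun j hj => Or.inl ⟨j, hj, rfl⟩
  have hW : ∀ j < k, (fun x => (W x).testBit j) ∈ natBits k V ∪ natBits k W :=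
    fun j hj => Or.inr ⟨j, hj, rfl⟩
  have hcar : ∀ i ≤ k, Gen inp (natBits k V ∪ natBits k W) {f | ∃ j ≤ i, f = car j}
      (20 * i + 2) := by
    intro i
    induction i with
    | zero =>
      intro _
      refine (Gen.const false).mono le_rfl ?_ le_rfl
      rintro f ⟨j, hj, rfl⟩
      obtain rfl : j = 0 := by omega
      rw [Set.mem_singleton_iff]
      funext x
      exact BitVec.carry_zero
    | succ i ih =>
      intro hi
      have h1 := ih (by omega)
      have h2 : Gen inp ((natBits k V ∪ natBits k W) ∪ {f | ∃ j ≤ i, f = car j}) {car (i + 1)}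
          20 := by
        refine (Gen.op3 (S := (natBits k V ∪ natBits k W) ∪ {f | ∃ j ≤ i, f = car j})
          Bool.atLeastTwo (Or.inl (hV i hi)) (Or.inl (hW i hi))
          (Or.inr ⟨i, le_rfl, rfl⟩)).mono le_rfl ?_ le_rfl
        rw [Set.singleton_subset_iff, Set.mem_singleton_iff]
        funext x
        have hi' : i < k := hi
        simp only [car]
        rw [BitVec.carry_succ, BitVec.getLsbD_ofNat, BitVec.getLsbD_ofNat]
        simp only [hi', decide_true, Bool.true_and]
      refine (h1.comp_left ((Gen.of_subset Set.subset_union_right).union h2)).mono le_rfl ?_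
        (by omega)
      rintro f ⟨j, hj, rfl⟩
      rcases Nat.lt_or_ge i j with h | h
      · obtain rfl : j = i + 1 := by omega
        exact Or.inr rfl
      · exact Or.inl ⟨j, h, rfl⟩
  have hsum : ∀ j : Fin k, Gen inp ((natBits k V ∪ natBits k W) ∪ {f | ∃ j ≤ k, f = car j})
      {fun x => (V x + W x).testBit j} 20 := by
    intro j
    refine (Gen.op3 (S := (natBits k V ∪ natBits k W) ∪ {f | ∃ j ≤ k, f = car j})
      (fun a b c => a ^^ (b ^^ c)) (Or.inl (hV j j.2)) (Or.inl (hW j j.2))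
      (Or.inr ⟨j, j.2.le, rfl⟩)).mono le_rfl ?_ le_rfl
    rw [Set.singleton_subset_iff, Set.mem_singleton_iff]
    funext x
    have h := BitVec.getLsbD_add j.2 (BitVec.ofNat k (V x)) (BitVec.ofNat k (W x))
    rw [← BitVec.ofNat_add, BitVec.getLsbD_ofNat, BitVec.getLsbD_ofNat, BitVec.getLsbD_ofNat] at h
    simpa only [j.2, decide_true, Bool.true_and] using h
  refine ((hcar k le_rfl).comp_left (Gen.range hsum)).mono le_rfl ?_ (by simp; omega)
  rintro f ⟨j, hj, rfl⟩
  exact ⟨⟨j, hj⟩, rfl⟩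

lemma gen_nat_const (k a : ℕ) : Gen inp S (natBits k fun _ => a) (2 * k) := by
  refine (Gen.range fun j : Fin k => Gen.const (S := S) (a.testBit j)).mono le_rfl ?_
    (by simp [mul_comm])
  rintro f ⟨j, hj, rfl⟩
  exact ⟨⟨j, hj⟩, rfl⟩

variable {q : ℕ} [NeZero q]

omit [NeZero q] in
lemma le_two_pow_bitLen : q ≤ 2 ^ bitLen q := Nat.le_pow_clog (by norm_num) q

/-- Add `2 ^ K - q`, where `K = bitLen q + 1`. Since `W < 2 q ≤ 2 ^ K`, bit `K` of the sum is set
exactly when `W ≥ q`, and then the lower bits are those of `W - q`; so that bit selects between the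
two candidates. -/
lemma gen_reduce {W : X → ℕ} (hW : ∀ x, W x < 2 * q) :
    Gen inp (natBits (bitLen q + 2) W) (zBits fun x => (W x : ZMod q)) (100 * (bitLen q + 2)) := by
  set K := bitLen q + 1 with hK
  have hq : q ≤ 2 ^ bitLen q := le_two_pow_bitLen
  have hK2 : 2 ^ K = 2 ^ bitLen q + 2 ^ bitLen q := by rw [hK, pow_succ]; ring
  have hq0 : 0 < q := Nat.pos_of_ne_zero (NeZero.ne q)
  have h1 : Gen inp (natBits (bitLen q + 2) W)
      (natBits (bitLen q + 2) fun x => W x + (2 ^ K - q)) _ :=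
    (gen_nat_const (bitLen q + 2) (2 ^ K - q)).comp_left (gen_nat_add _ W fun _ => 2 ^ K - q)
  have h2 : ∀ j : Fin (bitLen q), Gen inp (natBits (bitLen q + 2) W ∪
      natBits (bitLen q + 2) fun x => W x + (2 ^ K - q))
      {fun x => bits (W x : ZMod q) j} 20 := by
    intro j
    refine (Gen.op3 (S := natBits (bitLen q + 2) W ∪
      natBits (bitLen q + 2) fun x => W x + (2 ^ K - q)) (fun a b c => if a then b else c)
      (Or.inr ⟨K, by omega, rfl⟩) (Or.inr ⟨j, by omega, rfl⟩)
      (Or.inl ⟨j, by omega, rfl⟩)).mono le_rfl ?_ le_rfl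
    rw [Set.singleton_subset_iff, Set.mem_singleton_iff]
    funext x
    unfold bits
    rw [ZMod.val_natCast]
    beta_reduce
    rcases Nat.lt_or_ge (W x) q with h | h
    · rw [Nat.mod_eq_of_lt h, Nat.testBit_lt_two_pow (i := K) (by omega)]
      simp
    · have e : W x + (2 ^ K - q) = 2 ^ K + (W x - q) := by omega
      have := hW x
      rw [e, Nat.testBit_two_pow_add_eq, Nat.testBit_lt_two_pow (i := K) (by omega),
        Nat.testBit_two_pow_add_gt (by omega), Nat.mod_eq_sub_mod h, Nat.mod_eq_of_lt (by omega)]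
      simp
  refine (h1.comp_left (Gen.range h2)).mono le_rfl le_rfl ?_
  simp
  omega

lemma gen_val (u : X → ZMod q) (k : ℕ) : Gen inp (zBits u) (natBits k fun x => (u x).val) (2 * k) := by
  have h : ∀ j : Fin k, Gen inp (zBits u) {fun x => (u x).val.testBit j} 2 := by
    intro j
    by_cases hj : j < bitLen q
    · refine (Gen.of_subset (T := {fun x => (u x).val.testBit j}) ?_).mono le_rfl le_rfl (by simp)
      rw [Set.singleton_subset_iff]
      exact ⟨⟨j, hj⟩, rfl⟩
    · refine (Gen.const false).mono le_rfl ?_ le_rfl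
      rw [Set.singleton_subset_iff, Set.mem_singleton_iff]
      funext x
      refine Nat.testBit_lt_two_pow (((u x).val_lt.trans_le le_two_pow_bitLen).trans_le ?_)
      exact Nat.pow_le_pow_right (by norm_num) (by omega)
  refine (Gen.range h).mono le_rfl ?_ (by simp [mul_comm])
  rintro f ⟨j, hj, rfl⟩
  exact ⟨⟨j, hj⟩, rfl⟩

/-- A bound on the cost of an addition modulo `q`. -/
def addCost (q : ℕ) : ℕ := 200 * (bitLen q + 2)

lemma gen_add (u v : X → ZMod q) :
    Gen inp (zBits u ∪ zBits v) (zBits fun x => u x + v x) (addCost q) := by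
  have h1 := ((gen_val (inp := inp) u (bitLen q + 2)).mono (S' := zBits u ∪ zBits v)
    Set.subset_union_left le_rfl le_rfl).union ((gen_val v (bitLen q + 2)).mono
      (S' := zBits u ∪ zBits v) Set.subset_union_right le_rfl le_rfl)
  have h2 := (h1.comp (gen_nat_add _ _ _)).comp (gen_reduce (q := q)
    (W := fun x => (u x).val + (v x).val)
    fun x => by have := (u x).val_lt; have := (v x).val_lt; omega)
  refine h2.mono le_rfl ?_ (by unfold addCost; omega)
  simp only [Nat.cast_add, ZMod.natCast_val, ZMod.cast_id', id_eq]
  exact le_rfl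

omit [NeZero q] in
lemma gen_const (a : ZMod q) : Gen inp S (zBits fun _ => a) (2 * bitLen q) :=
  (Gen.range fun j : Fin (bitLen q) => Gen.const (bits a j)).mono le_rfl le_rfl
    (by simp [mul_comm])

lemma Gen.zadd {u v : X → ZMod q} (hu : Gen inp S (zBits u) c) (hv : Gen inp S (zBits v) d) :
    Gen inp S (zBits fun x => u x + v x) (c + d + addCost q) :=
  (hu.union hv).comp (gen_add u v)

lemma Gen.zadd_const {u : X → ZMod q} (hu : Gen inp S (zBits u) c) (a : ZMod q) :
    Gen inp S (zBits fun x => u x + a) (c + 2 * addCost q) :=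
  (hu.zadd (gen_const a)).mono le_rfl le_rfl (by unfold addCost; omega)

/-- Double-and-add along the binary digits of the hard-wired factor `a`, with at most two modular
additions per digit. -/
lemma gen_nat_mul (k : ℕ) (u : X → ZMod q) : ∀ a : ℕ, a < 2 ^ k →
    Gen inp (zBits u) (zBits fun x => (a : ZMod q) * u x) ((2 * k + 1) * addCost q) := by
  induction k with
  | zero =>
    intro a ha
    obtain rfl : a = 0 := by rw [pow_zero] at ha; omega
    refine (gen_const (0 : ZMod q)).mono le_rfl (by simp) (by unfold addCost; omega)
  | succ k ih =>
    intro a ha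
    have h1 := ih (a / 2) (by rw [pow_succ] at ha; omega)
    have h2 : Gen inp (zBits u) (zBits fun x => ((a / 2 : ℕ) : ZMod q) * u x +
        ((a / 2 : ℕ) : ZMod q) * u x) _ :=
      h1.comp ((gen_add _ _).mono (Set.union_self _).le le_rfl le_rfl)
    rcases Nat.even_or_odd' a with ⟨b, rfl | rfl⟩
    · refine h2.mono le_rfl ?_ (by ring_nf; omega)
      rw [Nat.mul_div_cancel_left _ (by norm_num)]
      refine le_of_eq (congrArg zBits (funext fun x => ?_))
      push_cast; ring
    · refine (h2.zadd (Gen.of_subset (T := zBits u) le_rfl)).mono le_rfl ?_ (by ring_nf; omega)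
      have : (2 * b + 1) / 2 = b := by omega
      rw [this]
      refine le_of_eq (congrArg zBits (funext fun x => ?_))
      push_cast; ring

lemma Gen.zmul {u : X → ZMod q} (hu : Gen inp S (zBits u) c) (a : ZMod q) :
    Gen inp S (zBits fun x => a * u x) (c + (2 * bitLen q + 1) * addCost q) := by
  refine (hu.comp (gen_nat_mul (bitLen q) u a.val (a.val_lt.trans_le le_two_pow_bitLen))).mono
    le_rfl ?_ le_rfl
  simp

/-- A bound on the cost of an affine function of `N` residues modulo `q`. -/
def affineCost (q N : ℕ) : ℕ := (N + 1) * ((2 * bitLen q + 3) * addCost q)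

/-- Affine functions are computed by short straight-line programs. -/
lemma gen_affine {ι : Type} [Fintype ι] {u : ι → X → ZMod q} (hu : ∀ i, zBits (u i) ⊆ S)
    (a : ι → ZMod q) (b : ZMod q) :
    Gen inp S (zBits fun x => ∑ i, a i * u i x + b) (affineCost q (Fintype.card ι)) := by
  classical
  have h : ∀ s : Finset ι, Gen inp S (zBits fun x => ∑ i ∈ s, a i * u i x)
      (s.card * ((2 * bitLen q + 2) * addCost q) + addCost q) := by
    intro s
    induction s using Finset.induction_on with
    | empty =>
      refine (gen_const (0 : ZMod q)).mono le_rfl (by simp only [Finset.sum_empty]; exact le_rfl) ?_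
      unfold addCost; simp; omega
    | insert i s hi ih =>
      rw [Finset.card_insert_of_notMem hi]
      refine ((Gen.zmul (Gen.of_subset (hu i)) (a i)).zadd ih).mono le_rfl ?_ (by ring_nf; rfl)
      refine le_of_eq (congrArg zBits (funext fun x => ?_))
      rw [Finset.sum_insert hi]
  refine ((h Finset.univ).zadd_const b).mono le_rfl le_rfl ?_
  rw [Finset.card_univ]
  unfold affineCost
  nlinarith [Nat.zero_le (Fintype.card ι * addCost q), Nat.zero_le (bitLen q * addCost q)]

end Chain

/-! ### Affine maps over `ℤ_q` and the membership test as programs. -/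

section Programs

variable {X κ : Type} {inp : κ → X → Bool} {S : Set (X → Bool)} {c : ℕ} {q : ℕ}

/-- A bound on the cost of an affine map from `ℤ_q^N` to `ℤ_q^M`. -/
def affineMapCost (q N M : ℕ) : ℕ := N * bitLen q + M * affineCost q N

/-- Affine maps over `ℤ_q` are computed by short straight-line programs. -/
lemma gen_affine_map [NeZero q] {ι o : Type} [Fintype ι] [Fintype o] (a : o → ι → ZMod q)
    (b : o → ZMod q) :
    Gen (fun (p : ι × Fin (bitLen q)) (x : ι → ZMod q) => bits (x p.1) p.2) ∅
      (Set.range fun (p : o × Fin (bitLen q)) x => bits (∑ i, a p.1 i * x i + b p.1) p.2)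
      (affineMapCost q (Fintype.card ι) (Fintype.card o)) := by
  have h := Gen.comp (Gen.inputs (S := ∅)
    (inp := fun (p : ι × Fin (bitLen q)) (x : ι → ZMod q) => bits (x p.1) p.2))
    (Gen.iUnion fun k : o => gen_affine (u := fun i (x : ι → ZMod q) => x i) (fun i => by
      rintro _ ⟨j, rfl⟩
      exact ⟨(i, j), rfl⟩) (a k) (b k))
  refine h.mono le_rfl ?_ (by simp [affineMapCost])
  rintro _ ⟨⟨k, j⟩, rfl⟩
  exact Set.mem_iUnion.2 ⟨k, j, rfl⟩

/-! ### The test for membership in the hardcore sets -/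

lemma Gen.mux_add [NeZero q] {b : X → Bool} {u : X → ZMod q} (hb : b ∈ S) (hu : zBits u ⊆ S)
    (α β : ZMod q) :
    Gen inp S (zBits fun x => if b x then u x + α else u x + β)
      (4 * addCost q + bitLen q * 20) := by
  have h := (((Gen.of_subset hu).zadd_const α).union ((Gen.of_subset hu).zadd_const β)).comp_left
    (Gen.range fun j : Fin (bitLen q) => Gen.op3 (inp := inp)
      (S := S ∪ ((zBits fun x => u x + α) ∪ zBits fun x => u x + β))
      (f := b) (g := fun x => bits (u x + α) j) (h := fun x => bits (u x + β) j)
      (fun a b c => if a then b else c) (Or.inl hb) (Or.inr (Or.inl ⟨j, rfl⟩))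
      (Or.inr (Or.inr ⟨j, rfl⟩)))
  refine h.mono le_rfl ?_ (by simp; omega)
  rintro _ ⟨j, rfl⟩
  refine ⟨j, funext fun x => ?_⟩
  beta_reduce
  split_ifs <;> rfl

lemma Gen.dot_xor {u v : X → ZMod q} {e : Fin (bitLen q) → X → Bool} (hu : zBits u ⊆ S)
    (hv : zBits v ⊆ S) (he : ∀ j, e j ∈ S) :
    Gen inp S {fun x => LWE.dot (fun j => e j x) fun j => xor (bits (u x) j) (bits (v x) j)}
      (bitLen q * 24 + 2) := by
  refine (Gen.dot (F := e) (F' := fun j x => xor (bits (u x) j) (bits (v x) j))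
    (fun j => Gen.of_subset (by simpa using he j))
    (fun j => Gen.op2 xor (hu ⟨j, rfl⟩) (hv ⟨j, rfl⟩))).mono le_rfl le_rfl (by simp)

variable {n : ℕ}

/-- A bit string decoded as a tuple `(b, x, d, c)`. -/
def decodeTuple (q : ℕ) (y : TupleBit n q → Bool) : Tuple n q :=
  (y (.inl ()), fun i => (Nat.ofBits fun j => y (.inr (.inl (i, j))) : ZMod q),
    fun p => y (.inr (.inr (.inl p))), y (.inr (.inr (.inr ()))))

lemma decode_encodeTuple [NeZero q] (t : Tuple n q) : decodeTuple q (encodeTuple t) = t := by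
  obtain ⟨b, x, d, c⟩ := t
  unfold decodeTuple encodeTuple
  simp only [Sum.elim_inl, Sum.elim_inr, Prod.mk.injEq, true_and, and_true]
  funext i
  have : (Nat.ofBits fun j => J x (i, j)) = (x i).val := by
    refine Nat.eq_of_testBit_eq fun j => ?_
    rcases Nat.lt_or_ge j (bitLen q) with h | h
    · rw [Nat.testBit_ofBits_lt _ _ h]; rfl
    · rw [Nat.testBit_ofBits_ge _ _ h, Nat.testBit_lt_two_pow]
      exact ((x i).val_lt.trans_le le_two_pow_bitLen).trans_le
        (Nat.pow_le_pow_right (by norm_num) h)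
  rw [this]
  simp

lemma encodeTuple_injective [NeZero q] :
    Function.Injective (encodeTuple : Tuple n q → TupleBit n q → Bool) :=
  Function.LeftInverse.injective decode_encodeTuple

/-- `decodeTuple` reduces every block modulo `q`, so it also accepts blocks with value at least `q`.
The second condition rejects exactly these non-canonical strings. -/
lemma exists_encodeTuple_eq [NeZero q] (y : TupleBit n q → Bool) (S : Set (Tuple n q)) :
    (∃ t ∈ S, y = encodeTuple t) ↔ decodeTuple q y ∈ S ∧
      ∀ p : Fin n × Fin (bitLen q), J (decodeTuple q y).2.1 p = y (.inr (.inl p)) := by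
  constructor
  · rintro ⟨t, ht, rfl⟩
    rw [decode_encodeTuple]
    exact ⟨ht, fun p => rfl⟩
  · rintro ⟨h1, h2⟩
    refine ⟨_, h1, funext fun p => ?_⟩
    rcases p with _ | p | p | _
    · rfl
    · exact (h2 p).symm
    · rfl
    · rfl

/-- The tuples with `(b, x, d, c ⊕ h) ∈ H_s`. -/
def Hset (q : ℕ) (h : Bool) (s : Fin n → Bool) : Set (Tuple n q) :=
  {t | (t.1, t.2.1, t.2.2.1, xor t.2.2.2 h) ∈ H q s}

lemma Hset_false : Hset (n := n) q false = H q := by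
  funext s
  ext ⟨b, x, d, c⟩
  simp [Hset]

lemma Hset_true : Hset (n := n) q true = Hbar q := by
  funext s
  ext ⟨b, x, d, c⟩
  simp [Hset, Hbar]

/-- A bound on the cost of the test for membership in `H_s`. -/
def testCost (n q : ℕ) : ℕ := 2000 * (n + 1) * (bitLen q + 2) + 20 * n * addCost q

-- With `s` hard-wired, all points that occur are `x` plus one of two constants selected by `b`.
-- What remains is a conjunction of the canonicity check, two disjunctions over coordinates for
-- goodness, and one parity.
set_option maxHeartbeats 1000000 in
open Classical in
lemma gen_test (hq : 2 ≤ q) [NeZero q] (h : Bool) (s : Fin n → Bool) :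
    Gen (fun (k : TupleBit n q) (y : TupleBit n q → Bool) => y k) ∅
      {fun y => decide (∃ t ∈ Hset q h s, y = encodeTuple t)} (testCost n q) := by
  set inp : TupleBit n q → (TupleBit n q → Bool) → Bool := fun k y => y k with hinp
  let b (y : TupleBit n q → Bool) : Bool := y (.inl ())
  let x (i : Fin n) (y : TupleBit n q → Bool) : ZMod q := (decodeTuple q y).2.1 i
  let d (p : Fin n × Fin (bitLen q)) (y : TupleBit n q → Bool) : Bool := y (.inr (.inr (.inl p)))
  let c (y : TupleBit n q → Bool) : Bool := y (.inr (.inr (.inr ())))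
  let x1 (i : Fin n) (y : TupleBit n q → Bool) : ZMod q := if b y then x i y + 1 else x i y + -1
  let xs (i : Fin n) (y : TupleBit n q → Bool) : ZMod q :=
    if b y then x i y + vec q s i else x i y + -vec q s i
  -- The other preimage `x ∓ s` carries the opposite bit, so its step by the all-ones vector goes
  -- the other way.
  let xs1 (i : Fin n) (y : TupleBit n q → Bool) : ZMod q :=
    if b y then x i y + (vec q s i - 1) else x i y + (-vec q s i + 1)
  set S0 := Set.range inp with hS0
  have h0 : Gen inp ∅ S0 (1 + (n * bitLen q + (n * bitLen q + 1))) :=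
    Gen.inputs.mono le_rfl le_rfl (by simp)
  -- the residues
  have h1 : ∀ i, Gen inp S0 (zBits (x i)) (102 * (bitLen q + 2)) := by
    intro i
    have e1 : ∀ j : Fin (bitLen q + 2), Gen inp S0 {fun y =>
        (Nat.ofBits fun j => y (.inr (.inl (i, j))) : ℕ).testBit j} 2 := by
      intro j
      by_cases hj : j.val < bitLen q
      · refine (Gen.of_subset (S := S0) (T := {inp (.inr (.inl (i, ⟨j, hj⟩)))}) ?_).mono le_rfl ?_
          (by norm_num)
        · rw [Set.singleton_subset_iff]; exact ⟨_, rfl⟩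
        · rw [Set.singleton_subset_iff, Set.mem_singleton_iff]
          funext y
          rw [Nat.testBit_ofBits_lt _ _ hj]
      · refine (Gen.const false).mono le_rfl ?_ le_rfl
        rw [Set.singleton_subset_iff, Set.mem_singleton_iff]
        funext y
        rw [Nat.testBit_ofBits_ge _ _ (by omega)]
    refine (((Gen.range e1).mono (T' := natBits (bitLen q + 2) fun y : TupleBit n q → Bool =>
      (Nat.ofBits fun j => y (.inr (.inl (i, j))) : ℕ)) le_rfl ?_ le_rfl).comp
        (gen_reduce (q := q) fun y => ?_)).mono le_rfl le_rfl (by simp; omega)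
    · rintro f ⟨j, hj, rfl⟩
      exact ⟨⟨j, hj⟩, rfl⟩
    · refine (Nat.ofBits_lt_two_pow _).trans_le ?_
      -- A block of `bitLen q` bits has value below `2 * 2 ^ (bitLen q - 1) < 2 q`, so one
      -- conditional subtraction suffices.
      have e2 := Nat.pow_pred_clog_lt_self (b := 2) (by norm_num) (show 1 < q by omega)
      have e3 : 0 < bitLen q := Nat.clog_pos (by norm_num) hq
      have e4 : 2 ^ bitLen q = 2 ^ (bitLen q - 1) * 2 := by
        rw [← pow_succ]; congr 1; omega
      unfold bitLen at *
      rw [Nat.pred_eq_sub_one] at e2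
      omega
  set S1 := S0 ∪ ⋃ i, zBits (x i) with hS1
  have h1' : Gen inp S0 S1 _ := (Gen.of_subset le_rfl).union (Gen.iUnion h1)
  have hb1 : b ∈ S1 := Or.inl ⟨.inl (), rfl⟩
  have hx1 : ∀ i, zBits (x i) ⊆ S1 := fun i f hf => Or.inr (Set.mem_iUnion.2 ⟨i, hf⟩)
  set S2 := S1 ∪ (((⋃ i, zBits (x1 i)) ∪ ⋃ i, zBits (xs i)) ∪ ⋃ i, zBits (xs1 i)) with hS2
  have h2 : Gen inp S1 S2 _ := (Gen.of_subset le_rfl).union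
    (((Gen.iUnion fun i => Gen.mux_add hb1 (hx1 i) 1 (-1)).union
      (Gen.iUnion fun i => Gen.mux_add hb1 (hx1 i) (vec q s i) (-vec q s i))).union
      (Gen.iUnion fun i => Gen.mux_add hb1 (hx1 i) (vec q s i - 1) (-vec q s i + 1)))
  have hin : ∀ k, inp k ∈ S2 := fun k => Or.inl (Or.inl ⟨k, rfl⟩)
  have hb : b ∈ S2 := hin _
  have hd : ∀ p, d p ∈ S2 := fun p => hin _
  have hc : c ∈ S2 := hin _
  have hx : ∀ i, zBits (x i) ⊆ S2 := fun i f hf => Or.inl (hx1 i hf)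
  have hx1 : ∀ i, zBits (x1 i) ⊆ S2 :=
    fun i f hf => Or.inr (Or.inl (Or.inl (Set.mem_iUnion.2 ⟨i, hf⟩)))
  have hxs : ∀ i, zBits (xs i) ⊆ S2 :=
    fun i f hf => Or.inr (Or.inl (Or.inr (Set.mem_iUnion.2 ⟨i, hf⟩)))
  have hxs1 : ∀ i, zBits (xs1 i) ⊆ S2 := fun i f hf => Or.inr (Or.inr (Set.mem_iUnion.2 ⟨i, hf⟩))
  -- the three conditions
  have gv := Gen.all (inp := inp) (S := S2) fun p : Fin n × Fin (bitLen q) =>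
    Gen.op2 (fun a b => a == b) (hx p.1 ⟨p.2, rfl⟩) (hin (.inr (.inl p)))
  have gG := Gen.any (inp := inp) (S := S2) fun i : Fin n =>
    Gen.op2' (fun a b => a && b) (Gen.op1 (fun a => decide (half n a i)) hb)
      (Gen.dot_xor (hx i) (hx1 i) fun j => hd (i, j))
  have gG' := Gen.any (inp := inp) (S := S2) fun i : Fin n =>
    Gen.op2' (fun a b => a && b) (Gen.op1 (fun a => decide (half n (!a) i)) hb)
      (Gen.dot_xor (hxs i) (hxs1 i) fun j => hd (i, j))
  have gc := Gen.dot (inp := inp) (S := S2) (F := d) (c := 0)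
    (F' := fun p y => xor (bits (x p.1 y) p.2) (bits (xs p.1 y) p.2))
    (fun p => Gen.of_subset (by simpa using hd p))
    (fun p => Gen.op2 xor (hx p.1 ⟨p.2, rfl⟩) (hxs p.1 ⟨p.2, rfl⟩))
  have gcc := gc.op2' (fun e a => xor a h == e) (Gen.of_subset (T := {c}) (by simpa using hc))
  have gtot := (gv.op2' (fun a b => a && b) gcc).op2' (fun a b => a && b)
    (gG.op2' (fun a b => a && b) gG')
  refine ((h0.comp h1').comp (h2.comp gtot)).mono le_rfl ?_ ?_
  · rw [Set.singleton_subset_iff, Set.mem_singleton_iff]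
    funext y
    rw [Bool.eq_iff_iff, decide_eq_true_eq, exists_encodeTuple_eq]
    have em : ∀ i, move (b y) (decodeTuple q y).2.1 1 i = x1 i y := by
      intro i
      simp only [x1, x, move, sub_eq_add_neg]
      cases b y <;> simp
    have es : ∀ i, move (b y) (decodeTuple q y).2.1 (vec q s) i = xs i y := by
      intro i
      simp only [xs, x, move, sub_eq_add_neg]
      cases b y <;> simp
    have es1 : ∀ i, move (!(b y)) (move (b y) (decodeTuple q y).2.1 (vec q s)) 1 i = xs1 i y := by
      intro i
      simp only [xs1, x, move]
      cases b y <;> simp <;> ring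
    have hG : (decodeTuple q y).2.2.1 ∈ G (b y) (decodeTuple q y).2.1 ↔
        ∃ i, half n (b y) i ∧ LWE.dot (fun j => d (i, j) y)
          (fun j => xor (bits (x i y) j) (bits (x1 i y) j)) = true := by
      refine exists_congr fun i => and_congr_right fun _ => ?_
      simp only [I, J, em, x, d]
      rfl
    have hG' : (decodeTuple q y).2.2.1 ∈ G (!(b y))
        (move (b y) (decodeTuple q y).2.1 (vec q s)) ↔
        ∃ i, half n (!(b y)) i ∧ LWE.dot (fun j => d (i, j) y)
          (fun j => xor (bits (xs i y) j) (bits (xs1 i y) j)) = true := by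
      refine exists_congr fun i => and_congr_right fun _ => ?_
      simp only [I, J, es, es1, d]
      rfl
    have hH : decodeTuple q y ∈ Hset q h s ↔ ((decodeTuple q y).2.2.1 ∈ G (b y) (decodeTuple q y).2.1 ∧
        (decodeTuple q y).2.2.1 ∈ G (!(b y)) (move (b y) (decodeTuple q y).2.1 (vec q s))) ∧
        xor (c y) h = LWE.dot (fun p => d p y) fun p =>
          xor (bits (x p.1 y) p.2) (bits (xs p.1 y) p.2) := by
      have := mem_H (q := q) (s := s) (b := b y) (x := (decodeTuple q y).2.1)
        (d := (decodeTuple q y).2.2.1) (c := xor (c y) h)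
      rw [mem_goodSet] at this
      simp only [J, es] at this
      exact this
    rw [hH, hG, hG']
    simp only [Bool.and_eq_true, decide_eq_true_eq, beq_iff_eq, J, x, hinp]
    tauto
  · simp only [Fintype.card_fin, Fintype.card_prod]
    unfold testCost
    generalize addCost q = A
    generalize bitLen q = k
    nlinarith [Nat.zero_le (n * k)]

end Programs

/-! ### Running lists of gates -/

section Run

variable {Q Q' : Type} [DecidableEq Q] [DecidableEq Q']

/-- The action of a list of gates on a state vector. -/
noncomputable def run (gs : List (Gate Q)) (ψ : (Q → Bool) → ℂ) : (Q → Bool) → ℂ :=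
  gs.foldl (fun ψ g => g.apply ψ) ψ

lemma run_append (gs gs' : List (Gate Q)) (ψ : (Q → Bool) → ℂ) :
    run (gs ++ gs') ψ = run gs' (run gs ψ) := by simp [run]

lemma apply_zero (g : Gate Q) : g.apply 0 = 0 := by
  funext x
  cases g <;> simp [Gate.apply]

lemma run_zero (gs : List (Gate Q)) : run gs 0 = 0 := by
  induction gs with
  | nil => rfl
  | cons g gs ih => simpa [run, apply_zero] using ih

/-- A gate on a subset of the qubits as a gate on all qubits. -/
def Gate.map (f : Q ↪ Q') : Gate Q → Gate Q'
  | .had i => .had (f i)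
  | .tgate i => .tgate (f i)
  | .not i => .not (f i)
  | .cnot i j h => .cnot (f i) (f j) (f.injective.ne h)
  | .toffoli i j k h h' h'' =>
      .toffoli (f i) (f j) (f k) (f.injective.ne h) (f.injective.ne h') (f.injective.ne h'')

/-- The part of a state vector in which the qubits outside of the range of `f` have the
values `r`. -/
noncomputable def slice (f : Q ↪ Q') (r : Q' → Bool) (ψ : (Q' → Bool) → ℂ) : (Q → Bool) → ℂ :=
  fun x => ψ (Function.extend f x r)

lemma update_extend (f : Q ↪ Q') (r : Q' → Bool) (x : Q → Bool) (i : Q) (b : Bool) :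
    Function.update (Function.extend f x r) (f i) b =
      Function.extend f (Function.update x i b) r := by
  funext p
  by_cases hp : ∃ k, f k = p
  · obtain ⟨k, rfl⟩ := hp
    rw [f.injective.extend_apply]
    by_cases hk : k = i
    · subst hk; simp
    · rw [Function.update_of_ne (f.injective.ne hk), f.injective.extend_apply,
        Function.update_of_ne hk]
  · rw [Function.extend_apply' _ _ _ hp, Function.update_of_ne, Function.extend_apply' _ _ _ hp]
    rintro rfl
    exact hp ⟨i, rfl⟩

/-- A gate on the range of `f` neither reads nor changes the remaining qubits, so each slice evolves
separately. -/
lemma slice_apply_map (f : Q ↪ Q') (r : Q' → Bool) (g : Gate Q) (ψ : (Q' → Bool) → ℂ) :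
    slice f r ((g.map f).apply ψ) = g.apply (slice f r ψ) := by
  funext x
  cases g <;> simp [Gate.map, Gate.apply, slice, update_extend, f.injective.extend_apply]

lemma slice_run_map (f : Q ↪ Q') (r : Q' → Bool) (gs : List (Gate Q)) (ψ : (Q' → Bool) → ℂ) :
    slice f r (run (gs.map (Gate.map f)) ψ) = run gs (slice f r ψ) := by
  induction gs generalizing ψ with
  | nil => rfl
  | cons g gs ih =>
    have := ih ((g.map f).apply ψ)
    rw [slice_apply_map] at this
    exact this

omit [DecidableEq Q] [DecidableEq Q'] in
lemma extend_comp_self (f : Q ↪ Q') (x : Q' → Bool) : Function.extend f (fun i => x (f i)) x = x := by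
  funext p
  by_cases hp : ∃ k, f k = p
  · obtain ⟨k, rfl⟩ := hp
    rw [f.injective.extend_apply]
  · rw [Function.extend_apply' _ _ _ hp]

lemma run_map_apply (f : Q ↪ Q') (gs : List (Gate Q)) (ψ : (Q' → Bool) → ℂ) (x : Q' → Bool) :
    run (gs.map (Gate.map f)) ψ x = run gs (slice f x ψ) fun i => x (f i) := by
  rw [← slice_run_map]
  simp only [slice, extend_comp_self]

end Run

/-! ### Unitarity -/

section Unitary

variable {Q : Type} [DecidableEq Q] [Fintype Q]

/-- The negation of one bit. -/
def flipEquiv (i : Q) : (Q → Bool) ≃ (Q → Bool) :=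
  Function.Involutive.toPerm (fun x => Function.update x i (!(x i))) fun x => by simp

/-- Strings that differ only in bit `i` are paired, and each pair is the parallelogram law. -/
lemma sum_norm_had (i : Q) (ψ : (Q → Bool) → ℂ) :
    ∑ x, ‖(Gate.had i).apply ψ x‖ ^ 2 = ∑ x, ‖ψ x‖ ^ 2 := by
  have h : ∀ F : (Q → Bool) → ℝ, ∑ x, F x = (1 / 2) * ∑ x, (F x + F (flipEquiv i x)) := by
    intro F
    rw [Finset.sum_add_distrib, (flipEquiv i).sum_comp]
    ring
  have par : ∀ a b : ℂ, ‖((Real.sqrt 2 : ℝ) : ℂ)⁻¹ * (a + b)‖ ^ 2 +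
      ‖((Real.sqrt 2 : ℝ) : ℂ)⁻¹ * (a - b)‖ ^ 2 = ‖a‖ ^ 2 + ‖b‖ ^ 2 := by
    intro a b
    have h2 := parallelogram_law_with_norm ℝ a b
    rw [norm_mul, norm_mul, mul_pow, mul_pow, norm_inv, Complex.norm_real, Real.norm_eq_abs,
      inv_pow, sq_abs, Real.sq_sqrt (by norm_num)]
    nlinarith
  rw [h, h fun x => ‖ψ x‖ ^ 2]
  congr 1
  refine Finset.sum_congr rfl fun x _ => ?_
  have e3 : flipEquiv i x = Function.update x i (!(x i)) := rfl
  have e : ∀ b, Function.update (flipEquiv i x) i b = Function.update x i b := by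
    intro b; simp [e3]
  have e2 : flipEquiv i x i = !(x i) := by simp [e3]
  simp only [Gate.apply, e, e2]
  rw [e3]
  have p := par (ψ (Function.update x i false)) (ψ (Function.update x i true))
  cases hx : x i
  · have : Function.update x i false = x := by rw [← hx]; simp
    rw [this] at p ⊢
    simp only [Bool.not_false, if_true, Bool.false_eq_true, if_false, one_mul, neg_one_mul,
      ← sub_eq_add_neg]
    exact p
  · have : Function.update x i true = x := by rw [← hx]; simp
    rw [this] at p ⊢
    simp only [Bool.not_true, if_true, Bool.false_eq_true, if_false, one_mul, neg_one_mul,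
      ← sub_eq_add_neg]
    linarith

lemma sum_norm_apply (g : Gate Q) (ψ : (Q → Bool) → ℂ) :
    ∑ x, ‖g.apply ψ x‖ ^ 2 = ∑ x, ‖ψ x‖ ^ 2 := by
  cases g with
  | had i => exact sum_norm_had i ψ
  | tgate i =>
    refine Finset.sum_congr rfl fun x _ => ?_
    have h : ‖Complex.exp (Complex.I * Real.pi / 4)‖ = 1 := by
      have : Complex.I * Real.pi / 4 = ((Real.pi / 4 : ℝ) : ℂ) * Complex.I := by push_cast; ring
      rw [this, Complex.norm_exp_ofReal_mul_I]
    simp only [Gate.apply, norm_mul]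
    split_ifs <;> simp [h]
  | not i => exact (flipEquiv i).sum_comp fun x => ‖ψ x‖ ^ 2
  | cnot i j h =>
    refine Equiv.sum_comp (Function.Involutive.toPerm
      (fun x : Q → Bool => Function.update x j (xor (x j) (x i))) fun x => ?_) fun x => ‖ψ x‖ ^ 2
    simp [Function.update_of_ne h]
  | toffoli i j k h h' h'' =>
    refine Equiv.sum_comp (Function.Involutive.toPerm
      (fun x : Q → Bool => Function.update x k (xor (x k) (x i && x j))) fun x => ?_)
      fun x => ‖ψ x‖ ^ 2
    simp [Function.update_of_ne h', Function.update_of_ne h'']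

lemma sum_norm_run (gs : List (Gate Q)) (ψ : (Q → Bool) → ℂ) :
    ∑ x, ‖run gs ψ x‖ ^ 2 = ∑ x, ‖ψ x‖ ^ 2 := by
  induction gs generalizing ψ with
  | nil => rfl
  | cons g gs ih => exact (ih (g.apply ψ)).trans (sum_norm_apply g ψ)

end Unitary

namespace QCircuit

variable {ι o : Type} [Fintype ι] [DecidableEq ι]

omit [Fintype ι] in
lemma final_eq_run (C : QCircuit ι o) (z : ι → Bool) : C.final z = run C.gates (C.initial z) := rfl

lemma sum_norm_initial (C : QCircuit ι o) (z : ι → Bool) : ∑ x, ‖C.initial z x‖ ^ 2 = 1 := by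
  classical
  rw [← C.advice_norm]
  symm
  refine Finset.sum_of_injOn
    (fun a => Sum.elim z (Sum.elim a fun _ => false)) ?_ (by simp) ?_ ?_
  · intro a _ b _ h
    funext j
    exact congrFun h (Sum.inr (Sum.inl j))
  · intro x _ hx
    rw [initial, if_neg]
    · simp
    · rintro ⟨h1, h2⟩
      refine hx ⟨fun j => x (Sum.inr (Sum.inl j)), by simp, ?_⟩
      funext p
      rcases p with k | k | k
      · exact (h1 k).symm
      · rfl
      · exact (h2 k).symm
  · intro a _
    simp [initial]

lemma prob_nonneg (C : QCircuit ι o) (z : ι → Bool) (y : o → Bool) : 0 ≤ C.prob z y :=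
  Finset.sum_nonneg fun _ _ => sq_nonneg _

lemma sum_prob [Fintype o] [DecidableEq o] (C : QCircuit ι o) (z : ι → Bool) : ∑ y, C.prob z y = 1 := by
  classical
  rw [← C.sum_norm_initial z, ← sum_norm_run C.gates, ← final_eq_run]
  unfold prob
  simp only [Finset.sum_filter]
  rw [Finset.sum_comm]
  refine Finset.sum_congr rfl fun x _ => ?_
  rw [Finset.sum_eq_single fun i => x (C.output i)]
  · simp
  · intro y _ hy
    rw [if_neg]
    intro h
    exact hy (funext fun i => (h i).symm)
  · simp

end QCircuit

/-! ### Classical gates -/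

section Classical

variable {Q : Type} [DecidableEq Q]

/-- The classical gates. -/
inductive CGate (Q : Type) : Type
  | not (i : Q) : CGate Q
  | cnot (i j : Q) (hij : i ≠ j) : CGate Q
  | toffoli (i j k : Q) (hij : i ≠ j) (hik : i ≠ k) (hjk : j ≠ k) : CGate Q

/-- A classical gate as a gate. -/
def CGate.toGate : CGate Q → Gate Q
  | .not i => .not i
  | .cnot i j h => .cnot i j h
  | .toffoli i j k h h' h'' => .toffoli i j k h h' h''

/-- The action of a classical gate on bit strings. -/
def CGate.act (g : CGate Q) (x : Q → Bool) : Q → Bool :=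
  match g with
  | .not i => Function.update x i (!(x i))
  | .cnot i j _ => Function.update x j (xor (x j) (x i))
  | .toffoli i j k _ _ _ => Function.update x k (xor (x k) (x i && x j))

lemma CGate.act_act (g : CGate Q) (x : Q → Bool) : g.act (g.act x) = x := by
  cases g with
  | not i => simp [act]
  | cnot i j h => simp [act, Function.update_of_ne h]
  | toffoli i j k h h' h'' => simp [act, Function.update_of_ne h', Function.update_of_ne h'']

lemma CGate.apply_toGate (g : CGate Q) (ψ : (Q → Bool) → ℂ) (x : Q → Bool) :
    g.toGate.apply ψ x = ψ (g.act x) := by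
  cases g <;> rfl

/-- The action of a list of classical gates on bit strings. -/
def cact (gs : List (CGate Q)) (x : Q → Bool) : Q → Bool := gs.foldl (fun x g => g.act x) x

lemma cact_append (gs gs' : List (CGate Q)) (x : Q → Bool) :
    cact (gs ++ gs') x = cact gs' (cact gs x) := by simp [cact]

/-- Classical gates are involutions, so running them transports amplitudes along the permutation
`cact gs`. -/
lemma run_toGate_cact (gs : List (CGate Q)) (ψ : (Q → Bool) → ℂ) (x : Q → Bool) :
    run (gs.map CGate.toGate) ψ (cact gs x) = ψ x := by
  induction gs generalizing ψ x with
  | nil => rfl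
  | cons g gs ih =>
    refine (ih (g.toGate.apply ψ) (g.act x)).trans ?_
    rw [g.apply_toGate, g.act_act]

lemma cact_bijective (gs : List (CGate Q)) : Function.Bijective (cact gs) := by
  induction gs with
  | nil => exact Function.bijective_id
  | cons g gs ih =>
    exact ih.comp (Function.Involutive.bijective g.act_act)

variable {X κ κ' : Type} {inp : κ → X → Bool}

/-- The circuit `gs` writes the values of the functions in `L` to the qubits `a`. -/
def Writes (inp : κ → X → Bool) (L : List (X → Bool)) (w : κ → Q) (a : Fin L.length ↪ Q)
    (gs : List (CGate Q)) : Prop :=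
  ∀ (z : X) (st : Q → Bool), (∀ k, st (w k) = inp k z) → (∀ j, st (a j) = false) →
    (∀ j, cact gs st (a j) = L.get j z) ∧ ∀ p, (∀ j, p ≠ a j) → cact gs st p = st p

lemma Writes.cons {L : List (X → Bool)} {f : X → Bool} {w : κ → Q}
    {a : Fin (f :: L).length ↪ Q} (haw : ∀ j k, a j ≠ w k) {gs gs' : List (CGate Q)}
    (hgs : Writes inp L w ((Fin.succEmb _).trans a) gs)
    (hgs' : ∀ (z : X) (st : Q → Bool), (∀ k, st (w k) = inp k z) → st (a 0) = false →
      (∀ j : Fin L.length, st (a j.succ) = L.get j z) →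
        cact gs' st = Function.update st (a 0) (f z)) :
    Writes inp (f :: L) w a (gs ++ gs') := by
  intro z st hw ha
  obtain ⟨h1, h2⟩ := hgs z st hw fun j => ha _
  have n0 : ∀ j : Fin L.length, a j.succ ≠ a 0 := fun j => a.injective.ne (Fin.succ_ne_zero j)
  rw [cact_append, hgs' z _ (fun k => (h2 _ fun j => (haw _ k).symm).trans (hw k))
    ((h2 _ fun j => (n0 j).symm).trans (ha 0)) h1]
  constructor
  · intro j
    refine Fin.cases ?_ (fun j => ?_) j
    · rw [Function.update_self]; rfl
    · rw [Function.update_of_ne (n0 j)]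
      exact h1 j
  · intro p hp
    rw [Function.update_of_ne (hp 0)]
    exact h2 p fun j => hp _

/-- Straight-line programs as classical circuits. -/
lemma Chain.exists_circuit {L : List (X → Bool)} (hL : Chain inp L) (w : κ → Q)
    (a : Fin L.length ↪ Q) (haw : ∀ j k, a j ≠ w k) :
    ∃ gs : List (CGate Q), gs.length ≤ 2 * L.length ∧ Writes inp L w a gs := by
  induction hL with
  | nil => exact ⟨[], le_rfl, fun z st _ _ => ⟨fun j => j.elim0, fun p _ => rfl⟩⟩
  | @true L hL ih =>
    obtain ⟨gs, hlen, hgs⟩ := ih ((Fin.succEmb _).trans a) fun j k => haw _ k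
    refine ⟨gs ++ [.not (a 0)], by simp; omega, hgs.cons haw fun z st _ h0 _ => ?_⟩
    simp [cact, CGate.act, h0]
  | @inp L k hL ih =>
    obtain ⟨gs, hlen, hgs⟩ := ih ((Fin.succEmb _).trans a) fun j k => haw _ k
    refine ⟨gs ++ [.cnot (w k) (a 0) (haw 0 k).symm], by simp; omega,
      hgs.cons haw fun z st hw h0 _ => ?_⟩
    simp [cact, CGate.act, h0, hw]
  | @nand L f g hf hg hL ih =>
    obtain ⟨gs, hlen, hgs⟩ := ih ((Fin.succEmb _).trans a) fun j k => haw _ k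
    obtain ⟨i, rfl⟩ := List.mem_iff_get.1 hf
    obtain ⟨i', rfl⟩ := List.mem_iff_get.1 hg
    have n0 : ∀ j : Fin L.length, a j.succ ≠ a 0 := fun j => a.injective.ne (Fin.succ_ne_zero j)
    -- A Toffoli gate needs distinct controls, so the NAND of a value with itself is done by a CNOT.
    by_cases h : i = i'
    · subst h
      refine ⟨gs ++ [.cnot (a i.succ) (a 0) (n0 i), .not (a 0)], by simp; omega,
        hgs.cons haw fun z st _ h0 hv => ?_⟩
      have := hv i
      simp [cact, CGate.act, h0, this]
    · refine ⟨gs ++ [.toffoli (a i.succ) (a i'.succ) (a 0)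
        (a.injective.ne fun h' => h (Fin.succ_injective _ h')) (n0 i) (n0 i'), .not (a 0)],
        by simp; omega, hgs.cons haw fun z st _ h0 hv => ?_⟩
      have h1 := hv i
      have h2 := hv i'
      simp [cact, CGate.act, h0, h1, h2]

/-- Copying the values of some qubits to fresh qubits. -/
lemma exists_copy_circuit (src : κ' → Q) (out : κ' ↪ Q) (h : ∀ k k', src k ≠ out k')
    (l : List κ') (hl : l.Nodup) :
    ∃ gs : List (CGate Q), gs.length = l.length ∧ ∀ st : Q → Bool, (∀ k, st (out k) = false) →
      (∀ k ∈ l, cact gs st (out k) = st (src k)) ∧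
        ∀ p, (∀ k ∈ l, p ≠ out k) → cact gs st p = st p := by
  induction l with
  | nil => exact ⟨[], rfl, fun st _ => ⟨by simp, fun p _ => rfl⟩⟩
  | cons k l ih =>
    rw [List.nodup_cons] at hl
    obtain ⟨gs, hlen, hgs⟩ := ih hl.2
    refine ⟨gs ++ [.cnot (src k) (out k) (h k k)], by simp [hlen], fun st hst => ?_⟩
    obtain ⟨h1, h2⟩ := hgs st hst
    have hk : ∀ k' ∈ l, out k ≠ out k' := fun k' hk' e => hl.1 (out.injective e ▸ hk')
    have e1 : cact gs st (out k) = false := (h2 _ hk).trans (hst k)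
    have e2 : cact gs st (src k) = st (src k) := h2 _ fun k' _ => h k k'
    rw [cact_append]
    simp only [cact, List.foldl_cons, List.foldl_nil, CGate.act] at e1 e2 h1 h2 ⊢
    constructor
    · intro k' hk'
      rcases List.mem_cons.1 hk' with rfl | hk'
      · simp [e1, e2]
      · rw [Function.update_of_ne (hk k' hk').symm]
        exact h1 k' hk'
    · intro p hp
      rw [Function.update_of_ne (hp k (List.mem_cons_self))]
      exact h2 p fun k' hk' => hp k' (List.mem_cons_of_mem _ hk')

/-- Straight-line programs as classical circuits: the values of the functions `F k` are written
to the qubits `out k`, with the help of the qubits `a`. -/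
lemma Chain.exists_circuit_out [Fintype κ'] {L : List (X → Bool)} (hL : Chain inp L) (w : κ → Q)
    (a : Fin L.length ↪ Q) (haw : ∀ j k, a j ≠ w k) (out : κ' ↪ Q) (hao : ∀ j k, a j ≠ out k)
    {F : κ' → X → Bool} (hF : ∀ k, F k ∈ L) :
    ∃ gs : List (CGate Q), gs.length ≤ 2 * L.length + Fintype.card κ' ∧
      ∀ (z : X) (st : Q → Bool), (∀ k, st (w k) = inp k z) → (∀ j, st (a j) = false) →
        (∀ k, st (out k) = false) →
        (∀ j, cact gs st (a j) = L.get j z) ∧ (∀ k, cact gs st (out k) = F k z) ∧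
        ∀ p, (∀ j, p ≠ a j) → (∀ k, p ≠ out k) → cact gs st p = st p := by
  obtain ⟨gs, hlen, hgs⟩ := hL.exists_circuit w a haw
  choose i hi using fun k => List.mem_iff_get.1 (hF k)
  obtain ⟨gs', hlen', hgs'⟩ := exists_copy_circuit (fun k => a (i k)) out (fun k k' => hao _ _)
    Finset.univ.toList (Finset.nodup_toList _)
  refine ⟨gs ++ gs', ?_, fun z st hw ha ho => ?_⟩
  · rw [List.length_append, hlen', Finset.length_toList, Finset.card_univ]
    omega
  obtain ⟨h1, h2⟩ := hgs z st hw ha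
  obtain ⟨h3, h4⟩ := hgs' (cact gs st) fun k => (h2 _ fun j => (hao j k).symm).trans (ho k)
  rw [cact_append]
  refine ⟨fun j => (h4 _ fun k _ => hao j k).trans (h1 j), fun k => ?_, fun p hp hp' => ?_⟩
  · rw [h3 k (by simp), h1, hi]
  · rw [h4 p fun k _ => hp' k, h2 p hp]

end Classical

/-! ### Classical processing before and after a quantum circuit -/

section Wrap

variable {ι ι' o' X : Type} [Fintype ι] [Fintype ι'] [Fintype o'] [DecidableEq ι] [DecidableEq ι']
  [DecidableEq o']

/-- The ancillas of a wrapped circuit. -/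
abbrev WrapAncilla (C : QCircuit ι' o') (l₁ l₂ : ℕ) : Type :=
  ι' ⊕ Fin C.ancillas ⊕ Fin l₁ ⊕ Fin l₂ ⊕ Unit

/-- The qubits of a wrapped circuit. -/
abbrev WrapQubit (ι : Type) (C : QCircuit ι' o') (l₁ l₂ : ℕ) : Type :=
  ι ⊕ Fin C.adviceQubits ⊕ Fin (Fintype.card (WrapAncilla C l₁ l₂))

/-- The position of an ancilla in a wrapped circuit. -/
noncomputable def wrapAnc (ι : Type) (C : QCircuit ι' o') (l₁ l₂ : ℕ) :
    WrapAncilla C l₁ l₂ ↪ WrapQubit ι C l₁ l₂ :=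
  ⟨fun k => Sum.inr (Sum.inr (Fintype.equivFin _ k)), fun k k' h => by simpa using h⟩

omit [Fintype ι] [Fintype o'] [DecidableEq ι] [DecidableEq ι'] [DecidableEq o'] in
lemma wrapAnc_apply (C : QCircuit ι' o') (l₁ l₂ : ℕ) (k : WrapAncilla C l₁ l₂) :
    wrapAnc ι C l₁ l₂ k = Sum.inr (Sum.inr (Fintype.equivFin _ k)) := rfl

/-- The position of a qubit of a circuit in a wrapped circuit. -/
noncomputable def wrapQubit (ι : Type) (C : QCircuit ι' o') (l₁ l₂ : ℕ) :
    C.Qubit ↪ WrapQubit ι C l₁ l₂ :=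
  ⟨Sum.elim (fun k => wrapAnc ι C l₁ l₂ (.inl k)) (Sum.elim (fun j => .inr (.inl j))
    fun j => wrapAnc ι C l₁ l₂ (.inr (.inl j))), by
    rintro (k | k | k) (k' | k' | k') h <;> simp [wrapAnc_apply] at h <;> simp [h]⟩

open Classical in
/-- A quantum circuit preceded by a straight-line program that computes its input and followed by
a straight-line program that tests its output. -/
lemma exists_wrapped_circuit (C : QCircuit ι' o') {inp : ι → X → Bool} {F : ι' → X → Bool}
    {c₁ c₂ : ℕ} (hF : Gen inp ∅ (Set.range F) c₁) {T : (o' → Bool) → Bool}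
    (hT : Gen (fun (k : o') (y : o' → Bool) => y k) ∅ {T} c₂) :
    ∃ D : QCircuit ι Unit,
      D.size ≤ C.size + (2 * Fintype.card ι' + 3 * c₁ + 3 * c₂ + 2) ∧
      ∀ z, D.prob (fun k => inp k z) (fun _ => true) =
        ∑ y, if T y = true then C.prob (fun k => F k z) y else 0 := by
  obtain ⟨L₁, hL₁, hF₁, hlen₁⟩ := hF.exists_chain
  obtain ⟨L₂, hL₂, hT₂, hlen₂⟩ := hT.exists_chain
  let anc := wrapAnc ι C L₁.length L₂.length
  have anc_surj : ∀ j, ∃ k, anc k = Sum.inr (Sum.inr j) := fun j =>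
    ⟨(Fintype.equivFin _).symm j, by simp [anc, wrapAnc_apply]⟩
  let f := wrapQubit ι C L₁.length L₂.length
  have f_inl : ∀ k, f (.inl k) = anc (.inl k) := fun _ => rfl
  have f_adv : ∀ j, f (.inr (.inl j)) = .inr (.inl j) := fun _ => rfl
  have f_anc : ∀ j, f (.inr (.inr j)) = anc (.inr (.inl j)) := fun _ => rfl
  let a₁ : Fin L₁.length ↪ WrapQubit ι C L₁.length L₂.length :=
    ((Function.Embedding.inl.trans Function.Embedding.inr).trans Function.Embedding.inr).trans anc
  have a₁_def : ∀ j, a₁ j = anc (.inr (.inr (.inl j))) := fun _ => rfl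
  let a₂ : Fin L₂.length ↪ WrapQubit ι C L₁.length L₂.length := (((Function.Embedding.inl.trans
    Function.Embedding.inr).trans Function.Embedding.inr).trans Function.Embedding.inr).trans anc
  have a₂_def : ∀ j, a₂ j = anc (.inr (.inr (.inr (.inl j)))) := fun _ => rfl
  let out := anc (.inr (.inr (.inr (.inr ()))))
  have out_def : out = anc (.inr (.inr (.inr (.inr ())))) := rfl
  have anc_ne : ∀ {k k'}, k ≠ k' → anc k ≠ anc k' := fun h => anc.injective.ne h
  have anc_inl : ∀ k i, anc k ≠ Sum.inl i := by intro k i; simp [anc, wrapAnc_apply]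
  have anc_adv : ∀ k j, anc k ≠ Sum.inr (Sum.inl j) := by intro k j; simp [anc, wrapAnc_apply]
  have f_ne : ∀ k : Fin L₁.length ⊕ Fin L₂.length ⊕ Unit, ∀ p, f p ≠ anc (.inr (.inr k)) := by
    rintro k (p | p | p)
    · exact anc_ne (by simp)
    · exact (anc_adv _ _).symm
    · exact anc_ne (by simp)
  have f_ne_inl : ∀ p i, f p ≠ Sum.inl i := by
    rintro (p | p | p) i
    · exact anc_inl _ _
    · rw [f_adv]; simp
    · exact anc_inl _ _
  obtain ⟨gs₁, hgs₁, h₁⟩ := hL₁.exists_circuit_out (fun i => Sum.inl i) a₁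
    (fun j k => anc_inl _ _) (Function.Embedding.inl.trans anc) (fun j k => anc_ne (by simp))
    (F := F) fun k => hF₁ _ ⟨k, rfl⟩
  obtain ⟨gs₂, hgs₂, h₂⟩ := hL₂.exists_circuit_out (fun i => f (C.output i)) a₂
    (fun j k => (f_ne _ _).symm) (κ' := Unit) ⟨fun _ => out, fun _ _ _ => rfl⟩
    (fun j k => anc_ne (by simp)) (F := fun _ => T) fun _ => hT₂ _ rfl
  let D : QCircuit ι Unit :=
    { adviceQubits := C.adviceQubits
      ancillas := Fintype.card (WrapAncilla C L₁.length L₂.length)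
      advice := C.advice
      advice_norm := C.advice_norm
      gates := gs₁.map CGate.toGate ++ (C.gates.map (Gate.map f) ++ gs₂.map CGate.toGate)
      output := ⟨fun _ => out, fun _ _ _ => rfl⟩ }
  refine ⟨D, ?_, fun z => ?_⟩
  · have hN : Fintype.card (WrapAncilla C L₁.length L₂.length) = Fintype.card ι' + (C.ancillas + (L₁.length + (L₂.length + 1))) := by
      simp
    simp only [QCircuit.size, D, List.length_append, List.length_map]
    simp only [Fintype.card_unit] at hgs₂
    omega
  -- the states
  let Fz : ι' → Bool := fun k => F k z
  let base (b : Fin C.adviceQubits → Bool) : WrapQubit ι C L₁.length L₂.length → Bool :=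
    Sum.elim (fun k => inp k z) (Sum.elim b fun _ => false)
  let r₀ : WrapQubit ι C L₁.length L₂.length → Bool := cact gs₁ (base fun _ => false)
  have base_anc : ∀ b k, base b (anc k) = false := fun b k => rfl
  have step₁ := fun b => h₁ z (base b) (fun k => rfl) (fun j => base_anc b _)
    (fun k => base_anc b _)
  have r_inl : ∀ b k, cact gs₁ (base b) (Sum.inl k) = inp k z := fun b k =>
    (step₁ b).2.2 _ (fun j => (anc_inl _ _).symm) fun k => (anc_inl _ _).symm
  have r_adv : ∀ b j, cact gs₁ (base b) (Sum.inr (Sum.inl j)) = b j := fun b j =>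
    (step₁ b).2.2 _ (fun j => (anc_adv _ _).symm) fun k => (anc_adv _ _).symm
  have r_in : ∀ b k, cact gs₁ (base b) (anc (.inl k)) = F k z := fun b k => (step₁ b).2.1 k
  have r_anc : ∀ b j, cact gs₁ (base b) (anc (.inr (.inl j))) = false := fun b j =>
    (step₁ b).2.2 _ (fun j => anc_ne (by simp)) fun k => anc_ne (by simp)
  have r_a₁ : ∀ b j, cact gs₁ (base b) (anc (.inr (.inr (.inl j)))) = L₁.get j z :=
    fun b j => (step₁ b).1 j
  have r_rest : ∀ b k, cact gs₁ (base b) (anc (.inr (.inr (.inr k)))) = false := fun b k =>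
    (step₁ b).2.2 _ (fun j => anc_ne (by simp)) fun k => anc_ne (by simp)
  -- The scratch values of the first program are never uncomputed. They depend on the classical
  -- input only and not on the advice basis state `b`, so they form a fixed basis state `r₀` that
  -- causes no decoherence in the embedded circuit.
  have not_range : ∀ p : WrapQubit ι C L₁.length L₂.length, (∀ k, p ≠ f k) → ∀ b, cact gs₁ (base b) p = r₀ p := by
    intro p hp b
    rcases p with i | j | j
    · exact (r_inl b i).trans (r_inl _ i).symm
    · exact absurd rfl (hp (.inr (.inl j)))
    · obtain ⟨k, hk⟩ := anc_surj j
      rw [← hk]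
      rcases k with k | k | k | k
      · exact absurd hk.symm (hp (.inl k))
      · exact absurd hk.symm (hp (.inr (.inr k)))
      · exact (r_a₁ b k).trans (r_a₁ _ k).symm
      · exact (r_rest b k).trans (r_rest _ k).symm
  have eψ₁ : run (gs₁.map CGate.toGate) (D.initial fun k => inp k z) = fun x =>
      if (∀ p, (∀ k, p ≠ f k) → x p = r₀ p) then C.initial Fz fun k => x (f k) else 0 := by
    funext x
    obtain ⟨x, rfl⟩ := (cact_bijective gs₁).2 x
    rw [run_toGate_cact]
    unfold QCircuit.initial
    by_cases hx : ∃ b, x = base b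
    · obtain ⟨b, rfl⟩ := hx
      rw [if_pos ⟨fun i => rfl, fun j => rfl⟩, if_pos fun p hp => not_range p hp b,
        if_pos ⟨fun i => r_in b i, fun j => r_anc b j⟩]
      exact congrArg C.advice (funext fun j => (r_adv b j).symm)
    · rw [if_neg]
      · symm
        rw [ite_eq_right_iff]
        intro h
        rw [if_neg]
        rintro ⟨h', h''⟩
        refine hx ⟨fun j => cact gs₁ x (Sum.inr (Sum.inl j)), (cact_bijective gs₁).1 ?_⟩
        funext p
        by_cases hp : ∃ k, p = f k
        · obtain ⟨k, rfl⟩ := hp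
          rcases k with k | k | k
          · exact (h' k).trans (r_in _ k).symm
          · exact (r_adv (fun j => cact gs₁ x (Sum.inr (Sum.inl j))) k).symm
          · exact (h'' k).trans (r_anc _ k).symm
        · push Not at hp
          rw [h p hp, not_range p hp]
      · rintro ⟨h, h'⟩
        refine hx ⟨fun j => x (Sum.inr (Sum.inl j)), ?_⟩
        funext p
        rcases p with i | j | j
        · exact h i
        · rfl
        · exact h' j
  let ψ₂ := run (C.gates.map (Gate.map f)) (run (gs₁.map CGate.toGate) (D.initial fun k => inp k z))
  have eψ₂ : ∀ x, ψ₂ x = if (∀ p, (∀ k, p ≠ f k) → x p = r₀ p) then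
      C.final Fz fun k => x (f k) else 0 := by
    intro x
    simp only [ψ₂]
    rw [run_map_apply, eψ₁, QCircuit.final_eq_run]
    have e : slice f x (fun x => if (∀ p, (∀ k, p ≠ f k) → x p = r₀ p) then
        C.initial Fz fun k => x (f k) else 0) =
        if (∀ p, (∀ k, p ≠ f k) → x p = r₀ p) then C.initial Fz else 0 := by
      funext y
      simp only [slice, f.injective.extend_apply]
      have : (∀ p, (∀ k, p ≠ f k) → Function.extend f y x p = r₀ p) ↔
          ∀ p, (∀ k, p ≠ f k) → x p = r₀ p := by
        refine forall_congr' fun p => forall_congr' fun hp => ?_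
        rw [Function.extend_apply' _ _ _ (by rintro ⟨k, rfl⟩; exact hp k rfl)]
      simp only [this]
      split_ifs <;> rfl
    rw [e]
    split_ifs
    · rfl
    · rw [run_zero]; rfl
  have efinal : D.final (fun k => inp k z) = run (gs₂.map CGate.toGate) ψ₂ := by
    rw [QCircuit.final_eq_run]
    simp only [D, run_append]
    rfl
  have eprob : D.prob (fun k => inp k z) (fun _ => true) =
      ∑ x : WrapQubit ι C L₁.length L₂.length → Bool, if cact gs₂ x out = true then ‖ψ₂ x‖ ^ 2 else 0 := by
    unfold QCircuit.prob
    rw [Finset.sum_filter, efinal]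
    -- The final test only permutes basis states, so its garbage does not affect the distribution of
    -- the measured bit.
    rw [← (Equiv.ofBijective _ (cact_bijective gs₂)).sum_comp]
    refine Finset.sum_congr rfl fun x _ => ?_
    simp only [Equiv.ofBijective_apply, run_toGate_cact]
    refine if_congr ?_ rfl rfl
    exact ⟨fun h => h (), fun h _ => h⟩
  have ext_f : ∀ (y : C.Qubit → Bool) k, Function.extend f y r₀ (f k) = y k :=
    fun y k => f.injective.extend_apply _ _ _
  have ext_not : ∀ (y : C.Qubit → Bool) p, (∀ k, p ≠ f k) → Function.extend f y r₀ p = r₀ p :=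
    fun y p hp => Function.extend_apply' _ _ _ (by rintro ⟨k, rfl⟩; exact hp k rfl)
  have hout : ∀ y : C.Qubit → Bool,
      cact gs₂ (Function.extend f y r₀) out = T fun i => y (C.output i) := by
    intro y
    refine (h₂ (fun i => y (C.output i)) (Function.extend f y r₀) (fun k => ext_f y _)
      (fun j => ?_) fun _ => ?_).2.1 ()
    · exact (ext_not y _ fun k => (f_ne _ k).symm).trans (r_rest _ _)
    · exact (ext_not y _ fun k => (f_ne _ k).symm).trans (r_rest _ _)
  have esum : ∑ x : WrapQubit ι C L₁.length L₂.length → Bool, (if cact gs₂ x out = true then ‖ψ₂ x‖ ^ 2 else 0) =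
      ∑ y : C.Qubit → Bool, if T (fun i => y (C.output i)) = true then ‖C.final Fz y‖ ^ 2 else 0 := by
    symm
    refine Finset.sum_of_injOn (fun y => Function.extend f y r₀) ?_ (by simp) ?_ ?_
    · intro y _ y' _ h
      funext k
      have := congrFun h (f k)
      simpa only [ext_f] using this
    · intro x _ hx
      rw [eψ₂, if_neg (c := ∀ p, (∀ k, p ≠ f k) → x p = r₀ p)]
      · simp
      · intro h
        refine hx ⟨fun k => x (f k), by simp, ?_⟩
        funext p
        by_cases hp : ∃ k, p = f k
        · obtain ⟨k, rfl⟩ := hp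
          exact ext_f _ _
        · push Not at hp
          exact (ext_not _ p hp).trans (h p hp).symm
    · intro y _
      rw [hout, eψ₂, if_pos fun p hp => ext_not y p hp]
      simp only [ext_f]
  rw [eprob, esum]
  have hprob : ∀ y, C.prob Fz y = ∑ a : C.Qubit → Bool,
      if ∀ i, a (C.output i) = y i then ‖C.final Fz a‖ ^ 2 else 0 := by
    intro y
    unfold QCircuit.prob
    rw [Finset.sum_filter]
    exact Finset.sum_congr rfl fun a _ => by congr
  change _ = ∑ y, if T y = true then C.prob Fz y else 0
  simp only [hprob]
  have e2 : ∀ y : o' → Bool, (if T y = true then ∑ a : C.Qubit → Bool,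
        (if ∀ i, a (C.output i) = y i then ‖C.final Fz a‖ ^ 2 else 0) else 0) =
      ∑ a : C.Qubit → Bool, if T y = true then
        (if ∀ i, a (C.output i) = y i then ‖C.final Fz a‖ ^ 2 else 0) else 0 := by
    intro y
    split_ifs
    · rfl
    · simp
  refine Eq.trans ?_ (Finset.sum_congr rfl fun y _ => (e2 y).symm)
  rw [Finset.sum_comm]
  refine Finset.sum_congr rfl fun a _ => ?_
  rw [Finset.sum_eq_single fun i => a (C.output i)]
  · simp
  · intro y _ hy
    have : ¬ ∀ i, a (C.output i) = y i := fun h => hy (funext fun i => (h i).symm)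
    simp [this]
  · simp

end Wrap

/-! ### Further facts on expectations -/

section Expectation

lemma abs_ex_sub_ex_le_of_support {α : Type} [Fintype α] {p : α → ℝ} (hp : IsDensity p)
    {f g : α → ℝ} {c : ℝ} (h : ∀ a, p a ≠ 0 → |f a - g a| ≤ c) (hc : 0 ≤ c) :
    |ex p f - ex p g| ≤ c := by
  classical
  have e : ∀ f : α → ℝ, ex p f = ex p fun a => if p a = 0 then 0 else f a := by
    intro f
    refine Finset.sum_congr rfl fun a _ => ?_
    by_cases ha : p a = 0 <;> simp [ha]
  rw [e f, e g]
  refine abs_ex_sub_ex_le hp fun a => ?_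
  split_ifs with ha
  · simpa using hc
  · exact h a ha

/-- The product of two densities. -/
def prodD {α β : Type} (p : α → ℝ) (r : β → ℝ) (x : α × β) : ℝ := p x.1 * r x.2

section Prod

variable {α β : Type} [Fintype α] [Fintype β]

lemma ex_prodD (p : α → ℝ) (r : β → ℝ) (f : α × β → ℝ) :
    ex (prodD p r) f = ex p fun a => ex r fun b => f (a, b) := by
  simp only [ex, prodD, Fintype.sum_prod_type, Finset.mul_sum, mul_assoc]

lemma isDensity_prodD {p : α → ℝ} {r : β → ℝ} (hp : IsDensity p) (hr : IsDensity r) :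
    IsDensity (prodD p r) := by
  refine ⟨fun x => mul_nonneg (hp.1 _) (hr.1 _), ?_⟩
  have := ex_prodD p r fun _ => 1
  rw [ex_const hr, ex_const hp] at this
  simpa [ex] using this

end Prod

lemma push_eq_of_forall_ex {α β : Type} [Fintype α] [Fintype β] {p : α → ℝ} {h : α → β}
    {r : β → ℝ} (H : ∀ F : β → ℝ, ex p (fun a => F (h a)) = ex r F) : push p h = r := by
  classical
  funext b
  have h1 := H fun b' => if b' = b then 1 else 0
  have h2 := ex_push p h fun b' => if b' = b then 1 else 0
  have := h2.trans h1
  simpa [ex] using this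

/-- Resampling one coordinate of a product density. -/
lemma ex_piD_update {ι α : Type} [Fintype ι] [DecidableEq ι] [Fintype α] {w : α → ℝ}
    (hw : IsDensity w) (k : ι) (f : (ι → α) → ℝ) :
    ex (piD fun _ => w) f =
      ex (piD fun _ => w) fun x => ex w fun y => f (Function.update x k y) := by
  -- Exchanging coordinate `k` with the fresh sample is an involution that preserves the product
  -- weight.
  let e : (ι → α) × α ≃ (ι → α) × α :=
    Function.Involutive.toPerm (fun p => (Function.update p.1 k p.2, p.1 k)) fun p => by simp
  have h1 : (ex (piD fun _ => w) fun x => ex w fun y => f (Function.update x k y)) =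
      ∑ p : (ι → α) × α, (∏ j, w (p.1 j)) * w p.2 * f (Function.update p.1 k p.2) := by
    simp only [ex, piD, Fintype.sum_prod_type, Finset.mul_sum, mul_assoc]
  have h2 : ∑ p : (ι → α) × α, (∏ j, w (p.1 j)) * w p.2 * f (Function.update p.1 k p.2) =
      ∑ p : (ι → α) × α, (∏ j, w (p.1 j)) * w p.2 * f p.1 := by
    rw [← e.sum_comp]
    refine Finset.sum_congr rfl fun p _ => ?_
    have e1 : e p = (Function.update p.1 k p.2, p.1 k) := rfl
    rw [e1]
    simp only [Function.update_idem, Function.update_eq_self]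
    congr 1
    rw [← Finset.mul_prod_erase _ _ (Finset.mem_univ k),
      ← Finset.mul_prod_erase _ (fun j => w (p.1 j)) (Finset.mem_univ k), Function.update_self]
    have : ∏ j ∈ Finset.univ.erase k, w (Function.update p.1 k p.2 j) =
        ∏ j ∈ Finset.univ.erase k, w (p.1 j) :=
      Finset.prod_congr rfl fun j hj => by rw [Function.update_of_ne (Finset.ne_of_mem_erase hj)]
    rw [this]
    ring
  rw [h1, h2]
  simp only [Fintype.sum_prod_type, ex, piD]
  refine Finset.sum_congr rfl fun x _ => ?_
  rw [← Finset.sum_mul, ← Finset.mul_sum, hw.2, mul_one]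

end Expectation

/-! ### From few LWE samples to many -/

section Amplify

variable {q : ℕ} [Fact q.Prime] {ρ κ μ : Type} [Fintype ρ] [Fintype κ] [Fintype μ]
  [DecidableEq ρ] [DecidableEq κ] [DecidableEq μ]

/-- The product of a matrix and a vector. -/
def lin (B : μ → κ → ZMod q) (c : κ → ZMod q) (i : μ) : ZMod q := ∑ k, B i k * c k

/-- The combinations of the entries of `u` with the coefficients `R` in `{-1, 0, 1}`. -/
def hashVec (R : μ → ρ → Bool × Bool) (u : ρ → ZMod q) (i : μ) : ZMod q :=
  ∑ a, sgn q (R i a) * u a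

omit [Fintype μ] [DecidableEq ρ] [DecidableEq κ] [DecidableEq μ] in
lemma hashVec_lin (R : μ → ρ → Bool × Bool) (B : ρ → κ → ZMod q) (c : κ → ZMod q) :
    hashVec R (lin B c) = lin (fun i => hash B (R i)) c := by
  ext i
  simp only [hashVec, lin, hash, Finset.mul_sum, Finset.sum_mul]
  rw [Finset.sum_comm]
  simp only [mul_assoc]

omit [Fintype μ] [DecidableEq ρ] [DecidableEq μ] in
lemma hashVec_add (R : μ → ρ → Bool × Bool) (u v : ρ → ZMod q) :
    hashVec R (u + v) = hashVec R u + hashVec R v := by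
  ext i
  simp [hashVec, mul_add, Finset.sum_add_distrib]

lemma abs_valMinAbs_le {B : ℕ} {x : ZMod q} (h : truncGaussian q B x ≠ 0) :
    |(x.valMinAbs : ℝ)| ≤ B := by
  by_contra h'
  exact h (by unfold truncGaussian; rw [if_neg h'])

-- `flooding` needs shifts given by small integers, so the combined noise is lifted from `ℤ_q`
-- through the representatives of its terms.
omit [DecidableEq μ] [Fintype μ] [DecidableEq ρ] in
lemma hashVec_eq_cast {B : ℕ} (R : μ → ρ → Bool × Bool) (u : ρ → ZMod q)
    (hu : ∀ a, |((u a).valMinAbs : ℝ)| ≤ B) :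
    ∃ v : μ → ℤ, (∀ i, |(v i : ℝ)| ≤ Fintype.card ρ * B) ∧ hashVec R u = fun i => (v i : ZMod q) := by
  refine ⟨fun i => ∑ a, (((R i a).1.toNat : ℤ) - ((R i a).2.toNat : ℤ)) * (u a).valMinAbs,
    fun i => ?_, ?_⟩
  · push_cast
    refine (Finset.abs_sum_le_sum_abs _ _).trans
      ((Finset.sum_le_card_nsmul _ _ (B : ℝ) fun a _ => ?_).trans (by simp))
    rw [abs_mul]
    refine (mul_le_of_le_one_left (abs_nonneg _) ?_).trans (hu a)
    cases (R i a).1 <;> cases (R i a).2 <;> simp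
  · funext i
    push_cast
    simp [hashVec, sgn]

/-- The error in the leftover hash lemma for `k` columns and `r` rows. -/
noncomputable def hashErr (q k r : ℕ) : ℝ := Real.sqrt ((q : ℝ) ^ k * (3 / 8) ^ r)

/-- The error in the reduction from many samples to few samples. -/
noncomputable def ampErr (q l m r B_L B_M : ℕ) : ℝ :=
  m * hashErr q l r + m * (r * B_L * shiftErr B_M) + m * hashErr q (l + 1) r

lemma ex_unif_append (Φ : (ρ → κ → ZMod q) → (ρ → ZMod q) → ℝ) :
    ex (unif (ρ → κ ⊕ Unit → ZMod q)) (fun A => Φ (fun a k => A a (.inl k)) fun a => A a (.inr ())) =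
      ex (unif (ρ → κ → ZMod q)) fun B => ex (unif (ρ → ZMod q)) fun u => Φ B u := by
  rw [← ex_unif_prod fun p => Φ p.1 p.2]
  let e : (ρ → κ ⊕ Unit → ZMod q) ≃ (ρ → κ → ZMod q) × (ρ → ZMod q) :=
    { toFun := fun A => (fun a k => A a (.inl k), fun a => A a (.inr ()))
      invFun := fun p a => Sum.elim (p.1 a) fun _ => p.2 a
      left_inv := fun A => by ext a (k | k) <;> rfl
      right_inv := fun p => rfl }
  exact ex_unif_equiv e fun p => Φ p.1 p.2

/-- LWE with many samples and wide noise reduces to LWE with few samples and narrow noise. -/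
lemma amplify (hq : 2 < q) {B_L B_M : ℕ} (hL0 : 0 < B_L) (hM0 : 0 < B_M) (hL : 2 * B_L < q)
    (hM : 2 * B_M < q) {δ : ℝ} {g : (μ → κ → ZMod q) → (μ → ZMod q) → ℝ} (hg : ∀ B y, |g B y| ≤ 1)
    (hadv : ∀ (R : μ → ρ → Bool × Bool) (f : μ → ZMod q),
      |(ex (unif (ρ → κ → ZMod q)) fun B => ex (unif (κ → ZMod q)) fun c =>
          ex (piD fun _ => truncGaussian q B_L) fun e =>
            g (fun i => hash B (R i)) (hashVec R (lin B c + e) + f)) -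
        ex (unif (ρ → κ → ZMod q)) fun B => ex (unif (ρ → ZMod q)) fun u =>
          g (fun i => hash B (R i)) (hashVec R u + f)| ≤ δ) :
    |(ex (unif (μ → κ → ZMod q)) fun B => ex (unif (κ → ZMod q)) fun c =>
        ex (piD fun _ => truncGaussian q B_M) fun f => g B (lin B c + f)) -
      ex (unif (μ → κ → ZMod q)) fun B => ex (unif (μ → ZMod q)) fun y => g B y| ≤
      ampErr q (Fintype.card κ) (Fintype.card μ) (Fintype.card ρ) B_L B_M + δ := by
  have dM : IsDensity (piD fun _ : μ => truncGaussian q (B_M : ℝ)) :=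
    isDensity_piD fun _ => isDensity_truncGaussian hM0 hM
  have dL : IsDensity (piD fun _ : ρ => truncGaussian q (B_L : ℝ)) :=
    isDensity_piD fun _ => isDensity_truncGaussian hL0 hL
  set PM := piD fun _ : μ => truncGaussian q (B_M : ℝ)
  set PL := piD fun _ : ρ => truncGaussian q (B_L : ℝ)
  -- From `E₁` to `E₂` the uniform matrix becomes `R B`; in `E₃` the noise `R e` is slipped under
  -- `f`, so the samples become combinations of those in `B c + e`; in `E₄` these are replaced by
  -- uniform `u`; in `E₅` the pair `(R B, R u)` is again uniform.
  set E₁ := ex (unif (μ → κ → ZMod q)) fun B => ex (unif (κ → ZMod q)) fun c =>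
    ex PM fun f => g B (lin B c + f) with hE₁
  set E₂ := ex (unif (ρ → κ → ZMod q)) fun B => ex (unif (μ → ρ → Bool × Bool)) fun R =>
    ex (unif (κ → ZMod q)) fun c => ex PM fun f =>
      g (fun i => hash B (R i)) (lin (fun i => hash B (R i)) c + f) with hE₂
  set E₃ := ex (unif (ρ → κ → ZMod q)) fun B => ex (unif (μ → ρ → Bool × Bool)) fun R =>
    ex (unif (κ → ZMod q)) fun c => ex PL fun e => ex PM fun f =>
      g (fun i => hash B (R i)) (hashVec R (lin B c + e) + f) with hE₃
  set E₄ := ex (unif (ρ → κ → ZMod q)) fun B => ex (unif (μ → ρ → Bool × Bool)) fun R =>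
    ex (unif (ρ → ZMod q)) fun u => ex PM fun f =>
      g (fun i => hash B (R i)) (hashVec R u + f) with hE₄
  set E₅ := ex (unif (μ → κ → ZMod q)) fun B => ex (unif (μ → ZMod q)) fun u =>
    ex PM fun f => g B (u + f) with hE₅
  have h₁₂ : |E₂ - E₁| ≤ Fintype.card μ * hashErr q (Fintype.card κ) (Fintype.card ρ) := by
    have h := leftover_hash (ρ := ρ) (κ := κ) (ω := μ) hq (fun _ U => ex (unif (κ → ZMod q)) fun c =>
      ex PM fun f => g U (lin U c + f))
      (fun _ U => abs_ex_le isDensity_unif fun c => abs_ex_le dM fun f => hg _ _)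
    rw [ex_const isDensity_unif] at h
    exact h
  have h₂₃ : |E₃ - E₂| ≤ Fintype.card μ * (Fintype.card ρ * B_L * shiftErr B_M) := by
    refine abs_ex_sub_ex_le isDensity_unif fun B => abs_ex_sub_ex_le isDensity_unif fun R =>
      abs_ex_sub_ex_le isDensity_unif fun c => ?_
    rw [← ex_const dL (ex PM fun f =>
      g (fun i => hash B (R i)) (lin (fun i => hash B (R i)) c + f))]
    refine abs_ex_sub_ex_le_of_support dL (fun e he => ?_)
      (by have := shiftErr_nonneg B_M; positivity)
    obtain ⟨v, hv, hve⟩ := hashVec_eq_cast R e fun a => abs_valMinAbs_le fun h0 =>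
      he (Finset.prod_eq_zero (Finset.mem_univ a) h0)
    have h := flooding hM0 hM v hv
      (f := fun f => g (fun i => hash B (R i)) (lin (fun i => hash B (R i)) c + f))
      fun _ => hg _ _
    rw [hashVec_add, hashVec_lin, hve]
    refine le_trans (le_of_eq ?_) h
    congr 3
    funext f
    congr 1
    ext i
    simp only [Pi.add_apply]
    ring
  have h₃₄ : |E₃ - E₄| ≤ δ := by
    have e₃ : E₃ = ex (unif (μ → ρ → Bool × Bool)) fun R => ex PM fun f =>
        ex (unif (ρ → κ → ZMod q)) fun B => ex (unif (κ → ZMod q)) fun c => ex PL fun e =>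
        g (fun i => hash B (R i)) (hashVec R (lin B c + e) + f) := by
      rw [hE₃, ex_comm]
      simp only [ex_comm PM]
    have e₄ : E₄ = ex (unif (μ → ρ → Bool × Bool)) fun R => ex PM fun f =>
        ex (unif (ρ → κ → ZMod q)) fun B => ex (unif (ρ → ZMod q)) fun u =>
        g (fun i => hash B (R i)) (hashVec R u + f) := by
      rw [hE₄, ex_comm]
      simp only [ex_comm PM]
    rw [e₃, e₄]
    exact abs_ex_sub_ex_le isDensity_unif fun R => abs_ex_sub_ex_le dM fun f => hadv R f
  have h₄₅ : |E₄ - E₅| ≤ Fintype.card μ * hashErr q (Fintype.card κ + 1) (Fintype.card ρ) := by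
    -- The vector `u` is treated as one more column of `B`, so that matrix and right-hand side are
    -- hashed jointly.
    have h := leftover_hash (ρ := ρ) (κ := κ ⊕ Unit) (ω := μ) hq
      (fun _ U => ex PM fun f => g (fun i k => U i (.inl k)) ((fun i => U i (.inr ())) + f))
      (fun _ U => abs_ex_le dM fun f => hg _ _)
    rw [ex_const isDensity_unif, ex_unif_append fun B u => ex PM fun f => g B (u + f),
      Fintype.card_sum, Fintype.card_unit] at h
    have e₄ := ex_unif_append (ρ := ρ) (κ := κ) (q := q) fun B u =>
      ex (unif (μ → ρ → Bool × Bool)) fun R => ex PM fun f =>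
        g (fun i => hash B (R i)) (hashVec R u + f)
    have e₄' : E₄ = ex (unif (ρ → κ → ZMod q)) fun B => ex (unif (ρ → ZMod q)) fun u =>
      ex (unif (μ → ρ → Bool × Bool)) fun R => ex PM fun f =>
        g (fun i => hash B (R i)) (hashVec R u + f) := by
      rw [hE₄]
      congr 1
      funext B
      rw [ex_comm]
    rw [e₄', ← e₄]
    exact h
  have h₅ : E₅ = ex (unif (μ → κ → ZMod q)) fun B => ex (unif (μ → ZMod q)) fun y => g B y := by
    rw [hE₅]
    congr 1
    funext B
    rw [ex_comm]
    have : ∀ f : μ → ZMod q, ex (unif (μ → ZMod q)) (fun u => g B (u + f)) =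
        ex (unif (μ → ZMod q)) fun y => g B y := fun f => ex_unif_equiv (Equiv.addRight f) (g B)
    simp only [this, ex_const dM]
  rw [← h₅]
  unfold ampErr
  rw [abs_le] at *
  constructor <;> linarith

end Amplify

/-! ### The lossy mode -/

section Lossy

variable {q : ℕ} [Fact q.Prime] {l m n r : ℕ}

/-- The randomness for one column: a secret, a noise vector and a uniform vector. -/
abbrev Seed (q l m : ℕ) : Type := (Fin l → ZMod q) × (Fin m → ZMod q) × (Fin m → ZMod q)

/-- The density of the randomness for one column. -/
noncomputable def seedD (q l m : ℕ) [Fact q.Prime] (B_M : ℕ) : Seed q l m → ℝ :=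
  prodD (unif _) (prodD (piD fun _ => truncGaussian q B_M) (unif _))

lemma isDensity_seedD {B_M : ℕ} (hM0 : 0 < B_M) (hM : 2 * B_M < q) :
    IsDensity (seedD q l m B_M) :=
  isDensity_prodD isDensity_unif (isDensity_prodD
    (isDensity_piD fun _ => isDensity_truncGaussian hM0 hM) isDensity_unif)

/-- The matrix whose first `k` columns are LWE samples and whose other columns are uniform. -/
def hybrid (k : ℕ) (B : Fin m → Fin l → ZMod q) (x : Fin n → Seed q l m) :
    Matrix (Fin m) (Fin n) (ZMod q) :=
  Matrix.of fun i j => if j.val < k then lin B (x j).1 i + (x j).2.1 i else (x j).2.2 i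

/-- A hybrid matrix with column `k` replaced by `y`. -/
def hybridWith (k : Fin n) (B : Fin m → Fin l → ZMod q) (x : Fin n → Seed q l m)
    (y : Fin m → ZMod q) : Matrix (Fin m) (Fin n) (ZMod q) :=
  Matrix.of fun i j => if j = k then y i else
    if j.val < k.val then lin B (x j).1 i + (x j).2.1 i else (x j).2.2 i

/-- Each seed holds the randomness for both kinds of column, so hybrids `k` and `k + 1` live on the
same probability space and differ in column `k` only. -/
lemma hybrid_update (k : Fin n) (B : Fin m → Fin l → ZMod q) (x : Fin n → Seed q l m)
    (y : Seed q l m) : hybrid k.val B (Function.update x k y) = hybridWith k B x y.2.2 := by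
  ext i j
  by_cases h : j = k
  · subst h; simp [hybrid, hybridWith]
  · simp [hybrid, hybridWith, h]

lemma hybrid_succ_update (k : Fin n) (B : Fin m → Fin l → ZMod q) (x : Fin n → Seed q l m)
    (y : Seed q l m) :
    hybrid (k.val + 1) B (Function.update x k y) = hybridWith k B x (lin B y.1 + y.2.1) := by
  ext i j
  by_cases h : j = k
  · subst h; simp [hybrid, hybridWith]
  · have h' : j.val < k.val + 1 ↔ j.val < k.val := by
      have : j.val ≠ k.val := fun e => h (Fin.ext e)
      omega
    simp only [hybrid, hybridWith, Matrix.of_apply, Function.update_of_ne h, h, if_false, h']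

/-- The expectation of `f` over hybrid matrices. -/
noncomputable def hybEx (B_M k : ℕ) (l : ℕ) (f : Matrix (Fin m) (Fin n) (ZMod q) → ℝ) : ℝ :=
  ex (unif (Fin m → Fin l → ZMod q)) fun B => ex (piD fun _ => seedD q l m B_M) fun x =>
    f (hybrid k B x)

lemma hybEx_zero {B_M : ℕ} (hM0 : 0 < B_M) (hM : 2 * B_M < q)
    (f : Matrix (Fin m) (Fin n) (ZMod q) → ℝ) : hybEx B_M 0 l f = ex (unif _) f := by
  have dM := isDensity_piD fun _ : Fin m => isDensity_truncGaussian (q := q) hM0 hM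
  have h2 : push (seedD q l m B_M) (fun y => y.2.2) = unif (Fin m → ZMod q) :=
    push_eq_of_forall_ex fun F => by
      simp only [seedD, ex_prodD, ex_const isDensity_unif, ex_const dM]
  unfold hybEx
  have h3 : ∀ B : Fin m → Fin l → ZMod q, (ex (piD fun _ => seedD q l m B_M) fun x =>
      f (hybrid 0 B x)) = ex (unif (Matrix (Fin m) (Fin n) (ZMod q))) f := by
    intro B
    have e : ∀ x : Fin n → Seed q l m, hybrid 0 B x = Matrix.of fun i j => (x j).2.2 i := by
      intro x; ext i j; simp [hybrid]
    simp only [e]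
    have h4 := ex_push (piD fun _ : Fin n => seedD q l m B_M) (fun x j => (x j).2.2)
      fun c : Fin n → Fin m → ZMod q => f (Matrix.of fun i j => c j i)
    rw [← h4, push_piD (fun _ : Fin n => seedD q l m B_M) (fun _ (y : Seed q l m) => y.2.2)]
    simp only [h2, piD_unif]
    exact ex_unif_equiv ((Equiv.piComm fun _ _ => ZMod q).trans Matrix.of) f
  simp only [h3, ex_const isDensity_unif]

/-- The hybrid argument over the columns. -/
lemma abs_ex_sub_hybEx_le (hq : 2 < q) {B_L B_M : ℕ} (hL0 : 0 < B_L) (hM0 : 0 < B_M)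
    (hL : 2 * B_L < q) (hM : 2 * B_M < q) {δ : ℝ} {f : Matrix (Fin m) (Fin n) (ZMod q) → ℝ}
    (hf : ∀ A, |f A| ≤ 1)
    (hadv : ∀ (R : Fin m → Fin r → Bool × Bool) (f' : Fin m → ZMod q) (k : Fin n)
      (x : Fin n → Seed q l m),
      |(ex (unif (Fin r → Fin l → ZMod q)) fun B => ex (unif (Fin l → ZMod q)) fun c =>
          ex (piD fun _ => truncGaussian q B_L) fun e =>
            f (hybridWith k (fun i => hash B (R i)) x (hashVec R (lin B c + e) + f'))) -
        ex (unif (Fin r → Fin l → ZMod q)) fun B => ex (unif (Fin r → ZMod q)) fun u =>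
          f (hybridWith k (fun i => hash B (R i)) x (hashVec R u + f'))| ≤ δ) :
    |ex (unif _) f - hybEx B_M n l f| ≤ n * (ampErr q l m r B_L B_M + δ) := by
  have dS := isDensity_seedD (l := l) (m := m) hM0 hM
  have dM := isDensity_piD fun _ : Fin m => isDensity_truncGaussian (q := q) hM0 hM
  have step : ∀ k : Fin n, |hybEx B_M (k.val + 1) l f - hybEx B_M k.val l f| ≤
      ampErr q l m r B_L B_M + δ := by
    intro k
    unfold hybEx
    rw [ex_comm, ex_comm (unif (Fin m → Fin l → ZMod q)), ex_piD_update dS k,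
      ex_piD_update dS k (fun x => ex (unif (Fin m → Fin l → ZMod q)) fun B => f (hybrid k.val B x))]
    refine abs_ex_sub_ex_le (isDensity_piD fun _ => dS) fun x => ?_
    simp only [hybrid_update, hybrid_succ_update]
    rw [ex_comm, ex_comm (seedD q l m B_M)]
    simp only [seedD, ex_prodD, ex_const isDensity_unif, ex_const dM]
    have h := amplify hq hL0 hM0 hL hM (g := fun B y => f (hybridWith k B x y))
      (fun _ _ => hf _) (fun R f' => hadv R f' k x)
    simpa only [Fintype.card_fin] using h
  have tele : ∀ k ≤ n, |ex (unif _) f - hybEx B_M k l f| ≤ k * (ampErr q l m r B_L B_M + δ) := by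
    intro k
    induction k with
    | zero => intro _; rw [hybEx_zero hM0 hM]; simp
    | succ k ih =>
      intro hk
      have h1 := ih (by omega)
      have h2 := step ⟨k, by omega⟩
      rw [abs_sub_comm] at h2
      refine (abs_sub_le _ (hybEx B_M k l f) _).trans ?_
      push_cast
      linarith
  exact tele n le_rfl

end Lossy

/-! ### The reduction to LWE -/

section Affine

variable {q : ℕ} {κ : Type} [Fintype κ]

/-- Affine functions of a vector over `ℤ_q`. -/
def IsAffine (φ : (κ → ZMod q) → ZMod q) : Prop :=
  ∃ (a : κ → ZMod q) (b : ZMod q), ∀ x, φ x = ∑ i, a i * x i + b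

lemma IsAffine.const (c : ZMod q) : IsAffine fun _ : κ → ZMod q => c :=
  ⟨0, c, fun x => by simp⟩

lemma IsAffine.coord (k : κ) : IsAffine fun x : κ → ZMod q => x k := by
  classical
  exact ⟨Pi.single k 1, 0, fun x => by simp [Pi.single_apply]⟩

lemma IsAffine.add {φ ψ : (κ → ZMod q) → ZMod q} (hφ : IsAffine φ) (hψ : IsAffine ψ) :
    IsAffine fun x => φ x + ψ x := by
  obtain ⟨a, b, h⟩ := hφ
  obtain ⟨a', b', h'⟩ := hψ
  refine ⟨a + a', b + b', fun x => ?_⟩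
  simp only [h, h', Pi.add_apply, add_mul, Finset.sum_add_distrib]
  ring

lemma IsAffine.const_mul (c : ZMod q) {φ : (κ → ZMod q) → ZMod q} (hφ : IsAffine φ) :
    IsAffine fun x => c * φ x := by
  obtain ⟨a, b, h⟩ := hφ
  refine ⟨fun i => c * a i, c * b, fun x => ?_⟩
  simp only [h, mul_add, Finset.mul_sum, mul_assoc]

lemma IsAffine.mul_const (c : ZMod q) {φ : (κ → ZMod q) → ZMod q} (hφ : IsAffine φ) :
    IsAffine fun x => φ x * c := by
  simpa only [mul_comm] using hφ.const_mul c

lemma IsAffine.sum {τ : Type} (S : Finset τ) {φ : τ → (κ → ZMod q) → ZMod q}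
    (h : ∀ t, IsAffine (φ t)) : IsAffine fun x => ∑ t ∈ S, φ t x := by
  classical
  induction S using Finset.induction_on with
  | empty => simpa using IsAffine.const 0
  | insert t S ht ih => simpa only [Finset.sum_insert ht] using (h t).add ih

end Affine

section Reduction

variable {q : ℕ} [Fact q.Prime] {l m n r : ℕ}

open Classical in
/-- The probability that the output of `𝒜` on `(A, u)` is in `H_s` or in its complement. -/
noncomputable def acc (𝒜 : QCircuit (SampleBit m n q) (TupleBit n q)) (h : Bool)
    (s : Fin n → Bool) (A : Matrix (Fin m) (Fin n) (ZMod q)) (u : Fin m → ZMod q) : ℝ :=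
  ∑ t : Tuple n q with t ∈ Hset q h s, 𝒜.prob (encodeSample A u) (encodeTuple t)

variable (𝒜 : QCircuit (SampleBit m n q) (TupleBit n q))

lemma sum_prob_encodeTuple_le (z : SampleBit m n q → Bool) :
    ∑ t, 𝒜.prob z (encodeTuple t) ≤ 1 := by
  classical
  rw [← 𝒜.sum_prob z, ← Finset.sum_image (f := fun y => 𝒜.prob z y)
    fun a _ b _ h => encodeTuple_injective h]
  exact Finset.sum_le_sum_of_subset_of_nonneg (Finset.subset_univ _)
    fun _ _ _ => 𝒜.prob_nonneg _ _

lemma abs_acc_le (h : Bool) (s : Fin n → Bool) (A : Matrix (Fin m) (Fin n) (ZMod q))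
    (u : Fin m → ZMod q) : |acc 𝒜 h s A u| ≤ 1 := by
  classical
  unfold acc
  rw [abs_of_nonneg (Finset.sum_nonneg fun _ _ => 𝒜.prob_nonneg _ _)]
  refine le_trans ?_ (sum_prob_encodeTuple_le 𝒜 (encodeSample A u))
  exact Finset.sum_le_sum_of_subset_of_nonneg (Finset.filter_subset _ _)
    fun _ _ _ => 𝒜.prob_nonneg _ _

lemma acc_sub_acc (s : Fin n → Bool) (A : Matrix (Fin m) (Fin n) (ZMod q)) (u : Fin m → ZMod q) :
    acc 𝒜 false s A u - acc 𝒜 true s A u =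
      ∑ t, 𝒜.prob (encodeSample A u) (encodeTuple t) * signedH q s t := by
  classical
  unfold acc
  rw [Finset.sum_filter, Finset.sum_filter, ← Finset.sum_sub_distrib, Hset_false, Hset_true]
  refine Finset.sum_congr rfl fun t _ => ?_
  unfold signedH
  split_ifs <;> ring

lemma keyProb_eq (gen : Matrix (Fin m) (Fin n) (ZMod q) → ℝ) (χ : ZMod q → ℝ) (h : Bool) :
    keyProb gen χ 𝒜 (Hset q h) = ex gen fun A => ex (unif _) fun s => ex (piD fun _ => χ) fun e =>
      acc 𝒜 h s A (A.mulVec (vec q s) + e) := by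
  simp only [keyProb, ex, acc, piD, Finset.mul_sum, mul_assoc]

lemma lweAdvantage_eq (χ : ZMod q → ℝ) (D : QCircuit (SampleBit r l q) Unit) :
    lweAdvantage l r q χ D =
      |(ex (unif (Fin r → Fin l → ZMod q)) fun B => ex (unif (Fin l → ZMod q)) fun c =>
          ex (piD fun _ => χ) fun e => D.prob (encodeSample B (lin B c + e)) fun _ => true) -
        ex (unif (Fin r → Fin l → ZMod q)) fun B => ex (unif (Fin r → ZMod q)) fun u =>
          D.prob (encodeSample B u) fun _ => true| := by
  simp only [lweAdvantage, ex, piD, Finset.mul_sum, mul_assoc]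
  rfl

/-- The overhead of the reduction. -/
def redCost (r l m n q : ℕ) : ℕ :=
  2 * ((m * n + m) * bitLen q) + 3 * affineMapCost q (r * l + r) (m * n + m) +
    3 * testCost n q + 2

/-- The circuit that applies an affine map to its input, runs `𝒜` and tests its output. -/
lemma exists_reduction (h : Bool) (s : Fin n → Bool)
    {A : ((Fin r × Fin l) ⊕ Fin r → ZMod q) → Matrix (Fin m) (Fin n) (ZMod q)}
    {U : ((Fin r × Fin l) ⊕ Fin r → ZMod q) → Fin m → ZMod q}
    (hA : ∀ i j, IsAffine fun x => A x i j) (hU : ∀ i, IsAffine fun x => U x i) :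
    ∃ D : QCircuit (SampleBit r l q) Unit, D.size ≤ 𝒜.size + redCost r l m n q ∧
      ∀ (B : Fin r → Fin l → ZMod q) u, D.prob (encodeSample B u) (fun _ => true) =
        acc 𝒜 h s (A (Sum.elim (fun p => B p.1 p.2) u)) (U (Sum.elim (fun p => B p.1 p.2) u)) := by
  classical
  choose a b hab using hA
  choose a' b' hab' using hU
  have hF := gen_affine_map (q := q)
    (fun o : (Fin m × Fin n) ⊕ Fin m => Sum.elim (fun p => a p.1 p.2) a' o)
    (fun o => Sum.elim (fun p => b p.1 p.2) b' o)
  have hT := gen_test (q := q) (Fact.out : q.Prime).two_le h s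
  obtain ⟨D, hD, hprob⟩ := exists_wrapped_circuit 𝒜 hF hT
  refine ⟨D, hD.trans (le_of_eq ?_), fun B u => ?_⟩
  · simp only [redCost, Fintype.card_prod, Fintype.card_sum, Fintype.card_fin]
  · set x : (Fin r × Fin l) ⊕ Fin r → ZMod q := Sum.elim (fun p => B p.1 p.2) u with hx
    have hp := hprob x
    have e1 : (fun k : SampleBit r l q => bits (x k.1) k.2) = encodeSample B u := rfl
    have e2 : (fun k : SampleBit m n q => bits (∑ i, Sum.elim (fun p => a p.1 p.2) a' k.1 i * x i +
        Sum.elim (fun p => b p.1 p.2) b' k.1) k.2) = encodeSample (A x) (U x) := by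
      funext ⟨o, j⟩
      rcases o with ⟨i, i'⟩ | i
      · simp [encodeSample, hab]
      · simp [encodeSample, hab']
    rw [e1, e2] at hp
    rw [hp, acc]
    simp only [decide_eq_true_eq]
    rw [← Finset.sum_filter, ← Finset.sum_image (f := fun y => 𝒜.prob (encodeSample (A x) (U x)) y)
      fun a _ b _ h => encodeTuple_injective h]
    refine Finset.sum_congr ?_ fun _ _ => rfl
    ext y
    simp only [Finset.mem_filter, Finset.mem_univ, true_and, Finset.mem_image]
    exact ⟨fun ⟨t, ht, e⟩ => ⟨t, ht, e.symm⟩, fun ⟨t, ht, e⟩ => ⟨t, ht, e.symm⟩⟩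

/-- The coefficients `R`, the other secrets and all fresh noise are constants here, so the LWE
sample enters only linearly. -/
lemma isAffine_hybridWith (R : Fin m → Fin r → Bool × Bool) (f' : Fin m → ZMod q) (k : Fin n)
    (y : Fin n → Seed q l m) (i : Fin m) (j : Fin n) :
    IsAffine fun x : (Fin r × Fin l) ⊕ Fin r → ZMod q =>
      hybridWith k (fun i => hash (fun a b => x (.inl (a, b))) (R i)) y
        (hashVec R (fun a => x (.inr a)) + f') i j := by
  simp only [hybridWith, Matrix.of_apply]
  split_ifs with h1 h2
  · exact (IsAffine.sum _ fun a => (IsAffine.coord _).const_mul _).add (IsAffine.const _)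
  · exact (IsAffine.sum _ fun c => (IsAffine.sum _ fun a =>
      (IsAffine.coord _).const_mul _).mul_const _).add (IsAffine.const _)
  · exact IsAffine.const _

/-- With `s` and `e₀` hard-wired, `A s + e₀` is again affine in the LWE sample and membership of the
answer in `H_s` is decidable by the circuit. -/
lemma exists_reduction_hybridWith (h : Bool) (s : Fin n → Bool) (e₀ : Fin m → ZMod q)
    (R : Fin m → Fin r → Bool × Bool) (f' : Fin m → ZMod q) (k : Fin n) (x : Fin n → Seed q l m) :
    ∃ D : QCircuit (SampleBit r l q) Unit, D.size ≤ 𝒜.size + redCost r l m n q ∧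
      ∀ (B : Fin r → Fin l → ZMod q) u, D.prob (encodeSample B u) (fun _ => true) =
        (fun A => acc 𝒜 h s A (A.mulVec (vec q s) + e₀))
          (hybridWith k (fun i => hash B (R i)) x (hashVec R u + f')) := by
  have hA := isAffine_hybridWith (q := q) (l := l) R f' k x
  let A (x' : (Fin r × Fin l) ⊕ Fin r → ZMod q) : Matrix (Fin m) (Fin n) (ZMod q) :=
    hybridWith k (fun i => hash (fun a b => x' (.inl (a, b))) (R i)) x
      (hashVec R (fun a => x' (.inr a)) + f')
  have hU : ∀ i, IsAffine fun x' => ∑ j, A x' i j * vec q s j + e₀ i := fun i =>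
    (IsAffine.sum _ fun j => (hA i j).mul_const _).add (IsAffine.const _)
  exact exists_reduction 𝒜 h s (A := A) (U := fun x' => (A x').mulVec (vec q s) + e₀) hA hU

/-- A circuit that distinguishes LWE samples as well as any column of the hybrid argument does. -/
lemma exists_distinguisher (hn : 0 < n) (l r : ℕ) (χ : ZMod q → ℝ) :
    ∃ D : QCircuit (SampleBit r l q) Unit, D.size ≤ 𝒜.size + redCost r l m n q ∧
      ∀ (h : Bool) (s : Fin n → Bool) (e₀ : Fin m → ZMod q) (R : Fin m → Fin r → Bool × Bool)
        (f' : Fin m → ZMod q) (k : Fin n) (x : Fin n → Seed q l m),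
      |(ex (unif (Fin r → Fin l → ZMod q)) fun B => ex (unif (Fin l → ZMod q)) fun c =>
          ex (piD fun _ => χ) fun e => (fun A => acc 𝒜 h s A (A.mulVec (vec q s) + e₀))
            (hybridWith k (fun i => hash B (R i)) x (hashVec R (lin B c + e) + f'))) -
        ex (unif (Fin r → Fin l → ZMod q)) fun B => ex (unif (Fin r → ZMod q)) fun u =>
          (fun A => acc 𝒜 h s A (A.mulVec (vec q s) + e₀))
            (hybridWith k (fun i => hash B (R i)) x (hashVec R u + f'))| ≤
      lweAdvantage l r q χ D := by
  have key : ∀ p : Bool × (Fin n → Bool) × (Fin m → ZMod q) × (Fin m → Fin r → Bool × Bool) ×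
      (Fin m → ZMod q) × Fin n × (Fin n → Seed q l m),
      ∃ D : QCircuit (SampleBit r l q) Unit, D.size ≤ 𝒜.size + redCost r l m n q ∧
        ∀ (B : Fin r → Fin l → ZMod q) u, D.prob (encodeSample B u) (fun _ => true) =
          (fun A => acc 𝒜 p.1 p.2.1 A (A.mulVec (vec q p.2.1) + p.2.2.1))
            (hybridWith p.2.2.2.2.2.1 (fun i => hash B (p.2.2.2.1 i)) p.2.2.2.2.2.2
              (hashVec p.2.2.2.1 u + p.2.2.2.2.1)) := by
    rintro ⟨h, s, e₀, R, f', k, x⟩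
    exact exists_reduction_hybridWith 𝒜 h s e₀ R f' k x
  choose D hD hprob using key
  have : Nonempty (Fin n) := ⟨⟨0, hn⟩⟩
  -- Non-uniformity: there are finitely many choices of the hard-wired data, and the one with the
  -- largest advantage dominates all the others, so no randomness has to be sampled by the circuit.
  obtain ⟨p₀, hp₀⟩ := Finite.exists_max fun p => lweAdvantage l r q χ (D p)
  refine ⟨D p₀, hD p₀, fun h s e₀ R f' k x => ?_⟩
  refine le_trans (le_of_eq ?_) (hp₀ (h, s, e₀, R, f', k, x))
  rw [lweAdvantage_eq]
  simp only [hprob]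

end Reduction

/-! ### The lossy mode against an arbitrary adversary, and the total error for fixed parameters. -/

section Bound

variable {q : ℕ} [Fact q.Prime] {l m n r : ℕ} (𝒜 : QCircuit (SampleBit m n q) (TupleBit n q))

/-- The matrix of secrets of a lossy matrix. -/
def secrets (x : Fin n → Seed q l m) : Matrix (Fin l) (Fin n) (ZMod q) :=
  Matrix.of fun i j => (x j).1 i

lemma ex_secrets {B_M : ℕ} (hM0 : 0 < B_M) (hM : 2 * B_M < q)
    (f : Matrix (Fin l) (Fin n) (ZMod q) → ℝ) :
    (ex (piD fun _ => seedD q l m B_M) fun x => f (secrets x)) = ex (unif _) f := by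
  have dM := isDensity_piD fun _ : Fin m => isDensity_truncGaussian (q := q) hM0 hM
  have h2 : push (seedD q l m B_M) (fun y => y.1) = unif (Fin l → ZMod q) :=
    push_eq_of_forall_ex fun F => by
      simp only [seedD, ex_prodD, ex_const isDensity_unif, ex_const dM]
  have h4 := ex_push (piD fun _ : Fin n => seedD q l m B_M) (fun x j => (x j).1)
    fun c : Fin n → Fin l → ZMod q => f (Matrix.of fun i j => c j i)
  refine h4.symm.trans ?_
  rw [push_piD (fun _ : Fin n => seedD q l m B_M) (fun _ (y : Seed q l m) => y.1)]
  simp only [h2, piD_unif]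
  exact ex_unif_equiv ((Equiv.piComm fun _ _ => ZMod q).trans Matrix.of) f

/-- In the lossy mode the noise vectors of the matrix are absorbed by the noise. -/
lemma abs_ex_acc_lossy_le {B_M B_V : ℕ} (hV0 : 0 < B_V) (hV : 2 * B_V < q) (h : Bool)
    (s : Fin n → Bool) (B : Fin m → Fin l → ZMod q) (x : Fin n → Seed q l m)
    (hx : ∀ j i, |(((x j).2.1 i).valMinAbs : ℝ)| ≤ B_M) :
    |(ex (piD fun _ => truncGaussian q B_V) fun e =>
        acc 𝒜 h s (hybrid n B x) ((hybrid n B x).mulVec (vec q s) + e)) -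
      ex (piD fun _ => truncGaussian q B_V) fun e =>
        acc 𝒜 h s (hybrid n B x) (lin B ((secrets x).mulVec (vec q s)) + e)| ≤
      m * (n * B_M * shiftErr B_V) := by
  -- The shift is `E s`: each entry adds at most `n` noise terms of size at most `B_M`.
  have hf := flooding (ι := Fin m) hV0 hV
    (fun i => ∑ j, if s j then ((x j).2.1 i).valMinAbs else 0) (K := n * B_M) (fun i => by
      push_cast
      refine (Finset.abs_sum_le_sum_abs _ _).trans
        ((Finset.sum_le_card_nsmul _ _ (B_M : ℝ) fun j _ => ?_).trans (by simp))
      split_ifs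
      · exact hx j i
      · simp)
    (f := fun e => acc 𝒜 h s (hybrid n B x) (lin B ((secrets x).mulVec (vec q s)) + e))
    fun _ => abs_acc_le 𝒜 _ _ _ _
  rw [Fintype.card_fin] at hf
  refine le_trans (le_of_eq ?_) hf
  congr 3
  funext e
  congr 1
  ext i
  have e1 : (hybrid n B x).mulVec (vec q s) i =
      lin B ((secrets x).mulVec (vec q s)) i + ∑ j, (x j).2.1 i * vec q s j := by
    simp only [Matrix.mulVec, dotProduct, hybrid, Matrix.of_apply, Fin.is_lt, if_true, lin,
      secrets, add_mul, Finset.sum_add_distrib, Finset.mul_sum, Finset.sum_mul]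
    rw [Finset.sum_comm]
    simp only [mul_assoc]
  simp only [Pi.add_apply, e1]
  have e2 : ((∑ j, if s j = true then ((x j).2.1 i).valMinAbs else 0 : ℤ) : ZMod q) =
      ∑ j, (x j).2.1 i * vec q s j := by
    push_cast
    refine Finset.sum_congr rfl fun j _ => ?_
    unfold vec
    split_ifs <;> simp
  rw [e2]
  ring

/-- The advantage of any circuit in the lossy mode. -/
lemma abs_ex_lossy_sub_le (hq : 2 < q) {B_M B_V : ℕ} (hM0 : 0 < B_M) (hM : 2 * B_M < q)
    (hV0 : 0 < B_V) (hV : 2 * B_V < q) :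
    |(ex (unif (Fin m → Fin l → ZMod q)) fun B => ex (piD fun _ => seedD q l m B_M) fun x =>
        ex (unif (Fin n → Bool)) fun s => ex (piD fun _ => truncGaussian q B_V) fun e =>
          acc 𝒜 false s (hybrid n B x) (lin B ((secrets x).mulVec (vec q s)) + e)) -
      (ex (unif (Fin m → Fin l → ZMod q)) fun B => ex (piD fun _ => seedD q l m B_M) fun x =>
        ex (unif (Fin n → Bool)) fun s => ex (piD fun _ => truncGaussian q B_V) fun e =>
          acc 𝒜 true s (hybrid n B x) (lin B ((secrets x).mulVec (vec q s)) + e))| ≤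
      (q : ℝ) ^ l * (2 * (0.924 : ℝ) ^ (n / 2)) := by
  have dV := isDensity_piD fun _ : Fin m => isDensity_truncGaussian (q := q) hV0 hV
  have dS := isDensity_piD fun _ : Fin n => isDensity_seedD (q := q) (l := l) (m := m) hM0 hM
  have hpt : ∀ (B : Fin m → Fin l → ZMod q) (x : Fin n → Seed q l m),
      |ex (unif (Fin n → Bool)) fun s => ex (piD fun _ => truncGaussian q B_V) fun e =>
        acc 𝒜 false s (hybrid n B x) (lin B ((secrets x).mulVec (vec q s)) + e) -
          acc 𝒜 true s (hybrid n B x) (lin B ((secrets x).mulVec (vec q s)) + e)| ≤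
        (q : ℝ) ^ l * totalLeak (secrets x) := by
    intro B x
    -- For fixed `B` and `x` the matrix is fixed, and the right-hand side depends on `s` only
    -- through `v = C s`.
    refine le_trans (le_of_eq ?_) (abs_ex_sum_signedH_le (secrets x)
      (P := fun v t => ex (piD fun _ => truncGaussian q B_V) fun e =>
        𝒜.prob (encodeSample (hybrid n B x) (lin B v + e)) (encodeTuple t))
      (fun v t => ex_nonneg dV fun e => 𝒜.prob_nonneg _ _) fun v => ?_)
    · congr 2
      funext s
      simp only [acc_sub_acc, ex, Finset.mul_sum, Finset.sum_mul, mul_assoc]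
      rw [Finset.sum_comm]
    · have : ∑ t : Tuple n q, (ex (piD fun _ => truncGaussian q B_V) fun e =>
          𝒜.prob (encodeSample (hybrid n B x) (lin B v + e)) (encodeTuple t)) =
          ex (piD fun _ => truncGaussian q B_V) fun e => ∑ t : Tuple n q,
            𝒜.prob (encodeSample (hybrid n B x) (lin B v + e)) (encodeTuple t) := by
        simp only [ex, Finset.mul_sum]
        rw [Finset.sum_comm]
      rw [this]
      exact ex_le dV fun e => sum_prob_encodeTuple_le 𝒜 _
  simp only [← ex_sub]
  refine (abs_ex_le_ex_abs isDensity_unif _).trans ?_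
  refine ex_le isDensity_unif fun B => ?_
  refine (abs_ex_le_ex_abs dS _).trans ?_
  refine (ex_mono dS fun x => hpt B x).trans ?_
  rw [ex_const_mul, ex_secrets hM0 hM]
  exact mul_le_mul_of_nonneg_left (ex_totalLeak_le hq) (by positivity)

/-- The bound on the advantage for fixed parameters. -/
theorem exists_distinguisher_abs_keyProb_sub_le (hn : 0 < n) (l r B_L : ℕ) :
    ∃ D : QCircuit (SampleBit r l q) Unit, D.size ≤ 𝒜.size + redCost r l m n q ∧
      ∀ B_M B_V : ℕ, 2 < q → 0 < B_L → 0 < B_M → 0 < B_V → 2 * B_L < q → 2 * B_M < q →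
        2 * B_V < q →
        |keyProb (unif _) (truncGaussian q B_V) 𝒜 (H q) -
          keyProb (unif _) (truncGaussian q B_V) 𝒜 (Hbar q)| ≤
        2 * (n * (ampErr q l m r B_L B_M + lweAdvantage l r q (truncGaussian q B_L) D)) +
          2 * (m * (n * B_M * shiftErr B_V)) + (q : ℝ) ^ l * (2 * (0.924 : ℝ) ^ (n / 2)) := by
  -- The circuit is chosen before the size conditions on the widths, which hold only for large `λ`,
  -- whereas a circuit is needed for every `λ`.
  obtain ⟨D, hD, hadv⟩ := exists_distinguisher 𝒜 hn l r (truncGaussian q B_L)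
  refine ⟨D, hD, fun B_M B_V hq hL0 hM0 hV0 hL hM hV => ?_⟩
  have dV := isDensity_piD fun _ : Fin m => isDensity_truncGaussian (q := q) hV0 hV
  have dS := isDensity_piD fun _ : Fin n => isDensity_seedD (q := q) (l := l) (m := m) hM0 hM
  have h1 : ∀ h : Bool, |keyProb (unif _) (truncGaussian q B_V) 𝒜 (Hset q h) -
      ex (unif (Fin m → Fin l → ZMod q)) fun B => ex (piD fun _ => seedD q l m B_M) fun x =>
        ex (unif (Fin n → Bool)) fun s => ex (piD fun _ => truncGaussian q B_V) fun e =>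
          acc 𝒜 h s (hybrid n B x) ((hybrid n B x).mulVec (vec q s) + e)| ≤
      n * (ampErr q l m r B_L B_M + lweAdvantage l r q (truncGaussian q B_L) D) := by
    intro h
    -- Moving `s` and `e` outside makes them constants for the reduction.
    have e1 : keyProb (unif _) (truncGaussian q B_V) 𝒜 (Hset q h) =
        ex (unif (Fin n → Bool)) fun s => ex (piD fun _ => truncGaussian q B_V) fun e =>
          ex (unif (Matrix (Fin m) (Fin n) (ZMod q))) fun A =>
            acc 𝒜 h s A (A.mulVec (vec q s) + e) := by
      rw [keyProb_eq, ex_comm]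
      simp only [ex_comm (unif (Matrix (Fin m) (Fin n) (ZMod q)))]
    have e2 : (ex (unif (Fin m → Fin l → ZMod q)) fun B =>
        ex (piD fun _ => seedD q l m B_M) fun x =>
        ex (unif (Fin n → Bool)) fun s => ex (piD fun _ => truncGaussian q B_V) fun e =>
          acc 𝒜 h s (hybrid n B x) ((hybrid n B x).mulVec (vec q s) + e)) =
        ex (unif (Fin n → Bool)) fun s => ex (piD fun _ => truncGaussian q B_V) fun e =>
          hybEx B_M n l fun A => acc 𝒜 h s A (A.mulVec (vec q s) + e) := by
      unfold hybEx
      simp only [ex_comm (piD fun _ : Fin n => seedD q l m B_M)]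
      rw [ex_comm]
      simp only [ex_comm (unif (Fin m → Fin l → ZMod q))]
    rw [e1, e2]
    exact abs_ex_sub_ex_le isDensity_unif fun s => abs_ex_sub_ex_le dV fun e =>
      abs_ex_sub_hybEx_le hq hL0 hM0 hL hM (fun A => abs_acc_le 𝒜 _ _ _ _) (hadv h s e)
  have h2 : ∀ h : Bool,
      |(ex (unif (Fin m → Fin l → ZMod q)) fun B => ex (piD fun _ => seedD q l m B_M) fun x =>
        ex (unif (Fin n → Bool)) fun s => ex (piD fun _ => truncGaussian q B_V) fun e =>
          acc 𝒜 h s (hybrid n B x) ((hybrid n B x).mulVec (vec q s) + e)) -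
      (ex (unif (Fin m → Fin l → ZMod q)) fun B => ex (piD fun _ => seedD q l m B_M) fun x =>
        ex (unif (Fin n → Bool)) fun s => ex (piD fun _ => truncGaussian q B_V) fun e =>
          acc 𝒜 h s (hybrid n B x) (lin B ((secrets x).mulVec (vec q s)) + e))| ≤
      m * (n * B_M * shiftErr B_V) := by
    intro h
    refine abs_ex_sub_ex_le isDensity_unif fun B => abs_ex_sub_ex_le_of_support dS (fun x hx => ?_)
      (by have := shiftErr_nonneg B_V; positivity)
    refine abs_ex_sub_ex_le isDensity_unif fun s => abs_ex_acc_lossy_le 𝒜 hV0 hV h s B x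
      fun j i => abs_valMinAbs_le fun h0 => hx ?_
    refine Finset.prod_eq_zero (Finset.mem_univ j) ?_
    have : (piD fun _ : Fin m => truncGaussian q (B_M : ℝ)) (x j).2.1 = 0 :=
      Finset.prod_eq_zero (Finset.mem_univ i) h0
    simp [seedD, prodD, this]
  have h3 := abs_ex_lossy_sub_le (l := l) 𝒜 hq hM0 hM hV0 hV
  have h1f := h1 false
  have h1t := h1 true
  have h2f := h2 false
  have h2t := h2 true
  rw [Hset_false] at h1f
  rw [Hset_true] at h1t
  rw [abs_le] at *
  constructor <;> linarith

end Bound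

/-! ### Polynomially bounded and negligible functions -/

section Asymptotics

lemma PolyBounded.mono {f g : ℕ → ℕ} (hg : PolyBounded g) (h : ∀ t, f t ≤ g t) :
    PolyBounded f := by
  obtain ⟨p, hp⟩ := hg
  exact ⟨p, fun t => (Nat.cast_le.2 (h t)).trans (hp t)⟩

lemma PolyBounded.const (c : ℕ) : PolyBounded fun _ => c :=
  ⟨Polynomial.C (c : ℝ), fun t => by simp⟩

lemma PolyBounded.add {f g : ℕ → ℕ} (hf : PolyBounded f) (hg : PolyBounded g) :
    PolyBounded fun t => f t + g t := by
  obtain ⟨p, hp⟩ := hf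
  obtain ⟨r, hr⟩ := hg
  exact ⟨p + r, fun t => by push_cast; rw [Polynomial.eval_add]; exact add_le_add (hp t) (hr t)⟩

lemma PolyBounded.mul {f g : ℕ → ℕ} (hf : PolyBounded f) (hg : PolyBounded g) :
    PolyBounded fun t => f t * g t := by
  obtain ⟨p, hp⟩ := hf
  obtain ⟨r, hr⟩ := hg
  refine ⟨p * r, fun t => ?_⟩
  push_cast
  rw [Polynomial.eval_mul]
  exact mul_le_mul (hp t) (hr t) (Nat.cast_nonneg _) ((Nat.cast_nonneg _).trans (hp t))

lemma Negligible.mono {f g : ℕ → ℝ} (hg : Negligible g) (h : ∀ᶠ t in atTop, |f t| ≤ |g t|) :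
    Negligible f := fun p => by
  refine squeeze_zero_norm' ?_ (tendsto_zero_iff_norm_tendsto_zero.1 (hg p))
  filter_upwards [h] with t ht
  rw [norm_mul, norm_mul]
  exact mul_le_mul_of_nonneg_left ht (norm_nonneg _)

lemma Negligible.abs {f : ℕ → ℝ} (hf : Negligible f) : Negligible fun t => |f t| :=
  hf.mono (Eventually.of_forall fun _ => (abs_abs _).le)

lemma Negligible.add {f g : ℕ → ℝ} (hf : Negligible f) (hg : Negligible g) :
    Negligible fun t => f t + g t := fun p => by
  simpa [mul_add] using (hf p).add (hg p)

lemma Negligible.const_mul {f : ℕ → ℝ} (hf : Negligible f) (c : ℝ) :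
    Negligible fun t => c * f t := fun p => by
  simpa [mul_left_comm] using (hf p).const_mul c

lemma Negligible.natCast_mul {f : ℕ → ℝ} (hf : Negligible f) {N : ℕ → ℕ} (hN : PolyBounded N) :
    Negligible fun t => (N t : ℝ) * f t := fun p => by
  obtain ⟨r, hr⟩ := hN
  refine squeeze_zero_norm' (Eventually.of_forall fun t => ?_)
    (tendsto_zero_iff_norm_tendsto_zero.1 (hf (p * r)))
  rw [Polynomial.eval_mul, norm_mul, norm_mul, norm_mul, norm_mul, mul_assoc]
  refine mul_le_mul_of_nonneg_left (mul_le_mul_of_nonneg_right ?_ (norm_nonneg _)) (norm_nonneg _)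
  rw [Real.norm_natCast]
  exact (hr t).trans (le_abs_self _)

/-- Comparing `g` with `X * (p ^ 2 + 1)` gives `|p / g| ≤ 1 / t`, because `|y| ≤ y ^ 2 + 1`. -/
lemma SuperPoly.negligible_inv {g : ℕ → ℝ} (hg : SuperPoly g) : Negligible fun t => (g t)⁻¹ :=
  fun p => by
  refine squeeze_zero_norm' ?_ tendsto_inv_atTop_nhds_zero_nat
  filter_upwards [hg (Polynomial.X * (p ^ 2 + 1)), eventually_gt_atTop 0] with t ht h0
  simp only [Polynomial.eval_mul, Polynomial.eval_add, Polynomial.eval_pow, Polynomial.eval_X,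
    Polynomial.eval_one] at ht
  have h0' : (0 : ℝ) < t := Nat.cast_pos.2 h0
  set y := p.eval (t : ℝ)
  have hy : |y| ≤ y ^ 2 + 1 := by
    rw [← sq_abs]; nlinarith [sq_nonneg (|y| - 1), abs_nonneg y]
  have hg0 : 0 < g t := lt_of_lt_of_le (by positivity) ht
  rw [norm_mul, norm_inv, Real.norm_eq_abs, Real.norm_eq_abs, abs_of_pos hg0, ← div_eq_mul_inv,
    div_le_iff₀ hg0, inv_mul_eq_div, le_div_iff₀ h0', mul_comm]
  exact (mul_le_mul_of_nonneg_left hy h0'.le).trans ht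

lemma Negligible.of_sq {f : ℕ → ℝ} (hf : Negligible fun t => f t ^ 2) : Negligible f := fun p => by
  have h := (hf (p ^ 2)).sqrt
  simp only [Polynomial.eval_pow, ← mul_pow, Real.sqrt_sq_eq_abs, Real.sqrt_zero] at h
  exact (tendsto_zero_iff_abs_tendsto_zero _).2 h

end Asymptotics

/-! ### Bounds on the error terms -/

section Numeric

variable {q : ℕ}

lemma bitLen_le_two_mul_logb (hq : 2 ≤ q) : (bitLen q : ℝ) ≤ 2 * Real.logb 2 q := by
  have h1 : (1 : ℝ) ≤ Real.logb 2 q := by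
    rw [Real.le_logb_iff_rpow_le (by norm_num) (by positivity)]
    simpa using (Nat.cast_le (α := ℝ)).2 hq
  have h2 := Nat.ceil_lt_add_one (zero_le_one.trans h1)
  have h3 := Real.natCeil_logb_natCast 2 q
  push_cast at h3
  rw [h3] at h2
  linarith

lemma pow_le_inv_pow (hq : 2 ≤ q) {c : ℝ} (hc0 : 0 ≤ c) (hc1 : c ≤ 1) {a b k r : ℕ}
    (h : c ^ a ≤ (1 / 2) ^ b) (hr : a * (k * bitLen q) ≤ r) :
    c ^ r ≤ ((q : ℝ)⁻¹) ^ (b * k) := by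
  have hq0 : (0 : ℝ) < q := by exact_mod_cast (by omega : 0 < q)
  have h2 : (1 / 2 : ℝ) ^ bitLen q ≤ (q : ℝ)⁻¹ := by
    rw [one_div, inv_pow]
    exact inv_anti₀ hq0 (by exact_mod_cast Nat.le_pow_clog (by norm_num) q)
  calc c ^ r ≤ c ^ (a * (k * bitLen q)) := pow_le_pow_of_le_one hc0 hc1 hr
    _ = (c ^ a) ^ (k * bitLen q) := pow_mul _ _ _
    _ ≤ ((1 / 2) ^ b) ^ (k * bitLen q) := pow_le_pow_left₀ (by positivity) h _
    _ = ((1 / 2) ^ bitLen q) ^ (b * k) := by rw [← pow_mul, ← pow_mul]; ring_nf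
    _ ≤ _ := pow_le_pow_left₀ (by positivity) h2 _

/-- Since `(3/8) ^ 4 ≤ (1/2) ^ 3`, four rows per bit turn `(3/8) ^ r` into at most `q ^ (-3 k)`,
which leaves `q ^ (-2 k)` under the root. -/
lemma hashErr_le_inv (hq : 2 ≤ q) {k r : ℕ} (hk : 1 ≤ k) (hr : 4 * (k * bitLen q) ≤ r) :
    hashErr q k r ≤ (q : ℝ)⁻¹ := by
  have hq0 : (0 : ℝ) < q := by exact_mod_cast (by omega : 0 < q)
  have hq1 : (q : ℝ)⁻¹ ≤ 1 := inv_le_one_of_one_le₀ (by exact_mod_cast (by omega : 1 ≤ q))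
  unfold hashErr
  rw [Real.sqrt_le_iff]
  refine ⟨by positivity, ?_⟩
  have h := pow_le_inv_pow (c := 3 / 8) (b := 3) hq (by norm_num) (by norm_num) (by norm_num) hr
  calc (q : ℝ) ^ k * (3 / 8) ^ r ≤ (q : ℝ) ^ k * (q : ℝ)⁻¹ ^ (3 * k) :=
        mul_le_mul_of_nonneg_left h (by positivity)
    _ = (q : ℝ)⁻¹ ^ (2 * k) := by
        rw [show 3 * k = k + 2 * k by ring, pow_add, ← mul_assoc, ← mul_pow,
          mul_inv_cancel₀ hq0.ne', one_pow, one_mul]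
    _ ≤ (q : ℝ)⁻¹ ^ 2 := pow_le_pow_of_le_one (by positivity) hq1 (by omega)

/-- Here `0.924 ^ 25 ≤ 1/4`, so the exponent `n / 2 ≥ 25 l ⌈log q⌉` beats `q ^ l` twice over. -/
lemma pow_mul_pow_half_le_inv (hq : 2 ≤ q) {l n : ℕ} (hl : 1 ≤ l) (hn : 50 * (l * bitLen q) ≤ n) :
    (q : ℝ) ^ l * (2 * (0.924 : ℝ) ^ (n / 2)) ≤ 2 * (q : ℝ)⁻¹ := by
  have hq0 : (0 : ℝ) < q := by exact_mod_cast (by omega : 0 < q)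
  have hq1 : (q : ℝ)⁻¹ ≤ 1 := inv_le_one_of_one_le₀ (by exact_mod_cast (by omega : 1 ≤ q))
  have h := pow_le_inv_pow (c := 0.924) (a := 25) (b := 2) (k := l) (r := n / 2) hq (by norm_num)
    (by norm_num) (by norm_num) (by omega)
  calc (q : ℝ) ^ l * (2 * (0.924 : ℝ) ^ (n / 2))
        ≤ (q : ℝ) ^ l * (2 * (q : ℝ)⁻¹ ^ (2 * l)) := by gcongr
    _ = 2 * (q : ℝ)⁻¹ ^ l := by
        rw [show 2 * l = l + l by ring, pow_add]
        have : (q : ℝ) ^ l * (q : ℝ)⁻¹ ^ l = 1 := by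
          rw [← mul_pow, mul_inv_cancel₀ hq0.ne', one_pow]
        linear_combination 2 * (q : ℝ)⁻¹ ^ l * this
    _ ≤ 2 * (q : ℝ)⁻¹ := by
        gcongr
        simpa using pow_le_pow_of_le_one (by positivity) hq1 hl

lemma abs_keyProb_sub_keyProb_le [Fact q.Prime] {m n : ℕ}
    {gen : Matrix (Fin m) (Fin n) (ZMod q) → ℝ} {χ : ZMod q → ℝ} (hχ : IsDensity χ)
    (𝒜 : QCircuit (SampleBit m n q) (TupleBit n q)) (h : Bool) :
    |keyProb gen χ 𝒜 (Hset q h) - keyProb (unif _) χ 𝒜 (Hset q h)| ≤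
      2 * tvDist gen (unif _) := by
  rw [keyProb_eq, keyProb_eq]
  refine (abs_ex_sub_ex_le_l1 _ _ fun A => abs_ex_le isDensity_unif fun s =>
    abs_ex_le (isDensity_piD fun _ => hχ) fun e => abs_acc_le 𝒜 h s A _).trans (le_of_eq ?_)
  unfold l1 tvDist
  ring

end Numeric

/-! ### The main theorem -/

section Main

variable {C_T : ℝ} {ℓ n m q B_L B_V : ℕ → ℕ} {B_P : ℕ → ℝ} [∀ t, Fact (q t).Prime]

omit [∀ t, Fact (q t).Prime] in
lemma Conditions.bitLen_poly (hc : Conditions 100 C_T ℓ n m q B_L B_V B_P) :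
    PolyBounded fun t => bitLen (q t) :=
  hc.w_poly.mono fun t => Nat.le_mul_of_pos_left _ (hc.n_pos t)

omit [∀ t, Fact (q t).Prime] in
lemma Conditions.B_L_pos (hc : Conditions 100 C_T ℓ n m q B_L B_V B_P) (t : ℕ) : 0 < B_L t := by
  have h1 := hc.le_B_L t
  have h2 : 0 < Real.sqrt (n t) := Real.sqrt_pos.2 (Nat.cast_pos.2 (hc.n_pos t))
  exact_mod_cast (by linarith : (0 : ℝ) < B_L t)

lemma one_le_logb (q : ℕ) [Fact q.Prime] : 1 ≤ Real.logb 2 q := by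
  rw [Real.le_logb_iff_rpow_le (by norm_num) (Nat.cast_pos.2 (Fact.out : q.Prime).pos)]
  simpa using (Nat.cast_le (α := ℝ)).2 (Fact.out : q.Prime).two_le

lemma Conditions.mul_ratio_le (hC : 0 < C_T) (hc : Conditions 100 C_T ℓ n m q B_L B_V B_P)
    (t : ℕ) : 2 * C_T * (B_P t / B_V t) * B_V t ≤ q t := by
  have hV : (0 : ℝ) < B_V t := Nat.cast_pos.2 ((hc.B_L_pos t).trans (hc.B_L_lt t))
  have hs : 1 ≤ Real.sqrt ((m t : ℝ) * (n t : ℝ) * Real.logb 2 (q t)) := by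
    rw [Real.one_le_sqrt]
    have h1 : (1 : ℝ) ≤ m t := by exact_mod_cast hc.m_pos t
    have h2 : (1 : ℝ) ≤ n t := by exact_mod_cast hc.n_pos t
    exact one_le_mul_of_one_le_of_one_le (one_le_mul_of_one_le_of_one_le h1 h2) (one_le_logb _)
  have hP : 0 < B_P t := hV.trans (hc.B_V_lt t)
  rw [mul_assoc, div_mul_cancel₀ _ hV.ne']
  have := hc.B_P_eq t
  rw [eq_div_iff (by positivity)] at this
  rw [← this]
  nlinarith [mul_le_mul_of_nonneg_left hs (by positivity : 0 ≤ 2 * C_T * B_P t)]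

/-- The modulus is at least a constant times the superpolynomial ratio `B_P / B_V`. -/
lemma Conditions.negligible_inv_q (hC : 0 < C_T) (hc : Conditions 100 C_T ℓ n m q B_L B_V B_P) :
    Negligible fun t => (q t : ℝ)⁻¹ := by
  refine (hc.ratio_PV.negligible_inv.const_mul (2 * C_T)⁻¹).mono (Eventually.of_forall fun t => ?_)
  have hV : (1 : ℝ) ≤ B_V t := by exact_mod_cast (hc.B_L_pos t).trans (hc.B_L_lt t)
  have hP : 0 < B_P t := (zero_lt_one.trans_le hV).trans (hc.B_V_lt t)
  have hr : 0 < 2 * C_T * (B_P t / B_V t) := by positivity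
  rw [← mul_inv, abs_of_nonneg (by positivity), abs_of_pos (inv_pos.2 hr)]
  exact inv_anti₀ hr ((le_mul_of_one_le_right hr.le hV).trans (hc.mul_ratio_le hC t))

lemma Conditions.eventually_two_mul_B_V_lt (hC : 0 < C_T)
    (hc : Conditions 100 C_T ℓ n m q B_L B_V B_P) : ∀ᶠ t in atTop, 2 * B_V t < q t := by
  filter_upwards [hc.ratio_PV (Polynomial.C (2 / C_T))] with t ht
  rw [Polynomial.eval_C, div_le_iff₀ hC] at ht
  have hV : (0 : ℝ) < B_V t := Nat.cast_pos.2 ((hc.B_L_pos t).trans (hc.B_L_lt t))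
  have h := hc.mul_ratio_le hC t
  have : (2 * B_V t : ℝ) < q t := by nlinarith
  exact_mod_cast this

/-- The width of the noise in the lossy mode. -/
def midWidth (B_L B_V : ℕ) : ℕ := Nat.sqrt (B_L * B_V)

lemma midWidth_pos {B_L B_V : ℕ} (hL : 0 < B_L) (hV : B_L < B_V) : 0 < midWidth B_L B_V :=
  Nat.sqrt_pos.2 (Nat.mul_pos hL (hL.trans hV))

lemma midWidth_le {B_L B_V : ℕ} (hV : B_L < B_V) : midWidth B_L B_V ≤ B_V :=
  (Nat.sqrt_le_sqrt (Nat.mul_le_mul_right _ hV.le)).trans (Nat.sqrt_eq _).le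

-- The square of this quotient is at most `B_L / B_V`, by the choice of the geometric mean.
omit [∀ t, Fact (q t).Prime] in
lemma Conditions.negligible_midWidth_div (hc : Conditions 100 C_T ℓ n m q B_L B_V B_P) :
    Negligible fun t => (midWidth (B_L t) (B_V t) : ℝ) / B_V t := by
  refine Negligible.of_sq (hc.ratio_VL.negligible_inv.mono (Eventually.of_forall fun t => ?_))
  have hV : (0 : ℝ) < B_V t := Nat.cast_pos.2 ((hc.B_L_pos t).trans (hc.B_L_lt t))
  have h : (midWidth (B_L t) (B_V t) : ℝ) ^ 2 ≤ B_L t * B_V t := by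
    exact_mod_cast Nat.sqrt_le' _
  rw [abs_of_nonneg (by positivity), abs_of_nonneg (by positivity), inv_div, div_pow,
    div_le_div_iff₀ (by positivity) hV]
  nlinarith

omit [∀ t, Fact (q t).Prime] in
lemma Conditions.negligible_div_midWidth (hc : Conditions 100 C_T ℓ n m q B_L B_V B_P) :
    Negligible fun t => (B_L t : ℝ) / midWidth (B_L t) (B_V t) := by
  refine Negligible.of_sq ((hc.ratio_VL.negligible_inv.const_mul 4).mono
    (Eventually.of_forall fun t => ?_))
  have hV : (0 : ℝ) < B_V t := Nat.cast_pos.2 ((hc.B_L_pos t).trans (hc.B_L_lt t))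
  have hL : (0 : ℝ) < B_L t := Nat.cast_pos.2 (hc.B_L_pos t)
  have hM : (1 : ℝ) ≤ midWidth (B_L t) (B_V t) := by
    exact_mod_cast midWidth_pos (hc.B_L_pos t) (hc.B_L_lt t)
  have h : (B_L t * B_V t : ℝ) ≤ ((midWidth (B_L t) (B_V t) : ℝ) + 1) ^ 2 := by
    exact_mod_cast (Nat.lt_succ_sqrt' (B_L t * B_V t)).le
  rw [abs_of_nonneg (by positivity), abs_of_nonneg (by positivity), inv_div, div_pow,
    ← mul_div_assoc, div_le_div_iff₀ (by positivity) hV]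
  -- Rounding down the square root costs a factor `4`, since `M + 1 ≤ 2 M` for `M ≥ 1`.
  have h4 : (B_L t * B_V t : ℝ) ≤ 4 * (midWidth (B_L t) (B_V t) : ℝ) ^ 2 := by nlinarith
  nlinarith [mul_le_mul_of_nonneg_left h4 hL.le]

/-- The number of LWE samples that the reduction uses. -/
def numSamples (l q : ℕ) : ℕ := 4 * ((l + 1) * bitLen q)

omit [∀ t, Fact (q t).Prime] in
lemma Conditions.numSamples_poly (hc : Conditions 100 C_T ℓ n m q B_L B_V B_P) :
    PolyBounded fun t => numSamples (ℓ t) (q t) :=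
  (PolyBounded.const 4).mul ((hc.ell_poly.add (.const 1)).mul hc.bitLen_poly)

omit [∀ t, Fact (q t).Prime] in
lemma Conditions.redCost_poly (hc : Conditions 100 C_T ℓ n m q B_L B_V B_P) :
    PolyBounded fun t => redCost (numSamples (ℓ t) (q t)) (ℓ t) (m t) (n t) (q t) := by
  have hb := hc.bitLen_poly
  have hr := hc.numSamples_poly
  have hadd : PolyBounded fun t => addCost (q t) := (PolyBounded.const 200).mul (hb.add (.const 2))
  have haff : PolyBounded fun t =>
      affineCost (q t) (numSamples (ℓ t) (q t) * ℓ t + numSamples (ℓ t) (q t)) :=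
    (((hr.mul hc.ell_poly).add hr).add (.const 1)).mul
      ((((PolyBounded.const 2).mul hb).add (.const 3)).mul hadd)
  have htest : PolyBounded fun t => testCost (n t) (q t) :=
    (((PolyBounded.const 2000).mul (hc.n_poly.add (.const 1))).mul (hb.add (.const 2))).add
      (((PolyBounded.const 20).mul hc.n_poly).mul hadd)
  have hout : PolyBounded fun t => m t * n t + m t := (hc.m_poly.mul hc.n_poly).add hc.m_poly
  exact ((((PolyBounded.const 2).mul (hout.mul hb)).add ((PolyBounded.const 3).mul
    ((((hr.mul hc.ell_poly).add hr).mul hb).add (hout.mul haff)))).add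
      ((PolyBounded.const 3).mul htest)).add (.const 2)

/-- The constant `100` drops to `50` because `⌈log q⌉ ≤ 2 log q`. -/
lemma Conditions.eventually_le_n (hc : Conditions 100 C_T ℓ n m q B_L B_V B_P) :
    ∀ᶠ t in atTop, 50 * (ℓ t * bitLen (q t)) ≤ n t := by
  filter_upwards [hc.n_large] with t ht
  have h := mul_le_mul_of_nonneg_left
    (bitLen_le_two_mul_logb (Fact.out : (q t).Prime).two_le) (Nat.cast_nonneg (α := ℝ) (ℓ t))
  have : (50 * (ℓ t * bitLen (q t)) : ℝ) ≤ n t := by linarith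
  exact_mod_cast this

lemma Conditions.eventually_le_m (hc : Conditions 100 C_T ℓ n m q B_L B_V B_P) :
    ∀ᶠ t in atTop, 50 * (n t * bitLen (q t)) ≤ m t := by
  filter_upwards [hc.m_large] with t ht
  have h := mul_le_mul_of_nonneg_left
    (bitLen_le_two_mul_logb (Fact.out : (q t).Prime).two_le) (Nat.cast_nonneg (α := ℝ) (n t))
  have : (50 * (n t * bitLen (q t)) : ℝ) ≤ m t := by linarith
  exact_mod_cast this

lemma Conditions.negligible_tvDist_genTrap (hC : 0 < C_T)
    (hc : Conditions 100 C_T ℓ n m q B_L B_V B_P) :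
    Negligible fun t => tvDist (genTrap (m t) (n t) (q t)) (unif _) := by
  refine ((hc.negligible_inv_q hC).natCast_mul hc.w_poly).mono ?_
  filter_upwards [hc.eventually_le_m, hc.eventually_two_mul_B_V_lt hC] with t hm hV
  have hV1 := (hc.B_L_pos t).trans (hc.B_L_lt t)
  rw [abs_of_nonneg (by unfold tvDist; positivity), abs_of_nonneg (by positivity)]
  refine (tvDist_genTrap_le (by omega) (by omega)).trans ?_
  exact mul_le_mul_of_nonneg_left
    (hashErr_le_inv (Fact.out : (q t).Prime).two_le (hc.n_pos t) (by omega)) (Nat.cast_nonneg _)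

/-- The hardcore property for uniform matrices. -/
lemma Conditions.negligible_keyProb_unif (hC : 0 < C_T)
    (hc : Conditions 100 C_T ℓ n m q B_L B_V B_P)
    (hLWE : LWEAssumption ℓ q fun t => truncGaussian (q t) (B_L t))
    (𝒜 : ∀ t, QCircuit (SampleBit (m t) (n t) (q t)) (TupleBit (n t) (q t))) (h𝒜 : PolySize 𝒜) :
    Negligible fun t => keyProb (unif _) (truncGaussian (q t) (B_V t)) (𝒜 t) (H (q t)) -
      keyProb (unif _) (truncGaussian (q t) (B_V t)) (𝒜 t) (Hbar (q t)) := by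
  choose D hD hbound using fun t => exists_distinguisher_abs_keyProb_sub_le (𝒜 t) (hc.n_pos t)
    (ℓ t) (numSamples (ℓ t) (q t)) (B_L t)
  have hadv : Negligible fun t => lweAdvantage (ℓ t) (numSamples (ℓ t) (q t)) (q t)
      (truncGaussian (q t) (B_L t)) (D t) := by
    -- `ℓ + 1 ≤ 2 ℓ` and `⌈log q⌉ ≤ 2 log q` bound the number of samples by `16 ℓ log q`, as the
    -- assumption requires.
    refine hLWE _ ⟨16 * Polynomial.X, fun t => ?_⟩ D ((h𝒜.add hc.redCost_poly).mono hD)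
    have h1 := bitLen_le_two_mul_logb (Fact.out : (q t).Prime).two_le
    have h2 : (1 : ℝ) ≤ ℓ t := by exact_mod_cast hc.ell_pos t
    have h3 := one_le_logb (q t)
    unfold numSamples
    push_cast
    simp only [Polynomial.eval_mul, Polynomial.eval_ofNat, Polynomial.eval_X]
    calc 4 * (((ℓ t : ℝ) + 1) * bitLen (q t)) ≤ 4 * ((ℓ t + ℓ t) * (2 * Real.logb 2 (q t))) := by
          gcongr
      _ = _ := by ring
  have hq := hc.negligible_inv_q hC
  have hLM := hc.negligible_div_midWidth
  have hMV := hc.negligible_midWidth_div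
  have hamp : Negligible fun t => (m t : ℝ) * (q t : ℝ)⁻¹ + (m t : ℝ) * ((numSamples (ℓ t) (q t) : ℝ)
      * (Real.exp Real.pi * (B_L t / midWidth (B_L t) (B_V t)))) + (m t : ℝ) * (q t : ℝ)⁻¹ :=
    ((hq.natCast_mul hc.m_poly).add (((hLM.const_mul _).natCast_mul
      hc.numSamples_poly).natCast_mul hc.m_poly)).add (hq.natCast_mul hc.m_poly)
  refine (((((hamp.add hadv).natCast_mul hc.n_poly).const_mul 2).add
    ((((hMV.const_mul (Real.exp Real.pi)).natCast_mul hc.n_poly).natCast_mul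
      hc.m_poly).const_mul 2)).add (hq.const_mul 2)).mono ?_
  filter_upwards [hc.eventually_le_n, hc.eventually_two_mul_B_V_lt hC] with t hn hV
  have hq2 := (Fact.out : (q t).Prime).two_le
  have hL0 := hc.B_L_pos t
  have hLV := hc.B_L_lt t
  have hM := midWidth_le hLV
  refine (hbound t (midWidth (B_L t) (B_V t)) (B_V t) (by omega) hL0 (midWidth_pos hL0 hLV)
    (by omega) (by omega) (by omega) hV).trans (le_trans ?_ (le_abs_self _))
  have e1 : hashErr (q t) (ℓ t) (numSamples (ℓ t) (q t)) ≤ (q t : ℝ)⁻¹ :=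
    hashErr_le_inv hq2 (hc.ell_pos t) (Nat.mul_le_mul_left _ (Nat.mul_le_mul_right _ (by omega)))
  have e2 : hashErr (q t) (ℓ t + 1) (numSamples (ℓ t) (q t)) ≤ (q t : ℝ)⁻¹ :=
    hashErr_le_inv hq2 (by omega) le_rfl
  have e3 := pow_mul_pow_half_le_inv hq2 (hc.ell_pos t) hn
  have e4 : (numSamples (ℓ t) (q t) : ℝ) * B_L t * shiftErr (midWidth (B_L t) (B_V t)) =
      numSamples (ℓ t) (q t) * (Real.exp Real.pi * (B_L t / midWidth (B_L t) (B_V t))) := by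
    unfold shiftErr; ring
  have e5 : (n t : ℝ) * midWidth (B_L t) (B_V t) * shiftErr (B_V t) =
      n t * (Real.exp Real.pi * (midWidth (B_L t) (B_V t) / B_V t)) := by
    unfold shiftErr; ring
  unfold ampErr
  rw [e4, e5]
  gcongr

/-- The hardcore property for matrices that are statistically close to uniform. -/
lemma Conditions.negligible_keyProb (hC : 0 < C_T)
    (hc : Conditions 100 C_T ℓ n m q B_L B_V B_P)
    (hLWE : LWEAssumption ℓ q fun t => truncGaussian (q t) (B_L t))
    (𝒜 : ∀ t, QCircuit (SampleBit (m t) (n t) (q t)) (TupleBit (n t) (q t))) (h𝒜 : PolySize 𝒜)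
    (gen : ∀ t, Matrix (Fin (m t)) (Fin (n t)) (ZMod (q t)) → ℝ)
    (hgen : Negligible fun t => tvDist (gen t) (unif _)) :
    Negligible fun t => keyProb (gen t) (truncGaussian (q t) (B_V t)) (𝒜 t) (H (q t)) -
      keyProb (gen t) (truncGaussian (q t) (B_V t)) (𝒜 t) (Hbar (q t)) := by
  -- Each of the two probabilities moves by at most twice the total variation distance, hence the
  -- `4`.
  refine ((hc.negligible_keyProb_unif hC hLWE 𝒜 h𝒜).abs.add (hgen.const_mul 4)).mono ?_
  filter_upwards [hc.eventually_two_mul_B_V_lt hC] with t hV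
  have hχ := isDensity_truncGaussian ((hc.B_L_pos t).trans (hc.B_L_lt t)) hV
  have h0 := abs_keyProb_sub_keyProb_le (gen := gen t) hχ (𝒜 t) false
  have h1 := abs_keyProb_sub_keyProb_le (gen := gen t) hχ (𝒜 t) true
  rw [Hset_false] at h0
  rw [Hset_true] at h1
  refine le_trans ?_ (le_abs_self _)
  have h2 := le_abs_self (keyProb (unif _) (truncGaussian (q t) (B_V t)) (𝒜 t) (H (q t)) -
    keyProb (unif _) (truncGaussian (q t) (B_V t)) (𝒜 t) (Hbar (q t)))
  have h3 := neg_abs_le (keyProb (unif _) (truncGaussian (q t) (B_V t)) (𝒜 t) (H (q t)) -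
    keyProb (unif _) (truncGaussian (q t) (B_V t)) (𝒜 t) (Hbar (q t)))
  rw [abs_le] at h0 h1 ⊢
  constructor <;> linarith

end Main

end LWE

theorem mainTheorem3 :
    ∃ C : ℝ, 0 < C ∧
      ∀ (C_T : ℝ) (ℓ n m q B_L B_V : ℕ → ℕ) (B_P : ℕ → ℝ) [∀ t, Fact (q t).Prime],
        0 < C_T →
        LWE.Conditions C C_T ℓ n m q B_L B_V B_P →
        LWE.LWEAssumption ℓ q (fun t => LWE.truncGaussian (q t) (B_L t)) →
        ∀ 𝒜 : ∀ t, LWE.QCircuit (LWE.SampleBit (m t) (n t) (q t)) (LWE.TupleBit (n t) (q t)),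
          LWE.PolySize 𝒜 →
          (∃ μ : ℕ → ℝ, LWE.Negligible μ ∧ ∀ t,
            |LWE.keyProb (LWE.genTrap (m t) (n t) (q t))
                (LWE.truncGaussian (q t) (B_V t)) (𝒜 t) (LWE.H (q t)) -
              LWE.keyProb (LWE.genTrap (m t) (n t) (q t))
                (LWE.truncGaussian (q t) (B_V t)) (𝒜 t) (LWE.Hbar (q t))| ≤ μ t) ∧
          ∀ gen : ∀ t, Matrix (Fin (m t)) (Fin (n t)) (ZMod (q t)) → ℝ,
            (∀ t, LWE.IsDensity (gen t)) →
            (LWE.Negligible fun t => LWE.tvDist (gen t) (LWE.unif _)) →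
            ∃ μ : ℕ → ℝ, LWE.Negligible μ ∧ ∀ t,
              |LWE.keyProb (gen t)
                  (LWE.truncGaussian (q t) (B_V t)) (𝒜 t) (LWE.H (q t)) -
                LWE.keyProb (gen t)
                  (LWE.truncGaussian (q t) (B_V t)) (𝒜 t) (LWE.Hbar (q t))| ≤ μ t := by
  refine ⟨100, by norm_num, fun C_T ℓ n m q B_L B_V B_P _ hC hc hLWE 𝒜 h𝒜 => ⟨?_, ?_⟩⟩
  · exact ⟨_, (hc.negligible_keyProb hC hLWE 𝒜 h𝒜 _ (hc.negligible_tvDist_genTrap hC)).abs,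
      fun _ => le_rfl⟩
  · exact fun gen _ hgen => ⟨_, (hc.negligible_keyProb hC hLWE 𝒜 h𝒜 gen hgen).abs,
      fun _ => le_rfl⟩
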